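/- Let $p\neq q$ be coprime positive integers. In $\mathbb C^2=\mathbb R^4$ let $C_{pq}=\{r\gamma_{pq}(\theta): r\ge 0,\ 0\le\theta<2\pi\}$ be the Schoen–Wolfson cone over $$\gamma_{pq}(\theta)=\Big(\sqrt{\tfrac{q}{p+q}}\,e^{ip\theta},\ i\sqrt{\tfrac{p}{p+q}}\,e^{-iq\theta}\Big),$$ and let the companion cone $C'_{pq}$ be the image of $C_{pq}$ under $\mathrm{diag}(1,-1)$ if $p$ is odd and under $\mathrm{diag}(-1,1)$ if $p$ is even. Conventions. A Hamiltonian stationary surface is a proper smooth immersion $F:M\to\mathbb C^2$ of a surface without boundary (not necessarily connected or orientable) which is Lagrangian and whose (local) Lagrangian angle $\beta$, $*(dz^1\wedge dz^2)=e^{i\beta}$, is harmonic for the induced metric. With $H$ the mean curvature vector, it is a self-shrinker if $F^\perp=2cH$ for some constant $c<0$, and a self-expander if $F^\perp=2cH$ for some constant $c>0$. For a two-dimensional varifold $V$ with weight $\|V\|$, a locally integrable field $h=h(V)$ is its generalized mean curvature if $\delta V(X)=-\int\langle h,X\rangle\,d\|V\|$ for all $X\in C^1_c$. For $0\le\phi\in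 C^1_c(\mathbb R^4)$ put $\delta(V,\phi)(h)=-\int\phi|h|^2d\|V\|+\int D\phi\cdot h\,d\|V\|$, which is $-\infty$ if $\int\phi|h|^2d\|V\|=\infty$. A family $V_t$, each member having a generalized mean curvature, is a Brakke motion if $$\limsup_{s\to t}\frac{\|V_s\|(\phi)-\|V_t\|(\phi)}{s-t}\le\delta(V_t,\phi)(h(V_t))\quad\text{for all } t \text{ and all } 0\le\phi\in C^1_c(\mathbb R^4).$$ It is without mass loss if each $t\mapsto\|V_t\|(\phi)$ is continuous and the difference quotients converge in $[-\infty,\infty]$ as $s\to t$ to $\delta(V_t,\phi)(h(V_t))$, for all $t$ and $\phi$. **Theorem 1.1.** One has $C_{pq}\cap C'_{pq}=\{0\}$, and there is a Brakke motion $V_t$, $-\infty<t<\infty$, without mass loss such that: 1. there are a smooth immersed Hamiltonian stationary self-shrinker $F$ in $\mathbb C^2$ and a constant $c<0$ such that for every $t<0$ the varifold $V_t$ is the one induced by the immersion $F_t=\sqrt{t/c}\,F$, and $F_t$ is a Hamiltonian stationary self-shrinker with $F_t^\perp=2tH$; 2. there are a smooth immersed Hamiltonian stationary self-expander $F$ in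 $\mathbb C^2$ and a constant $c>0$ such that for every $t>0$ the varifold $V_t$ is the one induced by the immersion $F_t=\sqrt{t/c}\,F$, and $F_t$ is a Hamiltonian stationary self-expander with $F_t^\perp=2tH$; 3. $V_0$ is the multiplicity-one varifold of $C_{pq}\cup C'_{pq}$, and $V_t\to V_0$ as varifolds as $t\to0^-$ and as $t\to0^+$. -/

import Mathlib

open MeasureTheory Filter Topology
open scoped Manifold ContDiff

noncomputable section

namespace SchoenWolfson

/-- `ℂ²` with its Hermitian norm; the real inner product is the Euclidean one on `ℝ⁴`,
and the complex structure `J` is multiplication by `Complex.I`. -/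
abbrev C2 : Type := EuclideanSpace ℂ (Fin 2)

/-! ### Local geometry of a parametrised surface `f : ℝ² → ℂ²` -/

/-- The coordinate vectors of `ℝ × ℝ`. -/
def basisVec (i : Fin 2) : ℝ × ℝ := if i = 0 then (1, 0) else (0, 1)

/-- Partial derivative `∂ᵢ f (u)`. -/
def pd {G : Type*} [NormedAddCommGroup G] [NormedSpace ℝ G]
    (i : Fin 2) (f : ℝ × ℝ → G) (u : ℝ × ℝ) : G :=
  fderiv ℝ f u (basisVec i)

/-- The induced metric `g i j = ⟨∂ᵢ f, ∂ⱼ f⟩`. -/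
def metric (f : ℝ × ℝ → C2) (u : ℝ × ℝ) : Matrix (Fin 2) (Fin 2) ℝ :=
  Matrix.of fun i j => inner ℝ (pd i f u) (pd j f u)

/-- The area density `√(det g)`. -/
def areaDensity (f : ℝ × ℝ → C2) (u : ℝ × ℝ) : ℝ := Real.sqrt (metric f u).det

/-- The tangent plane, i.e. the range of the differential. -/
def tangentPlane (f : ℝ × ℝ → C2) (u : ℝ × ℝ) : Submodule ℝ C2 :=
  LinearMap.range (fderiv ℝ f u : ℝ × ℝ →ₗ[ℝ] C2)

/-- Orthogonal projection of `ℂ² = ℝ⁴` onto the tangent plane. -/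
def tangentProj (f : ℝ × ℝ → C2) (u : ℝ × ℝ) : C2 →L[ℝ] C2 :=
  (tangentPlane f u).starProjection

/-- The normal component `v^⊥` of a vector. -/
def normalPart (f : ℝ × ℝ → C2) (u : ℝ × ℝ) (v : C2) : C2 := v - tangentProj f u v

/-- The mean curvature vector, the trace `g^{ij} (∂ᵢ∂ⱼ f)^⊥` of the second fundamental form. -/
def meanCurvature (f : ℝ × ℝ → C2) (u : ℝ × ℝ) : C2 :=
  ∑ i, ∑ j, (metric f u)⁻¹ i j • normalPart f u (pd i (pd j f) u)

/-- The Laplace–Beltrami operator of the induced metric,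
`(det g)^{-1/2} ∂ᵢ ((det g)^{1/2} g^{ij} ∂ⱼ β)`. -/
def laplaceBeltrami (f : ℝ × ℝ → C2) (β : ℝ × ℝ → ℝ) (u : ℝ × ℝ) : ℝ :=
  (areaDensity f u)⁻¹ *
    ∑ i, pd i (fun v => areaDensity f v * ∑ j, (metric f v)⁻¹ i j * pd j β v) u

/-- The value of `dz¹ ∧ dz²` on the coordinate frame `(∂₀ f, ∂₁ f)`. -/
def holVolume (f : ℝ × ℝ → C2) (u : ℝ × ℝ) : ℂ :=
  (pd 0 f u) 0 * (pd 1 f u) 1 - (pd 0 f u) 1 * (pd 1 f u) 0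

/-- `β` is a Lagrangian angle at `u`: `*(dz¹ ∧ dz²) = e^{iβ}` (orientation of the coordinates). -/
def IsLagrangianAngleAt (f : ℝ × ℝ → C2) (β : ℝ × ℝ → ℝ) (u : ℝ × ℝ) : Prop :=
  holVolume f u = (areaDensity f u : ℂ) * Complex.exp ((β u : ℂ) * Complex.I)

/-! ### Immersed surfaces -/

/-- A smooth surface without boundary: not necessarily orientable, not necessarily connected. -/
structure SmoothSurface where
  carrier : Type
  [top : TopologicalSpace carrier]
  [hausdorff : T2Space carrier]
  [secondCountable : SecondCountableTopology carrier]
  [charted : ChartedSpace (ℝ × ℝ) carrier]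
  [manifold : IsManifold 𝓘(ℝ, ℝ × ℝ) ∞ carrier]
  [meas : MeasurableSpace carrier]
  [borelSpace : BorelSpace carrier]

attribute [instance] SmoothSurface.top SmoothSurface.hausdorff SmoothSurface.secondCountable
  SmoothSurface.charted SmoothSurface.manifold SmoothSurface.meas SmoothSurface.borelSpace

/-- The coordinate expression of `F` in the preferred chart at `x`. -/
def localRep (M : SmoothSurface) (F : M.carrier → C2) (x : M.carrier) : ℝ × ℝ → C2 :=
  fun u => F ((chartAt (ℝ × ℝ) x).symm u)

/-- The coordinates of `x` in the preferred chart at `x`. -/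
def coord (M : SmoothSurface) (x : M.carrier) : ℝ × ℝ := chartAt (ℝ × ℝ) x x

/-- A proper (hence complete) smooth immersion into `ℂ²`. -/
structure IsProperImmersion (M : SmoothSurface) (F : M.carrier → C2) : Prop where
  smooth : ContMDiff 𝓘(ℝ, ℝ × ℝ) 𝓘(ℝ, C2) ∞ F
  immersive : ∀ x, Function.Injective (fderiv ℝ (localRep M F x) (coord M x))
  proper : IsProperMap F

/-- The symplectic form vanishes on all tangent planes. -/
def IsLagrangian (M : SmoothSurface) (F : M.carrier → C2) : Prop :=
  ∀ x v w, inner ℝ (Complex.I • fderiv ℝ (localRep M F x) (coord M x) v)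
    (fderiv ℝ (localRep M F x) (coord M x) w) = 0

/-- The Lagrangian angle is harmonic. The angle is only defined up to constants
(and is multivalued in general), so the condition is imposed on a smooth local determination
near each point. -/
def HasHarmonicAngle (M : SmoothSurface) (F : M.carrier → C2) : Prop :=
  ∀ x, ∃ β : ℝ × ℝ → ℝ, ContDiffAt ℝ ∞ β (coord M x) ∧
    (∀ᶠ u in 𝓝 (coord M x), IsLagrangianAngleAt (localRep M F x) β u) ∧
    laplaceBeltrami (localRep M F x) β (coord M x) = 0

/-- A properly immersed smooth Hamiltonian stationary Lagrangian surface. -/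
structure IsHamiltonianStationary (M : SmoothSurface) (F : M.carrier → C2) : Prop where
  immersion : IsProperImmersion M F
  lagrangian : IsLagrangian M F
  harmonic : HasHarmonicAngle M F

/-- The self-similarity equation `F^⊥ = 2 c H`; a self-shrinker if `c < 0`, a self-expander if
`c > 0`. -/
def IsSelfSimilar (M : SmoothSurface) (F : M.carrier → C2) (c : ℝ) : Prop :=
  ∀ x, normalPart (localRep M F x) (coord M x) (F x) =
    (2 * c) • meanCurvature (localRep M F x) (coord M x)

/-- `σ` is the Riemannian area measure of the metric induced by `F`: in each chart it has density
`√(det g)`. -/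
def IsAreaMeasure (M : SmoothSurface) (F : M.carrier → C2) (σ : Measure M.carrier) : Prop :=
  ∀ x, ∀ A : Set M.carrier, MeasurableSet A → A ⊆ (chartAt (ℝ × ℝ) x).source →
    σ A = ∫⁻ u in (chartAt (ℝ × ℝ) x).target ∩ (chartAt (ℝ × ℝ) x).symm ⁻¹' A,
      ENNReal.ofReal (areaDensity (localRep M F x) u)

/-! ### Varifolds and Brakke motion -/

/-- `P` is the orthogonal projection onto a (real) plane of `ℂ² = ℝ⁴`. -/
def IsPlaneProj (P : C2 →L[ℝ] C2) : Prop :=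
  P ∘L P = P ∧ (∀ v w, inner ℝ (P v) w = inner ℝ v (P w)) ∧
    Module.finrank ℝ (LinearMap.range (P : C2 →ₗ[ℝ] C2)) = 2

/-- A two-dimensional varifold in `ℂ²`: a Radon measure on `ℂ² × G(4,2)`, where a plane is
represented by the orthogonal projection onto it. -/
structure Varifold where
  toMeasure : Measure (C2 × (C2 →L[ℝ] C2))
  finite_on_compacts : ∀ K : Set C2, IsCompact K → toMeasure (K ×ˢ Set.univ) < ⊤
  ae_plane : ∀ᵐ z ∂toMeasure, IsPlaneProj z.2

/-- The weight measure `‖V‖`. -/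
def Varifold.weight (V : Varifold) : Measure C2 := V.toMeasure.map Prod.fst

/-- `‖V‖(φ)`. -/
def Varifold.mass (V : Varifold) (φ : C2 → ℝ) : ℝ := ∫ x, φ x ∂V.weight

/-- The first variation `δV(X) = ∫ div_S X dV(x, S)`, with `div_S X = tr (P_S ∘ DX)`. -/
def Varifold.firstVariation (V : Varifold) (X : C2 → C2) : ℝ :=
  ∫ z, LinearMap.trace ℝ C2 ((z.2 ∘L fderiv ℝ X z.1 : C2 →L[ℝ] C2) : C2 →ₗ[ℝ] C2) ∂V.toMeasure

/-- `h` is the generalized mean curvature vector of `V`: `δV(X) = -∫ ⟨h, X⟩ d‖V‖` for all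
compactly supported `C¹` vector fields (in particular `δV` has no singular part). It is unique
up to `‖V‖`-null sets. -/
def Varifold.IsGenMeanCurvature (V : Varifold) (h : C2 → C2) : Prop :=
  LocallyIntegrable h V.weight ∧
    ∀ X : C2 → C2, ContDiff ℝ 1 X → HasCompactSupport X →
      V.firstVariation X = -∫ x, inner ℝ (h x) (X x) ∂V.weight

/-- Nonnegative compactly supported `C¹` functions. -/
structure IsTestFunction (φ : C2 → ℝ) : Prop where
  contDiff : ContDiff ℝ 1 φ
  compact : HasCompactSupport φ
  nonneg : ∀ x, 0 ≤ φ x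

open Classical in
/-- `δ(V, φ)(h) = -∫ φ |h|² d‖V‖ + ∫ Dφ · h d‖V‖`, which is `-∞` when `∫ φ |h|² d‖V‖ = ∞`. -/
def Varifold.brakkeTerm (V : Varifold) (φ : C2 → ℝ) (h : C2 → C2) : EReal :=
  if Integrable (fun x => φ x * ‖h x‖ ^ 2) V.weight then
    ((-(∫ x, φ x * ‖h x‖ ^ 2 ∂V.weight) + ∫ x, fderiv ℝ φ x (h x) ∂V.weight : ℝ) : EReal)
  else ⊥

/-- The difference quotient `(‖V_s‖(φ) - ‖V_t‖(φ)) / (s - t)`. -/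
def diffQuot (V : ℝ → Varifold) (φ : C2 → ℝ) (t s : ℝ) : EReal :=
  ((((V s).mass φ - (V t).mass φ) / (s - t) : ℝ) : EReal)

/-- A family of varifolds, with generalized mean curvature `h(V_t)` at every time, is a Brakke
motion if the upper derivative of `‖V_t‖(φ)` is at most `δ(V_t, φ)(h(V_t))`. -/
def IsBrakkeMotion (V : ℝ → Varifold) : Prop :=
  ∀ t, ∃ h, (V t).IsGenMeanCurvature h ∧
    ∀ φ, IsTestFunction φ → limsup (diffQuot V φ t) (𝓝[≠] t) ≤ (V t).brakkeTerm φ h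

/-- No mass loss: the masses `‖V_t‖(φ)` vary continuously, and equality holds in Brakke's
inequality at every time, the upper derivative being a limit in `[-∞, ∞]`. -/
def HasNoMassLoss (V : ℝ → Varifold) : Prop :=
  (∀ φ, IsTestFunction φ → Continuous fun t => (V t).mass φ) ∧
    ∀ t, ∃ h, (V t).IsGenMeanCurvature h ∧
      ∀ φ, IsTestFunction φ → Tendsto (diffQuot V φ t) (𝓝[≠] t) (𝓝 ((V t).brakkeTerm φ h))

/-- Convergence of varifolds, i.e. weak convergence of Radon measures on `ℂ² × G(4,2)`. -/
def VarifoldTendsto (V : ℝ → Varifold) (l : Filter ℝ) (W : Varifold) : Prop :=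
  ∀ f : C2 × (C2 →L[ℝ] C2) → ℝ, Continuous f → HasCompactSupport f →
    Tendsto (fun t => ∫ z, f z ∂(V t).toMeasure) l (𝓝 (∫ z, f z ∂W.toMeasure))

/-- `V` is the varifold of the immersed surface `F`: the image of the area measure under
`x ↦ (F x, T_x)`. -/
def IsVarifoldOf (M : SmoothSurface) (F : M.carrier → C2) (V : Varifold) : Prop :=
  ∃ σ : Measure M.carrier, IsAreaMeasure M F σ ∧
    V.toMeasure = σ.map fun x => (F x, tangentProj (localRep M F x) (coord M x))

/-! ### The cones -/

/-- The Schoen–Wolfson curve `γ_{pq}` in `S³`. -/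
def curve (p q : ℕ) (θ : ℝ) : C2 :=
  !₂[(Real.sqrt ((q : ℝ) / (p + q)) : ℂ) * Complex.exp (((p * θ : ℝ) : ℂ) * Complex.I),
    Complex.I * (Real.sqrt ((p : ℝ) / (p + q)) : ℂ) *
      Complex.exp (((-(q * θ) : ℝ) : ℂ) * Complex.I)]

/-- The image of `γ_{pq}` under `diag(1, -1)` if `p` is odd, under `diag(-1, 1)` if `p` is even. -/
def companionCurve (p q : ℕ) (θ : ℝ) : C2 :=
  if Odd p then !₂[curve p q θ 0, -(curve p q θ 1)] else !₂[-(curve p q θ 0), curve p q θ 1]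

/-- The cone over a closed curve `γ θ`, `0 ≤ θ < 2π`. -/
def cone (γ : ℝ → C2) : Set C2 :=
  {x | ∃ r : ℝ, 0 ≤ r ∧ ∃ θ ∈ Set.Ico 0 (2 * Real.pi), x = r • γ θ}

/-- The polar parametrisation `(r, θ) ↦ r γ(θ)`. -/
def coneParam (γ : ℝ → C2) (u : ℝ × ℝ) : C2 := u.1 • γ u.2

/-- The measure on `ℂ² × G(4,2)` given by the cone over `γ`, with its area and its tangent planes.
For injective `γ` this is the multiplicity-one varifold of the cone. -/
def coneMeasure (γ : ℝ → C2) : Measure (C2 × (C2 →L[ℝ] C2)) :=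
  ((volume.restrict (Set.Ioi (0 : ℝ) ×ˢ Set.Ioo (0 : ℝ) (2 * Real.pi))).withDensity
    fun u => ENNReal.ofReal (areaDensity (coneParam γ) u)).map
    fun u => (coneParam γ u, tangentProj (coneParam γ) u)

/-- The Schoen–Wolfson cone `C_{pq}`. -/
def swCone (p q : ℕ) : Set C2 := cone (curve p q)

/-- The companion cone `C'_{pq}`. -/
def companionCone (p q : ℕ) : Set C2 := cone (companionCurve p q)

end SchoenWolfson

end

open MeasureTheory Filter Topology
open scoped Manifold ContDiff
noncomputable section
namespace SchoenWolfson

/-! ### Moving frames -/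

/-! Everything takes place in the coordinates $z^1=(y_1/\sqrt p)\,e^{ip\theta}$, $z^2=i(y_2/\sqrt
q)\,e^{-iq\theta}$. The leaves are the surfaces swept out by the hyperbolas $y_1^2-y_2^2=\tau$. On
all of them the mean curvature is the restriction of one vector field $h$, `meanCurvatureField`, and
the normal part of the position satisfies $(q-p)F^\perp=\tau h$ (`leaf_sub_planeProj`,
`meanCurvature_surf`). Hence the leaf $\tau=2t(q-p)$ solves $F^\perp=2tH$, and leaves with $\tau$ of
one sign are dilations of each other. Their Lagrangian angle is $(p-q)\theta$, which is harmonic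
because the metric is diagonal with constant ratio of entries. The leaf $\tau=0$ consists of the
four rays $y_2=\pm y_1$ rotated by $\theta$. The half turn $\theta\mapsto\theta+\pi$ acts on $y$ by
the signs $((-1)^p,(-1)^q)$, not both $+1$ by coprimality, so the four rays fall into two pairs:
$C_{pq}$ and $C'_{pq}$ (`leafMeasure_zero`). For $\tau\neq0$ the same half turn is the deck
transformation that makes the two sheets of the hyperbola into a surface, possibly nonorientable.

For $t\ne0$ the mass is differentiated by scaling, which gives
$(2\tau)^{-1}\int(2\varphi+D\varphi(x))$. The first variation formula for the field $\varphi x$,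
together with $(q-p)x^\perp=\tau h$, turns this into $\int D\varphi\cdot h-\varphi|h|^2$
(`dilationField_leaf`, `hasDerivAt_integral_leafMeasure_time`). The first variation formula itself
is the divergence theorem in the coordinates $(v,\theta)$. It passes to the cone $\tau=0$ by
continuity in $\tau$.

All limits $\tau\to0$ come from one dominated convergence argument
(`MildlySingular.tendsto_leafMeasure`): in the radial parameter $r$ the area density is $O(r)$
uniformly in $\tau$, so integrands of size $O(1/|z|)$ are harmless. At $t=0$ l'Hôpital's rule
reduces the difference quotient to the limit of the dissipation. If $\varphi(0)=0$, then
$\varphi|h|^2=O(1/|z|)$ and the dissipation converges. If $\varphi(0)>0$, then $\int\varphi|h|^2$ is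
bounded below by a multiple of $\int dr/r$ (`exists_log_le_lintegral`), so it is infinite on the
cone and tends to $+\infty$ along the leaves. In that case both sides of Brakke's equality are
$-\infty$. -/

/-- The vector with coordinates `α, β` in the rotating frame `(e^{ipθ}, e^{-iqθ})`. -/
def frame (p q : ℕ) (θ : ℝ) (α β : ℂ) : C2 :=
  !₂[α * Complex.exp (((p * θ : ℝ) : ℂ) * Complex.I),
    β * Complex.exp (((-(q * θ) : ℝ) : ℂ) * Complex.I)]

@[simp] lemma frame_zero (p q : ℕ) (θ : ℝ) (α β : ℂ) :
    frame p q θ α β 0 = α * Complex.exp (((p * θ : ℝ) : ℂ) * Complex.I) := rfl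

@[simp] lemma frame_one (p q : ℕ) (θ : ℝ) (α β : ℂ) :
    frame p q θ α β 1 = β * Complex.exp (((-(q * θ) : ℝ) : ℂ) * Complex.I) := rfl

lemma C2_ext {x y : C2} (h0 : x 0 = y 0) (h1 : x 1 = y 1) : x = y := by
  ext i; fin_cases i <;> assumption

lemma inner_C2 (x y : C2) : inner ℝ x y =
    (starRingEnd ℂ (x 0) * y 0).re + (starRingEnd ℂ (x 1) * y 1).re := by
  simp [PiLp.inner_apply, Fin.sum_univ_two]
  ring

lemma conj_exp_mul_exp (x : ℝ) :
    starRingEnd ℂ (Complex.exp ((x : ℂ) * Complex.I)) * Complex.exp ((x : ℂ) * Complex.I) = 1 := by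
  rw [← Complex.exp_conj, ← Complex.exp_add]
  simp

lemma inner_frame (p q : ℕ) (θ : ℝ) (α β α' β' : ℂ) :
    inner ℝ (frame p q θ α β) (frame p q θ α' β') =
      (starRingEnd ℂ α * α').re + (starRingEnd ℂ β * β').re := by
  rw [inner_C2, frame_zero, frame_zero, frame_one, frame_one, map_mul, map_mul,
    mul_mul_mul_comm, conj_exp_mul_exp, mul_mul_mul_comm (starRingEnd ℂ β), conj_exp_mul_exp,
    mul_one, mul_one]

lemma norm_frame_sq (p q : ℕ) (θ : ℝ) (α β : ℂ) :
    ‖frame p q θ α β‖ ^ 2 = ‖α‖ ^ 2 + ‖β‖ ^ 2 := by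
  rw [← real_inner_self_eq_norm_sq, inner_frame]
  simp [← Complex.normSq_eq_conj_mul_self, Complex.sq_norm]

lemma frame_add (p q : ℕ) (θ : ℝ) (α β α' β' : ℂ) :
    frame p q θ α β + frame p q θ α' β' = frame p q θ (α + α') (β + β') := by
  apply C2_ext <;> simp [add_mul]

lemma frame_sub (p q : ℕ) (θ : ℝ) (α β α' β' : ℂ) :
    frame p q θ α β - frame p q θ α' β' = frame p q θ (α - α') (β - β') := by
  apply C2_ext <;> simp [sub_mul]

lemma smul_frame (p q : ℕ) (θ : ℝ) (c : ℝ) (α β : ℂ) :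
    c • frame p q θ α β = frame p q θ (c * α) (c * β) := by
  apply C2_ext <;> simp [mul_assoc]

lemma frame_injective {p q : ℕ} {θ : ℝ} {α β α' β' : ℂ}
    (h : frame p q θ α β = frame p q θ α' β') : α = α' ∧ β = β' := by
  have h0 : frame p q θ α β 0 = frame p q θ α' β' 0 := by rw [h]
  have h1 : frame p q θ α β 1 = frame p q θ α' β' 1 := by rw [h]
  simp only [frame_zero, frame_one] at h0 h1
  exact ⟨mul_right_cancel₀ (Complex.exp_ne_zero _) h0,
    mul_right_cancel₀ (Complex.exp_ne_zero _) h1⟩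

lemma frame_add_two_pi (p q : ℕ) (θ : ℝ) (α β : ℂ) :
    frame p q (θ + 2 * Real.pi) α β = frame p q θ α β := by
  have h1 : Complex.exp (((p * (θ + 2 * Real.pi) : ℝ) : ℂ) * Complex.I) =
      Complex.exp (((p * θ : ℝ) : ℂ) * Complex.I) := by
    rw [Complex.exp_eq_exp_iff_exists_int]
    exact ⟨p, by push_cast; ring⟩
  have h2 : Complex.exp (((-(q * (θ + 2 * Real.pi)) : ℝ) : ℂ) * Complex.I) =
      Complex.exp (((-(q * θ) : ℝ) : ℂ) * Complex.I) := by
    rw [Complex.exp_eq_exp_iff_exists_int]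
    exact ⟨-q, by push_cast; ring⟩
  simp only [frame, h1, h2]

/-- A half turn multiplies the frame vectors $e^{ip\theta}$ and $e^{-iq\theta}$ by signs. This is
the source of the deck transformation of the leaves and of the pairing of the four rays of the
cones. -/
lemma frame_add_pi (p q : ℕ) (θ : ℝ) (α β : ℂ) :
    frame p q (θ + Real.pi) α β = frame p q θ ((-1) ^ p * α) ((-1) ^ q * β) := by
  have h1 : Complex.exp (((p * (θ + Real.pi) : ℝ) : ℂ) * Complex.I) =
      (-1) ^ p * Complex.exp (((p * θ : ℝ) : ℂ) * Complex.I) := by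
    rw [← Complex.exp_pi_mul_I, ← Complex.exp_nat_mul, ← Complex.exp_add]
    congr 1; push_cast; ring
  have h2 : Complex.exp (((-(q * (θ + Real.pi)) : ℝ) : ℂ) * Complex.I) =
      (-1) ^ q * Complex.exp (((-(q * θ) : ℝ) : ℂ) * Complex.I) := by
    have : (-1 : ℂ) ^ q = Complex.exp (q * (-(Real.pi * Complex.I))) := by
      rw [Complex.exp_nat_mul, Complex.exp_neg, Complex.exp_pi_mul_I]; norm_num
    rw [this, ← Complex.exp_add]
    congr 1; push_cast; ring
  simp only [frame, h1, h2]
  apply C2_ext <;> simp <;> ring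

lemma continuous_frame {X : Type*} [TopologicalSpace X] (p q : ℕ) {θ : X → ℝ} {α β : X → ℂ}
    (hθ : Continuous θ) (hα : Continuous α) (hβ : Continuous β) :
    Continuous fun x => frame p q (θ x) (α x) (β x) := by
  refine (PiLp.continuous_toLp 2 _).comp (continuous_pi fun i => ?_)
  fin_cases i <;> simp <;> fun_prop

lemma contDiff_frame {E : Type*} [NormedAddCommGroup E] [NormedSpace ℝ E] (p q : ℕ)
    {θ : E → ℝ} {α β : E → ℂ} {n : WithTop ℕ∞}
    (hθ : ContDiff ℝ n θ) (hα : ContDiff ℝ n α) (hβ : ContDiff ℝ n β) :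
    ContDiff ℝ n fun x => frame p q (θ x) (α x) (β x) := by
  have h1 : ContDiff ℝ n fun x => ((p * θ x : ℝ) : ℂ) :=
    Complex.ofRealCLM.contDiff.comp (contDiff_const.mul hθ)
  have h2 : ContDiff ℝ n fun x => ((-(q * θ x) : ℝ) : ℂ) :=
    Complex.ofRealCLM.contDiff.comp (contDiff_const.mul hθ).neg
  refine contDiff_piLp' 2 fun i => ?_
  fin_cases i
  · exact hα.mul ((h1.mul contDiff_const).cexp)
  · exact hβ.mul ((h2.mul contDiff_const).cexp)

lemma hasDerivAt_C2 {f : ℝ → C2} {f' : C2} {x : ℝ}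
    (h0 : HasDerivAt (fun s => f s 0) (f' 0) x) (h1 : HasDerivAt (fun s => f s 1) (f' 1) x) :
    HasDerivAt f f' x := by
  have h : HasDerivAt (fun s => (WithLp.ofLp (f s) : Fin 2 → ℂ)) (WithLp.ofLp f') x := by
    rw [hasDerivAt_pi]
    intro i; fin_cases i <;> assumption
  exact ((PiLp.hasFDerivAt_toLp (𝕜 := ℝ) 2 (WithLp.ofLp (f x))).comp_hasDerivAt x h)

lemma hasDerivAt_frame_coeff (p q : ℕ) (θ : ℝ) {α β : ℝ → ℂ} {α' β' : ℂ} {v : ℝ}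
    (hα : HasDerivAt α α' v) (hβ : HasDerivAt β β' v) :
    HasDerivAt (fun s => frame p q θ (α s) (β s)) (frame p q θ α' β') v :=
  hasDerivAt_C2 (hα.mul_const _) (hβ.mul_const _)

lemma hasDerivAt_frame_angle (p q : ℕ) (θ : ℝ) (α β : ℂ) :
    HasDerivAt (fun s => frame p q s α β)
      (frame p q θ (Complex.I * p * α) (-(Complex.I * q * β))) θ := by
  have h (c : ℝ) : HasDerivAt (fun s : ℝ => Complex.exp (((c * s : ℝ) : ℂ) * Complex.I))
      (Complex.exp (((c * θ : ℝ) : ℂ) * Complex.I) * (c * Complex.I)) θ := by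
    have h1 : HasDerivAt (fun s : ℝ => ((c * s : ℝ) : ℂ)) (c : ℂ) θ := by
      have := ((hasDerivAt_id θ).const_mul c).ofReal_comp
      simpa using this
    exact (h1.mul_const Complex.I).cexp
  apply hasDerivAt_C2
  · simp only [frame_zero]
    have := (h p).const_mul α
    refine this.congr_deriv ?_; push_cast; ring
  · simp only [frame_one]
    have := (h (-q)).const_mul β
    simp only [neg_mul] at this
    refine this.congr_deriv ?_; push_cast; ring

/-! ### Partial derivatives -/

lemma pd_zero_eq {G : Type*} [NormedAddCommGroup G] [NormedSpace ℝ G] {f : ℝ × ℝ → G}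
    {u : ℝ × ℝ} {f' : G} (hf : DifferentiableAt ℝ f u)
    (h : HasDerivAt (fun v => f (v, u.2)) f' u.1) : pd 0 f u = f' := by
  have h1 : HasDerivAt (fun v : ℝ => (v, u.2)) ((1 : ℝ), (0 : ℝ)) u.1 :=
    (hasDerivAt_id u.1).prodMk (hasDerivAt_const u.1 u.2)
  exact (HasFDerivAt.comp_hasDerivAt (x := u.1) hf.hasFDerivAt h1).unique h

lemma pd_one_eq {G : Type*} [NormedAddCommGroup G] [NormedSpace ℝ G] {f : ℝ × ℝ → G}
    {u : ℝ × ℝ} {f' : G} (hf : DifferentiableAt ℝ f u)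
    (h : HasDerivAt (fun v => f (u.1, v)) f' u.2) : pd 1 f u = f' := by
  have h1 : HasDerivAt (fun v : ℝ => (u.1, v)) ((0 : ℝ), (1 : ℝ)) u.2 :=
    (hasDerivAt_const u.2 u.1).prodMk (hasDerivAt_id u.2)
  exact (HasFDerivAt.comp_hasDerivAt (x := u.2) hf.hasFDerivAt h1).unique h

lemma fderiv_eq_pd {G : Type*} [NormedAddCommGroup G] [NormedSpace ℝ G] (f : ℝ × ℝ → G)
    (u w : ℝ × ℝ) : fderiv ℝ f u w = w.1 • pd 0 f u + w.2 • pd 1 f u := by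
  have : w = w.1 • ((1 : ℝ), (0 : ℝ)) + w.2 • ((0 : ℝ), (1 : ℝ)) := by ext <;> simp
  conv_lhs => rw [this, map_add, map_smul, map_smul]
  rfl

lemma pd_const {G : Type*} [NormedAddCommGroup G] [NormedSpace ℝ G] (i : Fin 2) (c : G)
    (u : ℝ × ℝ) : pd i (fun _ => c) u = 0 := by
  simp [pd]

/-! ### Surfaces with orthogonal coordinate vectors -/

/-- The orthogonal projection onto the span of two orthogonal vectors. -/
def pairProj (a b : ℝ) (A B : C2) : C2 →L[ℝ] C2 :=
  a⁻¹ • (innerSL ℝ A).smulRight A + b⁻¹ • (innerSL ℝ B).smulRight B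

lemma pairProj_apply (a b : ℝ) (A B v : C2) :
    pairProj a b A B v = (a⁻¹ * inner ℝ A v) • A + (b⁻¹ * inner ℝ B v) • B := by
  simp [pairProj, smul_smul]

section Orthogonal

variable {f : ℝ × ℝ → C2} {u : ℝ × ℝ} {A B : C2} {a b : ℝ}

lemma metric_of_orthogonal (hA : pd 0 f u = A) (hB : pd 1 f u = B) (hAB : inner ℝ A B = 0)
    (ha : inner ℝ A A = a) (hb : inner ℝ B B = b) : metric f u = !![a, 0; 0, b] := by
  ext i j
  fin_cases i <;> fin_cases j <;> simp [metric, hA, hB, hAB, ha, hb, -inner_self_eq_norm_sq_to_K]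
  rw [real_inner_comm, hAB]

lemma areaDensity_of_orthogonal (hA : pd 0 f u = A) (hB : pd 1 f u = B)
    (hAB : inner ℝ A B = 0) (ha : inner ℝ A A = a) (hb : inner ℝ B B = b) :
    areaDensity f u = Real.sqrt (a * b) := by
  rw [areaDensity, metric_of_orthogonal hA hB hAB ha hb, Matrix.det_fin_two_of]
  simp

lemma metric_inv_of_orthogonal (hA : pd 0 f u = A) (hB : pd 1 f u = B)
    (hAB : inner ℝ A B = 0) (ha : inner ℝ A A = a) (hb : inner ℝ B B = b)
    (ha0 : a ≠ 0) (hb0 : b ≠ 0) : (metric f u)⁻¹ = !![a⁻¹, 0; 0, b⁻¹] := by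
  rw [metric_of_orthogonal hA hB hAB ha hb]
  apply Matrix.inv_eq_right_inv
  rw [Matrix.mul_fin_two, Matrix.one_fin_two]
  simp [ha0, hb0]

lemma tangentProj_of_orthogonal (hA : pd 0 f u = A) (hB : pd 1 f u = B)
    (hAB : inner ℝ A B = 0) (ha : inner ℝ A A = a) (hb : inner ℝ B B = b)
    (ha0 : a ≠ 0) (hb0 : b ≠ 0) : tangentProj f u = pairProj a b A B := by
  ext1 v
  have hBA : inner ℝ B A = 0 := by rw [real_inner_comm, hAB]
  refine Submodule.eq_starProjection_of_mem_of_inner_eq_zero ?_ ?_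
  · refine ⟨(a⁻¹ * inner ℝ A v, b⁻¹ * inner ℝ B v), ?_⟩
    rw [pairProj_apply]
    change fderiv ℝ f u _ = _
    rw [fderiv_eq_pd, hA, hB]
  · rintro w ⟨c, rfl⟩
    change inner ℝ _ (fderiv ℝ f u c) = 0
    rw [fderiv_eq_pd, hA, hB, pairProj_apply]
    simp only [inner_sub_left, inner_add_right, inner_add_left, inner_smul_right, inner_smul_left,
      hAB, hBA, ha, hb, real_inner_comm A v, real_inner_comm B v]
    simp
    field_simp
    ring

lemma injective_of_orthogonal (hA : pd 0 f u = A) (hB : pd 1 f u = B)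
    (hAB : inner ℝ A B = 0) (ha : inner ℝ A A = a) (hb : inner ℝ B B = b)
    (ha0 : a ≠ 0) (hb0 : b ≠ 0) : Function.Injective (fderiv ℝ f u) := by
  rw [injective_iff_map_eq_zero]
  intro c hc
  rw [fderiv_eq_pd, hA, hB] at hc
  have h1 : inner ℝ A (c.1 • A + c.2 • B) = 0 := by rw [hc, inner_zero_right]
  have h2 : inner ℝ B (c.1 • A + c.2 • B) = 0 := by rw [hc, inner_zero_right]
  simp only [inner_add_right, inner_smul_right, hAB, real_inner_comm A B, ha, hb, mul_zero,
    zero_add, add_zero, mul_eq_zero, ha0, hb0, or_false] at h1 h2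
  exact Prod.ext h1 h2

end Orthogonal

/-! ### The leaves `y₁² - y₂² = const` -/

/-- The point with moduli `y₁ / √p`, `y₂ / √q`. -/
def leaf (p q : ℕ) (y : ℝ × ℝ) (θ : ℝ) : C2 :=
  frame p q θ ((y.1 / √p : ℝ) : ℂ) (Complex.I * (y.2 / √q : ℝ))

/-- The derivative of `leaf` in the angle. -/
def angularTangent (p q : ℕ) (y : ℝ × ℝ) (θ : ℝ) : C2 :=
  frame p q θ (Complex.I * (√p * y.1 : ℝ)) ((√q * y.2 : ℝ) : ℂ)

/-- The tangent vector of the profile hyperbola through `y`. -/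
def profileTangent (p q : ℕ) (y : ℝ × ℝ) (θ : ℝ) : C2 :=
  frame p q θ ((√q * y.2 : ℝ) : ℂ) (Complex.I * (√p * y.1 : ℝ))

/-- The common squared length of `angularTangent` and `profileTangent`. -/
def sqLen (p q : ℕ) (y : ℝ × ℝ) : ℝ := p * y.1 ^ 2 + q * y.2 ^ 2

/-- The projection onto the tangent plane of the leaf. -/
def planeProj (p q : ℕ) (y : ℝ × ℝ) (θ : ℝ) : C2 →L[ℝ] C2 :=
  pairProj (sqLen p q y) (sqLen p q y) (profileTangent p q y θ) (angularTangent p q y θ)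

/-- The mean curvature vector of all the leaves, as a vector field on `ℂ²`. -/
def meanCurvatureField (p q : ℕ) (z : C2) : C2 :=
  (((q : ℝ) - p) / (p ^ 2 * ‖z 0‖ ^ 2 + q ^ 2 * ‖z 1‖ ^ 2)) • !₂[(p : ℂ) * z 0, -(q : ℂ) * z 1]

/-- The hyperbola `y₁² - y₂² = ε`. -/
def hyper (ε v : ℝ) : ℝ × ℝ :=
  ((Real.exp v + ε * Real.exp (-v)) / 2, (Real.exp v - ε * Real.exp (-v)) / 2)

lemma hyper_sq_sub (ε v : ℝ) : (hyper ε v).1 ^ 2 - (hyper ε v).2 ^ 2 = ε := by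
  have : Real.exp v * Real.exp (-v) = 1 := by rw [← Real.exp_add]; simp
  simp only [hyper]
  linear_combination ε * this

lemma hasDerivAt_hyper_fst (ε v : ℝ) :
    HasDerivAt (fun s => (hyper ε s).1) (hyper ε v).2 v := by
  have h := (((Real.hasDerivAt_exp v).add
    (((Real.hasDerivAt_exp (-v)).comp v (hasDerivAt_neg v)).const_mul ε)).div_const 2)
  refine h.congr_deriv ?_
  simp only [hyper]; ring

lemma hasDerivAt_hyper_snd (ε v : ℝ) :
    HasDerivAt (fun s => (hyper ε s).2) (hyper ε v).1 v := by
  have h := (((Real.hasDerivAt_exp v).sub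
    (((Real.hasDerivAt_exp (-v)).comp v (hasDerivAt_neg v)).const_mul ε)).div_const 2)
  refine h.congr_deriv ?_
  simp only [hyper]; ring

lemma contDiff_hyper_fst (ε : ℝ) {n : WithTop ℕ∞} : ContDiff ℝ n fun v => (hyper ε v).1 := by
  unfold hyper; simp only; fun_prop

lemma contDiff_hyper_snd (ε : ℝ) {n : WithTop ℕ∞} : ContDiff ℝ n fun v => (hyper ε v).2 := by
  unfold hyper; simp only; fun_prop

lemma sqLen_nonneg (p q : ℕ) (y : ℝ × ℝ) : 0 ≤ sqLen p q y := by
  unfold sqLen; positivity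

lemma sqLen_pos {p q : ℕ} (hp : 0 < p) (hq : 0 < q) {y : ℝ × ℝ} (hy : y ≠ 0) :
    0 < sqLen p q y := by
  have hp' : (0 : ℝ) < p := by exact_mod_cast hp
  have hq' : (0 : ℝ) < q := by exact_mod_cast hq
  by_cases h1 : y.1 = 0
  · have h2 : y.2 ≠ 0 := fun h2 => hy (Prod.ext h1 h2)
    unfold sqLen; positivity
  · unfold sqLen; positivity

lemma sqLen_smul (p q : ℕ) (l : ℝ) (y : ℝ × ℝ) : sqLen p q (l • y) = l ^ 2 * sqLen p q y := by
  simp only [sqLen, Prod.smul_fst, Prod.smul_snd, smul_eq_mul]; ring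

/-- In each coordinate one of the two vectors has a real coefficient and the other an imaginary one.
-/
lemma inner_profileTangent_angularTangent (p q : ℕ) (y : ℝ × ℝ) (θ : ℝ) :
    inner ℝ (profileTangent p q y θ) (angularTangent p q y θ) = 0 := by
  rw [profileTangent, angularTangent, inner_frame]
  simp

lemma inner_profileTangent_self (p q : ℕ) (y : ℝ × ℝ) (θ : ℝ) :
    inner ℝ (profileTangent p q y θ) (profileTangent p q y θ) = sqLen p q y := by
  rw [profileTangent, inner_frame, sqLen]
  simp
  linear_combination y.2 ^ 2 * Real.mul_self_sqrt (Nat.cast_nonneg (α := ℝ) q) +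
    y.1 ^ 2 * Real.mul_self_sqrt (Nat.cast_nonneg (α := ℝ) p)

lemma inner_angularTangent_self (p q : ℕ) (y : ℝ × ℝ) (θ : ℝ) :
    inner ℝ (angularTangent p q y θ) (angularTangent p q y θ) = sqLen p q y := by
  rw [angularTangent, inner_frame, sqLen]
  simp
  linear_combination y.2 ^ 2 * Real.mul_self_sqrt (Nat.cast_nonneg (α := ℝ) q) +
    y.1 ^ 2 * Real.mul_self_sqrt (Nat.cast_nonneg (α := ℝ) p)

lemma leaf_smul (p q : ℕ) (l : ℝ) (y : ℝ × ℝ) (θ : ℝ) :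
    leaf p q (l • y) θ = l • leaf p q y θ := by
  rw [leaf, leaf, smul_frame]
  congr 1
  · simp only [Prod.smul_fst, smul_eq_mul]; push_cast; ring
  · simp only [Prod.smul_snd, smul_eq_mul]; push_cast; ring

lemma angularTangent_smul (p q : ℕ) (l : ℝ) (y : ℝ × ℝ) (θ : ℝ) :
    angularTangent p q (l • y) θ = l • angularTangent p q y θ := by
  rw [angularTangent, angularTangent, smul_frame]
  congr 1
  · simp only [Prod.smul_fst, smul_eq_mul]; push_cast; ring
  · simp only [Prod.smul_snd, smul_eq_mul]; push_cast; ring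

lemma profileTangent_smul (p q : ℕ) (l : ℝ) (y : ℝ × ℝ) (θ : ℝ) :
    profileTangent p q (l • y) θ = l • profileTangent p q y θ := by
  rw [profileTangent, profileTangent, smul_frame]
  congr 1
  · simp only [Prod.smul_snd, smul_eq_mul]; push_cast; ring
  · simp only [Prod.smul_fst, smul_eq_mul]; push_cast; ring

lemma pairProj_smul {l : ℝ} (hl : l ≠ 0) (a b : ℝ) (A B : C2) :
    pairProj (l ^ 2 * a) (l ^ 2 * b) (l • A) (l • B) = pairProj a b A B := by
  ext1 v
  simp only [pairProj_apply, inner_smul_left, smul_smul, mul_inv]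
  simp
  congr 2 <;> field_simp

lemma planeProj_smul (p q : ℕ) {l : ℝ} (hl : l ≠ 0) (y : ℝ × ℝ) (θ : ℝ) :
    planeProj p q (l • y) θ = planeProj p q y θ := by
  rw [planeProj, sqLen_smul, profileTangent_smul, angularTangent_smul, pairProj_smul hl, planeProj]

/-- Since $|z^1|^2=y_1^2/p$ and $|z^2|^2=y_2^2/q$, the denominator of the field becomes `sqLen`. At
$y=0$ both sides vanish, so no condition on $y$ is needed. -/
lemma meanCurvatureField_leaf {p q : ℕ} (hp : 0 < p) (hq : 0 < q) (y : ℝ × ℝ) (θ : ℝ) :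
    meanCurvatureField p q (leaf p q y θ) = (((q : ℝ) - p) / sqLen p q y) •
      frame p q θ ((√p * y.1 : ℝ) : ℂ) (-(Complex.I * (√q * y.2 : ℝ))) := by
  have hp' : (0 : ℝ) < p := by exact_mod_cast hp
  have hq' : (0 : ℝ) < q := by exact_mod_cast hq
  have hP := Real.sq_sqrt hp'.le
  have hQ := Real.sq_sqrt hq'.le
  have hPc : ((√p : ℝ) : ℂ) ^ 2 = p := by rw [← Complex.ofReal_pow, hP]; simp
  have hQc : ((√q : ℝ) : ℂ) ^ 2 = q := by rw [← Complex.ofReal_pow, hQ]; simp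
  have hP0 : ((√p : ℝ) : ℂ) ≠ 0 := by
    rw [Complex.ofReal_ne_zero]; positivity
  have hQ0 : ((√q : ℝ) : ℂ) ≠ 0 := by
    rw [Complex.ofReal_ne_zero]; positivity
  rw [meanCurvatureField]
  congr 1
  · congr 1
    simp only [leaf, frame_zero, frame_one, norm_mul, Complex.norm_exp_ofReal_mul_I,
      Complex.norm_real, Complex.norm_I, mul_one, one_mul, Real.norm_eq_abs, sq_abs, div_pow, hP,
      hQ, sqLen]
    field_simp
  · apply C2_ext
    · simp [leaf]
      rw [← hPc]; field_simp
    · simp [leaf]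
      rw [← hQc]; field_simp

lemma norm_meanCurvatureField_leaf_sq {p q : ℕ} (hp : 0 < p) (hq : 0 < q) {y : ℝ × ℝ}
    (hy : y ≠ 0) (θ : ℝ) :
    ‖meanCurvatureField p q (leaf p q y θ)‖ ^ 2 = ((q : ℝ) - p) ^ 2 / sqLen p q y := by
  have hD := (sqLen_pos hp hq hy).ne'
  rw [meanCurvatureField_leaf hp hq, norm_smul, mul_pow, norm_frame_sq]
  simp only [norm_neg, norm_mul, Complex.norm_I, one_mul, Complex.norm_real, Real.norm_eq_abs,
    sq_abs, mul_pow, Real.sq_sqrt (Nat.cast_nonneg (α := ℝ) _)]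
  rw [← sqLen]
  field_simp

lemma continuous_leaf (p q : ℕ) : Continuous fun x : (ℝ × ℝ) × ℝ => leaf p q x.1 x.2 := by
  unfold leaf; exact continuous_frame p q (by fun_prop) (by fun_prop) (by fun_prop)

lemma continuous_profileTangent (p q : ℕ) :
    Continuous fun x : (ℝ × ℝ) × ℝ => profileTangent p q x.1 x.2 := by
  unfold profileTangent; exact continuous_frame p q (by fun_prop) (by fun_prop) (by fun_prop)

lemma continuous_angularTangent (p q : ℕ) :
    Continuous fun x : (ℝ × ℝ) × ℝ => angularTangent p q x.1 x.2 := by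
  unfold angularTangent; exact continuous_frame p q (by fun_prop) (by fun_prop) (by fun_prop)

lemma continuous_sqLen (p q : ℕ) : Continuous (sqLen p q) := by
  unfold sqLen; fun_prop

lemma continuous_rankOne : Continuous fun A : C2 => (innerSL ℝ A).smulRight A := by
  exact ((ContinuousLinearMap.smulRightL ℝ C2 C2).continuous₂).comp
    ((innerSL ℝ).continuous.prodMk continuous_id)

lemma continuousAt_planeProj {p q : ℕ} (hp : 0 < p) (hq : 0 < q) {x : (ℝ × ℝ) × ℝ}
    (hx : x.1 ≠ 0) : ContinuousAt (fun x : (ℝ × ℝ) × ℝ => planeProj p q x.1 x.2) x := by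
  have h1 : ContinuousAt (fun x : (ℝ × ℝ) × ℝ => (sqLen p q x.1)⁻¹) x :=
    (((continuous_sqLen p q).comp continuous_fst).continuousAt).inv₀ (sqLen_pos hp hq hx).ne'
  exact (h1.smul (continuous_rankOne.comp (continuous_profileTangent p q)).continuousAt).add
    (h1.smul (continuous_rankOne.comp (continuous_angularTangent p q)).continuousAt)

/-- Inversion is measurable on all of $\mathbb R$ with the convention $0^{-1}=0$. Measurability
therefore needs no exclusion of $y=0$, in contrast to continuity. -/
lemma measurable_planeProj (p q : ℕ) :
    Measurable fun x : (ℝ × ℝ) × ℝ => planeProj p q x.1 x.2 := by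
  have h1 : Measurable (fun x : (ℝ × ℝ) × ℝ => (sqLen p q x.1)⁻¹) :=
    (((continuous_sqLen p q).comp continuous_fst).measurable).inv
  exact (h1.smul (continuous_rankOne.comp (continuous_profileTangent p q)).measurable).add
    (h1.smul (continuous_rankOne.comp (continuous_angularTangent p q)).measurable)

/-! ### Geometry of the leaves -/

/-- The leaf `y₁² - y₂² = l² ε` in conformal coordinates. -/
def surf (p q : ℕ) (ε l : ℝ) (u : ℝ × ℝ) : C2 := leaf p q (l • hyper ε u.1) u.2

section frameMap

variable {p q : ℕ} {α β : ℝ → ℂ}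

lemma pd_zero_frame (hα : ContDiff ℝ ∞ α) (hβ : ContDiff ℝ ∞ β) {u : ℝ × ℝ} {α' β' : ℂ}
    (hα' : HasDerivAt α α' u.1) (hβ' : HasDerivAt β β' u.1) :
    pd 0 (fun w : ℝ × ℝ => frame p q w.2 (α w.1) (β w.1)) u = frame p q u.2 α' β' := by
  refine pd_zero_eq ?_ (hasDerivAt_frame_coeff p q u.2 hα' hβ')
  exact ((contDiff_frame p q (n := ∞) contDiff_snd (hα.comp contDiff_fst)
    (hβ.comp contDiff_fst)).differentiable (by simp)).differentiableAt

lemma pd_one_frame (hα : ContDiff ℝ ∞ α) (hβ : ContDiff ℝ ∞ β) {u : ℝ × ℝ} :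
    pd 1 (fun w : ℝ × ℝ => frame p q w.2 (α w.1) (β w.1)) u =
      frame p q u.2 (Complex.I * p * α u.1) (-(Complex.I * q * β u.1)) := by
  refine pd_one_eq ?_ (by exact hasDerivAt_frame_angle p q u.2 (α u.1) (β u.1))
  exact ((contDiff_frame p q (n := ∞) contDiff_snd (hα.comp contDiff_fst)
    (hβ.comp contDiff_fst)).differentiable (by simp)).differentiableAt

end frameMap

section Surf

variable {p q : ℕ} (ε l : ℝ) (u : ℝ × ℝ)

lemma hasDerivAt_coeff_fst (c : ℝ) (v : ℝ) :
    HasDerivAt (fun s => (((l * (hyper ε s).1) / c : ℝ) : ℂ))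
      ((l * (hyper ε v).2 / c : ℝ) : ℂ) v :=
  (((hasDerivAt_hyper_fst ε v).const_mul l).div_const c).ofReal_comp

lemma hasDerivAt_coeff_snd (c : ℝ) (v : ℝ) :
    HasDerivAt (fun s => (((l * (hyper ε s).2) / c : ℝ) : ℂ))
      ((l * (hyper ε v).1 / c : ℝ) : ℂ) v :=
  (((hasDerivAt_hyper_snd ε v).const_mul l).div_const c).ofReal_comp

lemma contDiff_coeff_fst (c : ℝ) :
    ContDiff ℝ ∞ (fun s => (((l * (hyper ε s).1) / c : ℝ) : ℂ)) :=
  Complex.ofRealCLM.contDiff.comp ((contDiff_const.mul (contDiff_hyper_fst ε)).div_const c)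

lemma contDiff_coeff_snd (c : ℝ) :
    ContDiff ℝ ∞ (fun s => (((l * (hyper ε s).2) / c : ℝ) : ℂ)) :=
  Complex.ofRealCLM.contDiff.comp ((contDiff_const.mul (contDiff_hyper_snd ε)).div_const c)

lemma contDiff_surf : ContDiff ℝ ∞ (surf p q ε l) :=
  contDiff_frame p q contDiff_snd ((contDiff_coeff_fst ε l √p).comp contDiff_fst)
    (contDiff_const.mul ((contDiff_coeff_snd ε l √q).comp contDiff_fst))

lemma pd_zero_surf' : pd 0 (surf p q ε l) u =
    frame p q u.2 ((l * (hyper ε u.1).2 / √p : ℝ) : ℂ)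
      (Complex.I * ((l * (hyper ε u.1).1 / √q : ℝ) : ℂ)) :=
  pd_zero_frame (contDiff_coeff_fst ε l √p) (contDiff_const.mul (contDiff_coeff_snd ε l √q))
    (hasDerivAt_coeff_fst ε l √p u.1) ((hasDerivAt_coeff_snd ε l √q u.1).const_mul Complex.I)

lemma pd_one_surf' : pd 1 (surf p q ε l) u =
    frame p q u.2 (Complex.I * p * ((l * (hyper ε u.1).1 / √p : ℝ) : ℂ))
      (-(Complex.I * q * (Complex.I * ((l * (hyper ε u.1).2 / √q : ℝ) : ℂ)))) :=
  pd_one_frame (contDiff_coeff_fst ε l √p) (contDiff_const.mul (contDiff_coeff_snd ε l √q))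

/-- The profile hyperbola, parametrised by $v$, solves $y''=y$. -/
lemma pd_zero_pd_zero_surf : pd 0 (pd 0 (surf p q ε l)) u = surf p q ε l u := by
  rw [funext (pd_zero_surf' ε l)]
  exact pd_zero_frame (contDiff_coeff_snd ε l √p) (contDiff_const.mul (contDiff_coeff_fst ε l √q))
    (hasDerivAt_coeff_snd ε l √p u.1) ((hasDerivAt_coeff_fst ε l √q u.1).const_mul Complex.I)

lemma pd_one_pd_one_surf : pd 1 (pd 1 (surf p q ε l)) u =
    frame p q u.2 (-(p ^ 2 * ((l * (hyper ε u.1).1 / √p : ℝ) : ℂ)))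
      (-(q ^ 2 * (Complex.I * ((l * (hyper ε u.1).2 / √q : ℝ) : ℂ)))) := by
  rw [funext (pd_one_surf' ε l)]
  refine (pd_one_frame (contDiff_const.mul (contDiff_coeff_fst ε l √p))
    (contDiff_const.mul (contDiff_const.mul (contDiff_coeff_snd ε l √q))).neg).trans ?_
  congr 1
  · linear_combination (p ^ 2 * ((l * (hyper ε u.1).1 / √p : ℝ) : ℂ)) * Complex.I_sq
  · linear_combination (q ^ 2 * Complex.I * ((l * (hyper ε u.1).2 / √q : ℝ) : ℂ)) * Complex.I_sq

end Surf

/-! ### The coordinate vectors of a leaf. -/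

section SurfGeometry

variable {p q : ℕ} (hp : 0 < p) (hq : 0 < q) (ε l : ℝ) (u : ℝ × ℝ)

include hp hq

/-- `profileTangent` is scaled to have the length of `angularTangent`; the price is the factor
$1/\sqrt{pq}$. The metric is thus `sqLen` times the constant matrix $\mathrm{diag}(1/(pq),1)$. -/
lemma pd_zero_surf : pd 0 (surf p q ε l) u =
    (√(p * q : ℝ))⁻¹ • profileTangent p q (l • hyper ε u.1) u.2 := by
  have hP0 : ((√p : ℝ) : ℂ) ≠ 0 := by rw [Complex.ofReal_ne_zero]; positivity
  have hQ0 : ((√q : ℝ) : ℂ) ≠ 0 := by rw [Complex.ofReal_ne_zero]; positivity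
  rw [pd_zero_surf', profileTangent, smul_frame, Real.sqrt_mul (Nat.cast_nonneg p)]
  congr 1 <;> · simp; field_simp

lemma pd_one_surf : pd 1 (surf p q ε l) u = angularTangent p q (l • hyper ε u.1) u.2 := by
  have hP0 : ((√p : ℝ) : ℂ) ≠ 0 := by rw [Complex.ofReal_ne_zero]; positivity
  have hQ0 : ((√q : ℝ) : ℂ) ≠ 0 := by rw [Complex.ofReal_ne_zero]; positivity
  have hPc : ((√p : ℝ) : ℂ) ^ 2 = p := by
    rw [← Complex.ofReal_pow, Real.sq_sqrt (Nat.cast_nonneg p)]; simp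
  have hQc : ((√q : ℝ) : ℂ) ^ 2 = q := by
    rw [← Complex.ofReal_pow, Real.sq_sqrt (Nat.cast_nonneg q)]; simp
  rw [pd_one_surf', angularTangent]
  congr 1
  · simp; rw [← hPc]; field_simp
  · simp; rw [← hQc]; field_simp; simp

end SurfGeometry

lemma hyper_ne_zero {ε : ℝ} (hε : ε ≠ 0) (v : ℝ) : hyper ε v ≠ 0 := by
  intro h
  have := hyper_sq_sub ε v
  rw [h] at this
  exact hε (by simpa using this.symm)

lemma inner_smul_I_frame (p q : ℕ) (θ : ℝ) (α β α' β' : ℂ) :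
    inner ℝ (Complex.I • frame p q θ α β) (frame p q θ α' β') =
      (starRingEnd ℂ (Complex.I * α) * α').re + (starRingEnd ℂ (Complex.I * β) * β').re := by
  rw [← inner_frame p q θ]
  congr 1
  apply C2_ext <;> simp [mul_assoc]

/-! ### Metric, Lagrangian angle, self-similarity and mean curvature of the leaves. -/

section SurfGeometry

variable {p q : ℕ} {ε l : ℝ}

lemma smul_hyper_ne_zero (hε : ε ≠ 0) (hl : l ≠ 0) (v : ℝ) : l • hyper ε v ≠ 0 :=
  smul_ne_zero hl (hyper_ne_zero hε v)

lemma inner_pd_zero_one_surf (hp : 0 < p) (hq : 0 < q) (u : ℝ × ℝ) :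
    inner ℝ (pd 0 (surf p q ε l) u) (pd 1 (surf p q ε l) u) = 0 := by
  rw [pd_zero_surf hp hq, pd_one_surf hp hq, inner_smul_left, inner_profileTangent_angularTangent,
    mul_zero]

lemma inner_pd_zero_surf (hp : 0 < p) (hq : 0 < q) (u : ℝ × ℝ) :
    inner ℝ (pd 0 (surf p q ε l) u) (pd 0 (surf p q ε l) u) =
      (p * q : ℝ)⁻¹ * sqLen p q (l • hyper ε u.1) := by
  rw [pd_zero_surf hp hq, real_inner_smul_left, real_inner_smul_right, inner_profileTangent_self,
    ← mul_assoc, ← mul_inv, Real.mul_self_sqrt (by positivity)]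

lemma inner_pd_one_surf (hp : 0 < p) (hq : 0 < q) (u : ℝ × ℝ) :
    inner ℝ (pd 1 (surf p q ε l) u) (pd 1 (surf p q ε l) u) = sqLen p q (l • hyper ε u.1) := by
  rw [pd_one_surf hp hq, inner_angularTangent_self]

lemma areaDensity_surf (hp : 0 < p) (hq : 0 < q) (u : ℝ × ℝ) :
    areaDensity (surf p q ε l) u = (√(p * q : ℝ))⁻¹ * sqLen p q (l • hyper ε u.1) := by
  rw [areaDensity_of_orthogonal rfl rfl (inner_pd_zero_one_surf hp hq u)
    (inner_pd_zero_surf hp hq u) (inner_pd_one_surf hp hq u), mul_assoc,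
    Real.sqrt_mul (by positivity), Real.sqrt_mul_self (sqLen_nonneg _ _ _), Real.sqrt_inv]

lemma metric_inv_surf (hp : 0 < p) (hq : 0 < q) (hε : ε ≠ 0) (hl : l ≠ 0) (u : ℝ × ℝ) :
    (metric (surf p q ε l) u)⁻¹ = !![((p * q : ℝ)⁻¹ * sqLen p q (l • hyper ε u.1))⁻¹, 0;
      0, (sqLen p q (l • hyper ε u.1))⁻¹] := by
  have hD := sqLen_pos hp hq (smul_hyper_ne_zero hε hl u.1)
  exact metric_inv_of_orthogonal rfl rfl (inner_pd_zero_one_surf hp hq u)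
    (inner_pd_zero_surf hp hq u) (inner_pd_one_surf hp hq u) (by positivity) hD.ne'

lemma tangentProj_surf (hp : 0 < p) (hq : 0 < q) (hε : ε ≠ 0) (hl : l ≠ 0) (u : ℝ × ℝ) :
    tangentProj (surf p q ε l) u = planeProj p q (l • hyper ε u.1) u.2 := by
  have hD := sqLen_pos hp hq (smul_hyper_ne_zero hε hl u.1)
  rw [tangentProj_of_orthogonal rfl rfl (inner_pd_zero_one_surf hp hq u)
    (inner_pd_zero_surf hp hq u) (inner_pd_one_surf hp hq u) (by positivity) hD.ne', planeProj]
  have hs : (√(p * q : ℝ)) ^ 2 = p * q := Real.sq_sqrt (by positivity)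
  ext1 v
  rw [pairProj_apply, pairProj_apply, pd_zero_surf hp hq, pd_one_surf hp hq, real_inner_smul_left,
    smul_smul]
  congr 2
  have h0 : √(p * q : ℝ) ≠ 0 := by positivity
  rw [mul_inv, ← hs, inv_inv, Real.sqrt_sq (by positivity)]
  field_simp

lemma injective_fderiv_surf (hp : 0 < p) (hq : 0 < q) (hε : ε ≠ 0) (hl : l ≠ 0) (u : ℝ × ℝ) :
    Function.Injective (fderiv ℝ (surf p q ε l) u) := by
  have hD := sqLen_pos hp hq (smul_hyper_ne_zero hε hl u.1)
  exact injective_of_orthogonal rfl rfl (inner_pd_zero_one_surf hp hq u)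
    (inner_pd_zero_surf hp hq u) (inner_pd_one_surf hp hq u) (by positivity) hD.ne'

lemma lagrangian_surf (hp : 0 < p) (hq : 0 < q) (u v w : ℝ × ℝ) :
    inner ℝ (Complex.I • fderiv ℝ (surf p q ε l) u v) (fderiv ℝ (surf p q ε l) u w) = 0 := by
  simp only [fderiv_eq_pd, pd_zero_surf hp hq, pd_one_surf hp hq, profileTangent, angularTangent,
    smul_frame, frame_add, inner_smul_I_frame]
  simp
  ring

/-- In the frame, $dz^1\wedge dz^2$ of the two tangents is the nonnegative number $(pq)^{-1/2}(p
y_1^2+q y_2^2)$ times $e^{ip\theta}e^{-iq\theta}$. -/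
lemma isLagrangianAngleAt_surf (hp : 0 < p) (hq : 0 < q) (u : ℝ × ℝ) :
    IsLagrangianAngleAt (surf p q ε l) (fun w => ((p : ℝ) - q) * w.2) u := by
  have hPc : ((√p : ℝ) : ℂ) ^ 2 = p := by
    rw [← Complex.ofReal_pow, Real.sq_sqrt (Nat.cast_nonneg p)]; simp
  have hQc : ((√q : ℝ) : ℂ) ^ 2 = q := by
    rw [← Complex.ofReal_pow, Real.sq_sqrt (Nat.cast_nonneg q)]; simp
  have he : Complex.exp ((((p : ℝ) - q) * u.2 : ℝ) * Complex.I) =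
      Complex.exp (((p * u.2 : ℝ) : ℂ) * Complex.I) *
        Complex.exp (((-(q * u.2) : ℝ) : ℂ) * Complex.I) := by
    rw [← Complex.exp_add]; congr 1; push_cast; ring
  rw [IsLagrangianAngleAt, holVolume, areaDensity_surf hp hq, pd_zero_surf hp hq,
    pd_one_surf hp hq, he, profileTangent, angularTangent, smul_frame]
  simp only [frame_zero, frame_one, sqLen]
  generalize Complex.exp (((p * u.2 : ℝ) : ℂ) * Complex.I) = e₁
  generalize Complex.exp (((-(q * u.2) : ℝ) : ℂ) * Complex.I) = e₂
  push_cast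
  rw [← hPc, ← hQc]
  linear_combination (-(√(p * q : ℝ) : ℂ)⁻¹ * (√p : ℂ) ^ 2 * ((l • hyper ε u.1).1 : ℂ) ^ 2 *
    e₁ * e₂) * Complex.I_sq

lemma laplaceBeltrami_surf (hp : 0 < p) (hq : 0 < q) (hε : ε ≠ 0) (hl : l ≠ 0) (u : ℝ × ℝ) :
    laplaceBeltrami (surf p q ε l) (fun w => ((p : ℝ) - q) * w.2) u = 0 := by
  have hd : Differentiable ℝ (fun w : ℝ × ℝ => ((p : ℝ) - q) * w.2) := by fun_prop
  have h0 (w : ℝ × ℝ) : pd 0 (fun w : ℝ × ℝ => ((p : ℝ) - q) * w.2) w = 0 :=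
    pd_zero_eq hd.differentiableAt (by exact hasDerivAt_const w.1 (((p : ℝ) - q) * w.2))
  have h1 (w : ℝ × ℝ) : pd 1 (fun w : ℝ × ℝ => ((p : ℝ) - q) * w.2) w = (p : ℝ) - q :=
    pd_one_eq hd.differentiableAt (by simpa using (hasDerivAt_id w.2).const_mul ((p : ℝ) - q))
  rw [laplaceBeltrami, Fin.sum_univ_two]
  simp only [Fin.sum_univ_two, h0, h1, metric_inv_surf hp hq hε hl, areaDensity_surf hp hq]
  have hD (w : ℝ × ℝ) : sqLen p q (l • hyper ε w.1) ≠ 0 :=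
    (sqLen_pos hp hq (smul_hyper_ne_zero hε hl w.1)).ne'
  have e0 : (fun w : ℝ × ℝ => (√(p * q : ℝ))⁻¹ * sqLen p q (l • hyper ε w.1) *
      (!![((p * q : ℝ)⁻¹ * sqLen p q (l • hyper ε w.1))⁻¹, 0;
      0, (sqLen p q (l • hyper ε w.1))⁻¹] 0 0 * 0 +
      !![((p * q : ℝ)⁻¹ * sqLen p q (l • hyper ε w.1))⁻¹, 0;
      0, (sqLen p q (l • hyper ε w.1))⁻¹] 0 1 * ((p : ℝ) - q))) = fun _ => 0 := by
    ext w; simp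
  -- The factor $\sqrt{\det g}\,g^{\theta\theta}$ is constant because the metric is a function times
  -- a constant matrix, so a function linear in $\theta$ is harmonic.
  have e1 : (fun w : ℝ × ℝ => (√(p * q : ℝ))⁻¹ * sqLen p q (l • hyper ε w.1) *
      (!![((p * q : ℝ)⁻¹ * sqLen p q (l • hyper ε w.1))⁻¹, 0;
      0, (sqLen p q (l • hyper ε w.1))⁻¹] 1 0 * 0 +
      !![((p * q : ℝ)⁻¹ * sqLen p q (l • hyper ε w.1))⁻¹, 0;
      0, (sqLen p q (l • hyper ε w.1))⁻¹] 1 1 * ((p : ℝ) - q))) =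
      fun _ => (√(p * q : ℝ))⁻¹ * ((p : ℝ) - q) := by
    ext w; have := hD w; simp; field_simp
  rw [e0, e1, pd_const, pd_const]
  simp

/-- A vector with real first and imaginary second coefficient is orthogonal to `angularTangent`, so
only the profile direction contributes. -/
lemma planeProj_apply_frame (y : ℝ × ℝ) (θ : ℝ) (α β : ℝ) :
    planeProj p q y θ (frame p q θ α (Complex.I * β)) =
      ((sqLen p q y)⁻¹ * (√q * y.2 * α + √p * y.1 * β)) • profileTangent p q y θ := by
  rw [planeProj, pairProj_apply, profileTangent, angularTangent, inner_frame, inner_frame]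
  simp

/-- The self-similarity of the leaves. Position and field both lie in the real plane of coefficients
(real, imaginary), where the normal to the profile is $n=(\sqrt p\,y_1,-i\sqrt q\,y_2)$. The
position has inner product $y_1^2-y_2^2$ with $n$, one has $|n|^2=$ `sqLen`, and the field is
$(q-p)\,n/$`sqLen`. -/
lemma leaf_sub_planeProj {p q : ℕ} (hp : 0 < p) (hq : 0 < q) {y : ℝ × ℝ} (hy : y ≠ 0) (θ : ℝ) :
    ((q : ℝ) - p) • (leaf p q y θ - planeProj p q y θ (leaf p q y θ)) =
      (y.1 ^ 2 - y.2 ^ 2) • meanCurvatureField p q (leaf p q y θ) := by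
  have hD := (sqLen_pos hp hq hy).ne'
  have hP0 : √(p : ℝ) ≠ 0 := by positivity
  have hQ0 : √(q : ℝ) ≠ 0 := by positivity
  have hP := Real.sq_sqrt (Nat.cast_nonneg (α := ℝ) p)
  have hQ := Real.sq_sqrt (Nat.cast_nonneg (α := ℝ) q)
  rw [meanCurvatureField_leaf hp hq]
  unfold leaf
  rw [planeProj_apply_frame, profileTangent]
  simp only [smul_frame, frame_sub]
  congr 1
  · simp only [← Complex.ofReal_mul, ← Complex.ofReal_sub,
      Complex.ofReal_inj]
    rw [sqLen] at *
    field_simp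
    simp only [hP, hQ]
    ring
  · rw [← mul_neg Complex.I, ← Complex.ofReal_neg]
    simp only [mul_left_comm _ Complex.I, ← mul_sub]
    congr 1
    simp only [← Complex.ofReal_mul, ← Complex.ofReal_sub,
      Complex.ofReal_inj]
    rw [sqLen] at *
    field_simp
    simp only [hP, hQ]
    ring

lemma surf_sub_planeProj (hp : 0 < p) (hq : 0 < q) (hε : ε ≠ 0) (hl : l ≠ 0) (u : ℝ × ℝ) :
    ((q : ℝ) - p) • (surf p q ε l u - planeProj p q (l • hyper ε u.1) u.2 (surf p q ε l u)) =
      (l ^ 2 * ε) • meanCurvatureField p q (surf p q ε l u) := by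
  have hτ : l ^ 2 * ε = (l • hyper ε u.1).1 ^ 2 - (l • hyper ε u.1).2 ^ 2 := by
    simp only [Prod.smul_fst, Prod.smul_snd, smul_eq_mul]
    linear_combination -l ^ 2 * hyper_sq_sub ε u.1
  rw [hτ]
  exact leaf_sub_planeProj hp hq (smul_hyper_ne_zero hε hl u.1) u.2

/-- With $F_{vv}=F$ the trace of second derivatives is $(pq\,F+F_{\theta\theta})/$`sqLen`. The
coefficients $pq-p^2$ and $pq-q^2$ make it a multiple of the normal $(\sqrt p\,y_1,-i\sqrt q\,y_2)$.
-/
lemma meanCurvature_surf (hp : 0 < p) (hq : 0 < q) (hε : ε ≠ 0) (hl : l ≠ 0) (u : ℝ × ℝ) :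
    meanCurvature (surf p q ε l) u = meanCurvatureField p q (surf p q ε l u) := by
  set y := l • hyper ε u.1 with hy
  have hD := (sqLen_pos hp hq (smul_hyper_ne_zero hε hl u.1)).ne'
  rw [← hy] at hD
  have hP0 : √(p : ℝ) ≠ 0 := by positivity
  have hQ0 : √(q : ℝ) ≠ 0 := by positivity
  have hP := Real.sq_sqrt (Nat.cast_nonneg (α := ℝ) p)
  have hQ := Real.sq_sqrt (Nat.cast_nonneg (α := ℝ) q)
  have hp0 : (p : ℝ) ≠ 0 := by positivity
  have hq0 : (q : ℝ) ≠ 0 := by positivity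
  simp only [meanCurvature, Fin.sum_univ_two, metric_inv_surf hp hq hε hl, pd_zero_pd_zero_surf,
    pd_one_pd_one_surf, normalPart, tangentProj_surf hp hq hε hl, ← hy]
  have e1 : frame p q u.2 (-(p ^ 2 * ((l * (hyper ε u.1).1 / √p : ℝ) : ℂ)))
      (-(q ^ 2 * (Complex.I * ((l * (hyper ε u.1).2 / √q : ℝ) : ℂ)))) =
      frame p q u.2 ((-(p ^ 2 * (y.1 / √p)) : ℝ) : ℂ)
        (Complex.I * ((-(q ^ 2 * (y.2 / √q)) : ℝ) : ℂ)) := by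
    rw [hy]; congr 1
    · simp
    · simp; ring
  have e2 : surf p q ε l u = frame p q u.2 ((y.1 / √p : ℝ) : ℂ) (Complex.I * (y.2 / √q : ℝ)) := rfl
  rw [e1, surf, meanCurvatureField_leaf hp hq, ← hy, leaf, planeProj_apply_frame,
    planeProj_apply_frame, profileTangent]
  simp only [Matrix.of_apply, Matrix.cons_val', Matrix.cons_val_zero, Matrix.cons_val_one,
    Matrix.cons_val_fin_one, zero_smul, add_zero, zero_add, smul_frame, frame_sub, frame_add]
  congr 1
  · simp only [← Complex.ofReal_mul, ← Complex.ofReal_sub, ← Complex.ofReal_add,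
      Complex.ofReal_inj]
    rw [sqLen] at *
    field_simp
    simp only [hP, hQ]
    try field_simp
    ring
  · rw [← mul_neg Complex.I, ← Complex.ofReal_neg]
    simp only [mul_left_comm _ Complex.I, ← mul_sub, ← mul_add]
    congr 1
    simp only [← Complex.ofReal_mul, ← Complex.ofReal_sub, ← Complex.ofReal_add,
      Complex.ofReal_inj]
    rw [sqLen] at *
    field_simp
    simp only [hP, hQ]
    try field_simp
    ring

end SurfGeometry

/-! ### Deck transformations -/

/-- A point of a leaf together with the tangent plane of the leaf. -/
def leafPlane (p q : ℕ) (y : ℝ × ℝ) (θ : ℝ) : C2 × (C2 →L[ℝ] C2) :=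
  (leaf p q y θ, planeProj p q y θ)

lemma measurable_leafPlane (p q : ℕ) :
    Measurable fun x : (ℝ × ℝ) × ℝ => leafPlane p q x.1 x.2 :=
  (continuous_leaf p q).measurable.prodMk (measurable_planeProj p q)

lemma leafPlane_add_two_pi (p q : ℕ) (y : ℝ × ℝ) (θ : ℝ) :
    leafPlane p q y (θ + 2 * Real.pi) = leafPlane p q y θ := by
  simp only [leafPlane, leaf, planeProj, profileTangent, angularTangent, frame_add_two_pi]

lemma planeProj_congr_sign {p q : ℕ} {y y' : ℝ × ℝ} {θ θ' : ℝ} {m : ℝ} (hm : m ^ 2 = 1)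
    (hD : sqLen p q y = sqLen p q y')
    (h1 : angularTangent p q y θ = angularTangent p q y' θ')
    (h2 : profileTangent p q y θ = m • profileTangent p q y' θ') :
    planeProj p q y θ = planeProj p q y' θ' := by
  ext1 v
  rw [planeProj, planeProj, pairProj_apply, pairProj_apply, hD, h1, h2, real_inner_smul_left,
    smul_smul]
  congr 2
  linear_combination ((sqLen p q y')⁻¹ * inner ℝ (profileTangent p q y' θ') v) * hm

lemma leafPlane_add_pi (p q : ℕ) (y : ℝ × ℝ) (θ : ℝ) :
    leafPlane p q y (θ + Real.pi) = leafPlane p q ((-1) ^ p * y.1, (-1) ^ q * y.2) θ := by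
  have hp2 : ((-1 : ℝ) ^ p) ^ 2 = 1 := by rw [← pow_mul, mul_comm, pow_mul]; simp
  have hq2 : ((-1 : ℝ) ^ q) ^ 2 = 1 := by rw [← pow_mul, mul_comm, pow_mul]; simp
  have hp2c : ((-1 : ℂ) ^ p) ^ 2 = 1 := by rw [← pow_mul, mul_comm, pow_mul]; simp
  have hq2c : ((-1 : ℂ) ^ q) ^ 2 = 1 := by rw [← pow_mul, mul_comm, pow_mul]; simp
  refine Prod.ext ?_ ?_
  · simp only [leafPlane, leaf, frame_add_pi]
    congr 1 <;> · push_cast; ring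
  · refine planeProj_congr_sign (m := (-1) ^ p * (-1) ^ q) (by rw [mul_pow, hp2, hq2, one_mul])
      ?_ ?_ ?_
    · simp only [sqLen, mul_pow, hp2, hq2, one_mul]
    · simp only [angularTangent, frame_add_pi]
      congr 1 <;> · push_cast; ring
    · simp only [profileTangent, frame_add_pi, smul_frame]
      congr 1
      · push_cast
        linear_combination (-((-1) ^ p * (√q * y.2 : ℂ))) * hq2c
      · push_cast
        linear_combination (-((-1) ^ q * (Complex.I * (√p * y.1) : ℂ))) * hp2c

/-- `s` is a sign. -/
def IsSign (s : ℝ) : Prop := s = 1 ∨ s = -1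

lemma IsSign.sq {s : ℝ} (h : IsSign s) : s ^ 2 = 1 := by rcases h with rfl | rfl <;> norm_num

lemma IsSign.mul_self {s : ℝ} (h : IsSign s) : s * s = 1 := by
  rcases h with rfl | rfl <;> norm_num

lemma IsSign.ne_zero {s : ℝ} (h : IsSign s) : s ≠ 0 := by rcases h with rfl | rfl <;> norm_num

lemma IsSign.mul {s t : ℝ} (h : IsSign s) (h' : IsSign t) : IsSign (s * t) := by
  rcases h with rfl | rfl <;> rcases h' with rfl | rfl <;> simp [IsSign]

lemma isSign_neg_one_pow (n : ℕ) : IsSign ((-1) ^ n) := neg_one_pow_eq_or ℝ n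

lemma isSign_one : IsSign 1 := Or.inl rfl

lemma isSign_neg_one : IsSign (-1) := Or.inr rfl

/-- The half turn as a map of the parameters. If $p$ and $q$ have the same parity, it multiplies $y$
by a sign, that is, it fixes or exchanges the sheets. Otherwise one coordinate of $y$ changes sign
relative to the other, which is achieved by $v\mapsto-v$ and a possible change of sheet. -/
lemma exists_deck (p q : ℕ) {ε : ℝ} (hε : IsSign ε) : ∃ d n : ℝ, IsSign d ∧ IsSign n ∧
    ∀ l v θ, leafPlane p q (l • hyper ε v) (θ + Real.pi) =
      leafPlane p q ((l * d) • hyper ε (n * v)) θ := by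
  have key (d n : ℝ) (h : ∀ v, ((-1) ^ p * (hyper ε v).1, (-1) ^ q * (hyper ε v).2) =
      d • hyper ε (n * v)) (l v θ : ℝ) : leafPlane p q (l • hyper ε v) (θ + Real.pi) =
      leafPlane p q ((l * d) • hyper ε (n * v)) θ := by
    rw [leafPlane_add_pi, mul_smul, ← h]
    congr 1
    ext <;> simp <;> ring
  have hp := isSign_neg_one_pow p
  have hq := isSign_neg_one_pow q
  by_cases h : (-1 : ℝ) ^ p = (-1) ^ q
  · refine ⟨(-1) ^ p, 1, hp, isSign_one, key _ _ fun v => ?_⟩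
    rw [← h, one_mul]; rfl
  · have h' : (-1 : ℝ) ^ q = -(-1) ^ p := by
      rcases hp with h1 | h1 <;> rcases hq with h2 | h2 <;> rw [h1, h2] at h ⊢ <;> simp at h ⊢
    -- If $(y_1,y_2)$ is the point of the hyperbola with parameter $v$, then $\varepsilon$ times the
    -- point with parameter $-v$ is $(y_1,-y_2)$.
    refine ⟨(-1) ^ p * ε, -1, hp.mul hε, isSign_neg_one, key _ _ fun v => ?_⟩
    rw [h']
    have := hε.mul_self
    ext
    · simp [hyper]
      linear_combination (-((-1) ^ p * Real.exp v / 2)) * this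
    · simp [hyper]
      linear_combination ((-1) ^ p * Real.exp v / 2) * this

/-- Equal values of $e^{2i\theta}$ mean that the angles differ by $k\pi$. For even $k$ nothing
changes; for odd $k$ the deck transformation moves the point to another parameter at the angle
$\theta'$. -/
lemma exists_leafPlane_eq_of_exp_eq (p q : ℕ) {ε : ℝ} (hε : IsSign ε) {θ θ' : ℝ}
    (h : Complex.exp ((2 * θ : ℝ) * Complex.I) = Complex.exp ((2 * θ' : ℝ) * Complex.I))
    {s : ℝ} (hs : IsSign s) (v : ℝ) : ∃ s' v', IsSign s' ∧
      leafPlane p q (s • hyper ε v) θ = leafPlane p q (s' • hyper ε v') θ' := by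
  obtain ⟨k, hk⟩ := Complex.exp_eq_exp_iff_exists_int.1 h
  have hk' : θ = θ' + k * Real.pi := by
    have h2 : ((2 * θ : ℝ) : ℂ) = ((2 * (θ' + k * Real.pi) : ℝ) : ℂ) := by
      apply mul_right_cancel₀ Complex.I_ne_zero
      rw [hk]; push_cast; ring
    rw [Complex.ofReal_inj] at h2
    linarith
  have hper (y : ℝ × ℝ) (m : ℤ) (x : ℝ) :
      leafPlane p q y (x + m * (2 * Real.pi)) = leafPlane p q y x := by
    have : Function.Periodic (leafPlane p q y) (2 * Real.pi) := leafPlane_add_two_pi p q y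
    exact this.int_mul m x
  obtain ⟨m, hm | hm⟩ := Int.even_or_odd' k
  · refine ⟨s, v, hs, ?_⟩
    rw [← hper _ m θ', hk', hm]
    congr 1; push_cast; ring
  · obtain ⟨d, n, hd, -, hdn⟩ := exists_deck p q hε
    refine ⟨s * d, n * v, hs.mul hd, ?_⟩
    rw [← hdn, ← hper _ m (θ' + Real.pi), hk', hm]
    congr 1; push_cast; ring

/-! ### The abstract surface -/

/-- The covering of the surface by the two sheets `s = ± 1` of the hyperbola times the line of
angles; the first component records the angle modulo `π`. -/
def coverMap (p q : ℕ) (ε s : ℝ) (u : ℝ × ℝ) : ℂ × C2 :=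
  (Complex.exp ((2 * u.2 : ℝ) * Complex.I), surf p q ε s u)

lemma contDiff_coverMap (p q : ℕ) (ε s : ℝ) : ContDiff ℝ ∞ (coverMap p q ε s) := by
  have h : ContDiff ℝ ∞ fun u : ℝ × ℝ => ((2 * u.2 : ℝ) : ℂ) :=
    Complex.ofRealCLM.contDiff.comp (contDiff_const.mul contDiff_snd)
  exact ((h.mul contDiff_const).cexp).prodMk (contDiff_surf ε s)

/-- The angle of a unit complex number `e^{2iθ}`, normalised to lie near `θ₀`. -/
def angleNear (θ₀ : ℝ) (w : ℂ) : ℝ := θ₀ + (w * Complex.exp ((-2 * θ₀ : ℝ) * Complex.I)).arg / 2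

/-- The sum of the two rotated coordinates of a point of `ℂ × ℂ²`. -/
def coordSum (p q : ℕ) (θ₀ : ℝ) (x : ℂ × C2) : ℝ :=
  √p * (x.2 0 * Complex.exp ((-(p * angleNear θ₀ x.1) : ℝ) * Complex.I)).re +
    √q * (x.2 1 * Complex.exp (((q * angleNear θ₀ x.1) : ℝ) * Complex.I)).im

/-- A left inverse of `coverMap p q ε s` near the angle `θ₀`. -/
def chartFun (p q : ℕ) (s θ₀ : ℝ) (x : ℂ × C2) : ℝ × ℝ :=
  (Real.log (s * coordSum p q θ₀ x), angleNear θ₀ x.1)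

/-- The domain of `chartFun`. -/
def chartDom (p q : ℕ) (s θ₀ : ℝ) : Set (ℂ × C2) :=
  {x | x.1 * Complex.exp ((-2 * θ₀ : ℝ) * Complex.I) ∈ Complex.slitPlane ∧
    0 < s * coordSum p q θ₀ x}

/-- The angles of a chart around the angle `θ₀`. -/
def angleStrip (θ₀ : ℝ) : Set (ℝ × ℝ) :=
  Set.univ ×ˢ Set.Ioo (θ₀ - Real.pi / 2) (θ₀ + Real.pi / 2)

lemma exp_angleNear (θ₀ : ℝ) {w : ℂ} (hw : ‖w‖ = 1) :
    Complex.exp ((2 * angleNear θ₀ w : ℝ) * Complex.I) = w := by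
  set z := w * Complex.exp ((-2 * θ₀ : ℝ) * Complex.I) with hz
  have hz1 : ‖z‖ = 1 := by rw [hz, norm_mul, hw, Complex.norm_exp_ofReal_mul_I, one_mul]
  have h1 : Complex.exp (z.arg * Complex.I) = z := by
    have := Complex.norm_mul_exp_arg_mul_I z
    rwa [hz1, Complex.ofReal_one, one_mul] at this
  have : ((2 * angleNear θ₀ w : ℝ) : ℂ) * Complex.I =
      (2 * θ₀ : ℝ) * Complex.I + z.arg * Complex.I := by
    rw [angleNear, ← hz]; push_cast; ring
  rw [this, Complex.exp_add, h1, hz, mul_left_comm, ← Complex.exp_add]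
  have : ((2 * θ₀ : ℝ) : ℂ) * Complex.I + ((-2 * θ₀ : ℝ) : ℂ) * Complex.I = 0 := by
    push_cast; ring
  rw [this, Complex.exp_zero, mul_one]

lemma exp_mul_exp_neg (θ θ₀ : ℝ) : Complex.exp ((2 * θ : ℝ) * Complex.I) *
    Complex.exp ((-2 * θ₀ : ℝ) * Complex.I) = Complex.exp ((2 * (θ - θ₀) : ℝ) * Complex.I) := by
  rw [← Complex.exp_add]; congr 1; push_cast; ring

lemma arg_exp_of_mem {x : ℝ} (hx : x ∈ Set.Ioc (-Real.pi) Real.pi) :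
    (Complex.exp ((x : ℂ) * Complex.I)).arg = x := by
  rw [Complex.exp_mul_I]; exact Complex.arg_cos_add_sin_mul_I hx

lemma angleNear_exp {θ θ₀ : ℝ} (h : θ ∈ Set.Ioo (θ₀ - Real.pi / 2) (θ₀ + Real.pi / 2)) :
    angleNear θ₀ (Complex.exp ((2 * θ : ℝ) * Complex.I)) = θ := by
  rw [angleNear, exp_mul_exp_neg, arg_exp_of_mem ⟨by linarith [h.1], by linarith [h.2]⟩]
  ring

lemma exp_mem_slitPlane_near {θ θ₀ : ℝ}
    (h : θ ∈ Set.Ioo (θ₀ - Real.pi / 2) (θ₀ + Real.pi / 2)) :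
    Complex.exp ((2 * θ : ℝ) * Complex.I) * Complex.exp ((-2 * θ₀ : ℝ) * Complex.I) ∈
      Complex.slitPlane := by
  rw [exp_mul_exp_neg, Complex.mem_slitPlane_iff_arg,
    arg_exp_of_mem ⟨by linarith [h.1], by linarith [h.2]⟩]
  exact ⟨by linarith [h.2], Complex.exp_ne_zero _⟩

lemma angleNear_mem (θ₀ : ℝ) {w : ℂ}
    (hw : w * Complex.exp ((-2 * θ₀ : ℝ) * Complex.I) ∈ Complex.slitPlane) :
    angleNear θ₀ w ∈ Set.Ioo (θ₀ - Real.pi / 2) (θ₀ + Real.pi / 2) := by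
  have h1 := (Complex.mem_slitPlane_iff_arg.1 hw).1
  have h2 := Complex.neg_pi_lt_arg (w * Complex.exp ((-2 * θ₀ : ℝ) * Complex.I))
  have h3 := lt_of_le_of_ne (Complex.arg_le_pi _) h1
  rw [angleNear]
  constructor <;> linarith

lemma hyper_add (ε v : ℝ) : (hyper ε v).1 + (hyper ε v).2 = Real.exp v := by
  simp only [hyper]; ring

/-- Undoing the rotation recovers $y_1+y_2$, which on the sheet $s$ equals $s\,e^v$. Its sign tells
the sheet and its logarithm the parameter $v$. -/
lemma coordSum_leaf {p q : ℕ} (hp : 0 < p) (hq : 0 < q) (θ₀ : ℝ) {w : ℂ} (y : ℝ × ℝ) :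
    coordSum p q θ₀ (w, leaf p q y (angleNear θ₀ w)) = y.1 + y.2 := by
  have hP0 : √(p : ℝ) ≠ 0 := by positivity
  have hQ0 : √(q : ℝ) ≠ 0 := by positivity
  simp only [coordSum, leaf, frame_zero, frame_one]
  generalize angleNear θ₀ w = θ
  have h1 : Complex.exp (((p * θ : ℝ) : ℂ) * Complex.I) *
      Complex.exp (((-(p * θ) : ℝ) : ℂ) * Complex.I) = 1 := by
    rw [← Complex.exp_add]; simp
  have h2 : Complex.exp (((-(q * θ) : ℝ) : ℂ) * Complex.I) *
      Complex.exp (((q * θ : ℝ) : ℂ) * Complex.I) = 1 := by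
    rw [← Complex.exp_add]; simp
  rw [mul_assoc, h1, mul_assoc, h2]
  simp [-Complex.ofReal_div]
  field_simp

lemma isOpen_slit (θ₀ : ℝ) : IsOpen {x : ℂ × C2 |
    x.1 * Complex.exp ((-2 * θ₀ : ℝ) * Complex.I) ∈ Complex.slitPlane} :=
  Complex.isOpen_slitPlane.preimage (by fun_prop)

lemma contDiffAt_angleNear {θ₀ : ℝ} {w : ℂ}
    (h : w * Complex.exp ((-2 * θ₀ : ℝ) * Complex.I) ∈ Complex.slitPlane) :
    ContDiffAt ℝ ∞ (angleNear θ₀) w := by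
  have h1 : ContDiffAt ℝ ∞ (fun w : ℂ => Complex.log
      (w * Complex.exp ((-2 * θ₀ : ℝ) * Complex.I))) w := by
    exact ContDiffAt.comp (f := fun w : ℂ => w * Complex.exp ((-2 * θ₀ : ℝ) * Complex.I)) w
      ((Complex.contDiffAt_log h).restrict_scalars ℝ) (contDiff_id.mul contDiff_const).contDiffAt
  have h2 := (Complex.imCLM.contDiff.contDiffAt.comp w h1).div_const 2
  simp only [Function.comp_def, Complex.imCLM_apply, Complex.log_im] at h2
  exact contDiffAt_const.add h2

lemma contDiffAt_coordSum {p q : ℕ} {θ₀ : ℝ} {x : ℂ × C2}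
    (h : x.1 * Complex.exp ((-2 * θ₀ : ℝ) * Complex.I) ∈ Complex.slitPlane) :
    ContDiffAt ℝ ∞ (coordSum p q θ₀) x := by
  have hA : ContDiffAt ℝ ∞ (fun x : ℂ × C2 => angleNear θ₀ x.1) x :=
    (contDiffAt_angleNear h).comp x contDiffAt_fst
  have hz (i : Fin 2) : ContDiffAt ℝ ∞ (fun x : ℂ × C2 => x.2 i) x :=
    ((EuclideanSpace.proj i : C2 →L[ℂ] ℂ).restrictScalars ℝ).contDiff.contDiffAt.comp x
      contDiffAt_snd
  have he (c : ℝ) : ContDiffAt ℝ ∞ (fun x : ℂ × C2 =>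
      Complex.exp (((c * angleNear θ₀ x.1 : ℝ) : ℂ) * Complex.I)) x :=
    ((Complex.ofRealCLM.contDiff.contDiffAt.comp x (contDiffAt_const.mul hA)).mul
      contDiffAt_const).cexp
  have hm := he (-p)
  simp only [neg_mul] at hm
  exact (contDiffAt_const.mul (Complex.reCLM.contDiff.contDiffAt.comp x ((hz 0).mul hm))).add
    (contDiffAt_const.mul (Complex.imCLM.contDiff.contDiffAt.comp x ((hz 1).mul (he q))))

lemma contDiffAt_chartFun {p q : ℕ} {s θ₀ : ℝ} {x : ℂ × C2} (h : x ∈ chartDom p q s θ₀) :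
    ContDiffAt ℝ ∞ (chartFun p q s θ₀) x :=
  (((contDiffAt_const.mul (contDiffAt_coordSum h.1)).log h.2.ne').prodMk
    ((contDiffAt_angleNear h.1).comp x contDiffAt_fst))

lemma isOpen_chartDom (p q : ℕ) (s θ₀ : ℝ) : IsOpen (chartDom p q s θ₀) := by
  have h : ContinuousOn (fun x => s * coordSum p q θ₀ x) {x : ℂ × C2 |
      x.1 * Complex.exp ((-2 * θ₀ : ℝ) * Complex.I) ∈ Complex.slitPlane} := fun x hx =>
    (continuousAt_const.mul (contDiffAt_coordSum hx).continuousAt).continuousWithinAt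
  exact h.isOpen_inter_preimage (isOpen_slit θ₀) isOpen_Ioi

/-- The points of the surface: the common quotient of the two sheets. -/
def surfaceSet (p q : ℕ) (ε : ℝ) : Set (ℂ × C2) :=
  {x | ∃ s u, IsSign s ∧ coverMap p q ε s u = x}

/-! ### Charts of the surface, inverting the covering over strips of angles of width π. -/

section Charts

variable {p q : ℕ} {ε s θ₀ : ℝ}

lemma coordSum_coverMap (hp : 0 < p) (hq : 0 < q) (s' : ℝ) {u : ℝ × ℝ}
    (hu : u ∈ angleStrip θ₀) :
    coordSum p q θ₀ (coverMap p q ε s' u) = s' * Real.exp u.1 := by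
  have h := angleNear_exp hu.2
  rw [coverMap, surf]
  conv_lhs => rw [← congrArg (leaf p q (s' • hyper ε u.1)) h]
  rw [coordSum_leaf hp hq]
  simp [← hyper_add ε]
  ring

lemma coverMap_mem_chartDom_iff (hp : 0 < p) (hq : 0 < q) (hs : IsSign s) {s' : ℝ}
    (hs' : IsSign s') {u : ℝ × ℝ} (hu : u ∈ angleStrip θ₀) :
    coverMap p q ε s' u ∈ chartDom p q s θ₀ ↔ s' = s := by
  have h1 : (coverMap p q ε s' u).1 * Complex.exp ((-2 * θ₀ : ℝ) * Complex.I) ∈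
    Complex.slitPlane := exp_mem_slitPlane_near hu.2
  rw [chartDom, Set.mem_ofPred_eq, coordSum_coverMap hp hq s' hu, ← mul_assoc]
  simp only [h1, true_and, Real.exp_pos, mul_pos_iff_of_pos_right]
  rcases hs with rfl | rfl <;> rcases hs' with rfl | rfl <;> norm_num

lemma chartFun_coverMap (hp : 0 < p) (hq : 0 < q) (hs : IsSign s) {u : ℝ × ℝ}
    (hu : u ∈ angleStrip θ₀) : chartFun p q s θ₀ (coverMap p q ε s u) = u := by
  rw [chartFun, coordSum_coverMap hp hq s hu, ← mul_assoc, hs.mul_self, one_mul, Real.log_exp]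
  exact Prod.ext rfl (angleNear_exp hu.2)

lemma chartFun_mem {x : ℂ × C2} (hx : x ∈ chartDom p q s θ₀) :
    chartFun p q s θ₀ x ∈ angleStrip θ₀ := ⟨trivial, angleNear_mem θ₀ hx.1⟩

/-- A point of the surface may be given by an angle outside the strip and by the other sheet. The
deck transformation provides a representative inside the strip, whose sheet is then forced by the
sign of `coordSum`. -/
lemma coverMap_chartFun (hp : 0 < p) (hq : 0 < q) (hε : IsSign ε) (hs : IsSign s)
    {x : ℂ × C2} (hx : x ∈ surfaceSet p q ε) (hx' : x ∈ chartDom p q s θ₀) :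
    coverMap p q ε s (chartFun p q s θ₀ x) = x := by
  obtain ⟨s', u, hs', rfl⟩ := hx
  have h1 := exp_angleNear θ₀ (w := (coverMap p q ε s' u).1)
    (Complex.norm_exp_ofReal_mul_I _)
  obtain ⟨s₁, v₁, hs₁, h2⟩ := exists_leafPlane_eq_of_exp_eq p q hε h1.symm hs' u.1
  have h3 : coverMap p q ε s' u =
      coverMap p q ε s₁ (v₁, angleNear θ₀ (coverMap p q ε s' u).1) :=
    Prod.ext h1.symm (congrArg Prod.fst h2)
  have hmem : ((v₁, angleNear θ₀ (coverMap p q ε s' u).1) : ℝ × ℝ) ∈ angleStrip θ₀ :=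
    ⟨trivial, angleNear_mem θ₀ hx'.1⟩
  generalize angleNear θ₀ (coverMap p q ε s' u).1 = θ at h3 hmem
  rw [h3] at hx' ⊢
  obtain rfl := (coverMap_mem_chartDom_iff hp hq hs hs₁ hmem).1 hx'
  rw [chartFun_coverMap hp hq hs₁ hmem]

end Charts

/-! ### The smooth structure of the surface and its proper immersion. -/

section Surface

variable {p q : ℕ} {ε : ℝ}

/-- The covering map with values in the surface. -/
def sheetMap (p q : ℕ) (ε : ℝ) {s : ℝ} (hs : IsSign s) (u : ℝ × ℝ) : surfaceSet p q ε :=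
  ⟨coverMap p q ε s u, s, u, hs, rfl⟩

lemma continuous_sheetMap {s : ℝ} (hs : IsSign s) : Continuous (sheetMap p q ε hs) :=
  (contDiff_coverMap p q ε s).continuous.subtype_mk _

lemma exists_sheetMap_eq (x : surfaceSet p q ε) :
    ∃ (s : ℝ) (hs : IsSign s) (u : ℝ × ℝ), sheetMap p q ε hs u = x := by
  obtain ⟨x, s, u, hs, rfl⟩ := x
  exact ⟨s, hs, u, rfl⟩

lemma isOpen_angleStrip (θ₀ : ℝ) : IsOpen (angleStrip θ₀) := isOpen_univ.prod isOpen_Ioo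

/-- The chart of the sheet `s` around the angle `θ₀`. -/
def surfaceChart (hp : 0 < p) (hq : 0 < q) (hε : IsSign ε) {s : ℝ} (hs : IsSign s) (θ₀ : ℝ) :
    OpenPartialHomeomorph (surfaceSet p q ε) (ℝ × ℝ) where
  toFun x := chartFun p q s θ₀ x.1
  invFun := sheetMap p q ε hs
  source := {x | x.1 ∈ chartDom p q s θ₀}
  target := angleStrip θ₀
  map_source' _ hx := chartFun_mem hx
  map_target' _ hu := (coverMap_mem_chartDom_iff hp hq hs hs hu).2 rfl
  left_inv' x hx := Subtype.ext (coverMap_chartFun hp hq hε hs x.2 hx)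
  right_inv' _ hu := chartFun_coverMap hp hq hs hu
  open_source := (isOpen_chartDom p q s θ₀).preimage continuous_subtype_val
  open_target := isOpen_angleStrip θ₀
  continuousOn_toFun _ hx :=
    ((contDiffAt_chartFun hx).continuousAt.comp continuousAt_subtype_val).continuousWithinAt
  continuousOn_invFun := (continuous_sheetMap hs).continuousOn

lemma sheetMap_mem_surfaceChart_source (hp : 0 < p) (hq : 0 < q) (hε : IsSign ε) {s : ℝ}
    (hs : IsSign s) (u : ℝ × ℝ) :
    sheetMap p q ε hs u ∈ (surfaceChart hp hq hε hs u.2).source := by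
  refine (surfaceChart hp hq hε hs u.2).map_target ?_
  exact ⟨trivial, by linarith [Real.pi_pos], by linarith [Real.pi_pos]⟩

/-- The atlas of the surface. -/
@[reducible]
def surfaceChartedSpace (hp : 0 < p) (hq : 0 < q) (hε : IsSign ε) :
    ChartedSpace (ℝ × ℝ) (surfaceSet p q ε) where
  atlas := {e | ∃ (s : ℝ) (hs : IsSign s) (θ₀ : ℝ), e = surfaceChart hp hq hε hs θ₀}
  chartAt x := surfaceChart hp hq hε (exists_sheetMap_eq x).choose_spec.choose
    (exists_sheetMap_eq x).choose_spec.choose_spec.choose.2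
  mem_chart_source x := by
    have h := (exists_sheetMap_eq x).choose_spec.choose_spec.choose_spec
    refine (congrArg (· ∈ _) h).mp ?_
    exact sheetMap_mem_surfaceChart_source hp hq hε _ _
  chart_mem_atlas x := ⟨_, _, _, rfl⟩

/-- Transition maps factor through the ambient space $\mathbb C\times\mathbb C^2$: a smooth covering
map followed by a function that is smooth on an open set of the ambient space. -/
lemma isManifold_surface (hp : 0 < p) (hq : 0 < q) (hε : IsSign ε) :
    letI := surfaceChartedSpace hp hq hε
    IsManifold 𝓘(ℝ, ℝ × ℝ) ∞ (surfaceSet p q ε) := by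
  let := surfaceChartedSpace hp hq hε
  refine isManifold_of_contDiffOn 𝓘(ℝ, ℝ × ℝ) ∞ (surfaceSet p q ε) ?_
  rintro _ _ ⟨s, hs, θ, rfl⟩ ⟨s', hs', θ', rfl⟩
  intro u hu
  have hu' : coverMap p q ε s u ∈ chartDom p q s' θ' := hu.1.2
  exact ((contDiffAt_chartFun hu').comp u
    (contDiff_coverMap p q ε s).contDiffAt).contDiffWithinAt

/-- The abstract surface whose images under dilations are the leaves. -/
def surface (hp : 0 < p) (hq : 0 < q) (hε : IsSign ε) : SmoothSurface where
  carrier := surfaceSet p q ε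
  charted := surfaceChartedSpace hp hq hε
  manifold := isManifold_surface hp hq hε

/-- The immersion of the surface, dilated by `l`. -/
def immersion (hp : 0 < p) (hq : 0 < q) (hε : IsSign ε) (x : (surface hp hq hε).carrier) : C2 :=
  (x : surfaceSet p q ε).1.2

variable (hp : 0 < p) (hq : 0 < q) (hε : IsSign ε)

lemma exists_chartAt_eq (x : (surface hp hq hε).carrier) :
    ∃ (s : ℝ) (hs : IsSign s) (θ₀ : ℝ),
      chartAt (ℝ × ℝ) x = surfaceChart hp hq hε hs θ₀ := ⟨_, _, _, rfl⟩

lemma surf_mul (l s : ℝ) (u : ℝ × ℝ) : surf p q ε (l * s) u = l • surf p q ε s u := by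
  rw [surf, surf, mul_smul, leaf_smul]

/-- The inverse chart is the covering map on all of $\mathbb R^2$, so the coordinate expression is a
sheet of the leaf as a global function. All local geometry of the surface is thereby reduced to that
of `surf`. -/
lemma exists_localRep_eq (l : ℝ) (x : (surface hp hq hε).carrier) :
    ∃ s : ℝ, IsSign s ∧
      localRep (surface hp hq hε) (fun x => l • immersion hp hq hε x) x =
        surf p q ε (l * s) ∧
      (x : surfaceSet p q ε).1 = coverMap p q ε s (coord (surface hp hq hε) x) := by
  obtain ⟨s, hs, θ₀, h⟩ := exists_chartAt_eq hp hq hε x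
  refine ⟨s, hs, ?_, ?_⟩
  · ext1 u
    rw [localRep, h, surf_mul]
    rfl
  · have h1 := (chartAt (ℝ × ℝ) x).left_inv (mem_chart_source (ℝ × ℝ) x)
    rw [coord]
    conv_lhs => rw [← h1]
    rw [h]
    rfl

lemma continuous_immersion : Continuous (immersion hp hq hε) :=
  continuous_snd.comp continuous_subtype_val

lemma contMDiff_immersion (l : ℝ) :
    ContMDiff 𝓘(ℝ, ℝ × ℝ) 𝓘(ℝ, C2) ∞ fun x => l • immersion hp hq hε x := by
  intro x
  obtain ⟨s, -, h, -⟩ := exists_localRep_eq hp hq hε l x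
  rw [contMDiffAt_iff]
  refine ⟨((continuous_immersion hp hq hε).const_smul l).continuousAt, ?_⟩
  have h2 : (extChartAt 𝓘(ℝ, C2) (l • immersion hp hq hε x) ∘
      (fun x => l • immersion hp hq hε x) ∘ (extChartAt 𝓘(ℝ, ℝ × ℝ) x).symm) =
      surf p q ε (l * s) := by
    rw [← h]; rfl
  rw [h2]
  exact (contDiff_surf ε (l * s)).contDiffAt.contDiffWithinAt

lemma coverMap_add_two_pi (s v θ : ℝ) :
    coverMap p q ε s (v, θ + 2 * Real.pi) = coverMap p q ε s (v, θ) := by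
  refine Prod.ext ?_ (congrArg Prod.fst (leafPlane_add_two_pi p q (s • hyper ε v) θ))
  change Complex.exp _ = Complex.exp _
  rw [Complex.exp_eq_exp_iff_exists_int]
  exact ⟨2, by push_cast; ring⟩

lemma exists_sheetMap_eq_Icc {s : ℝ} (hs : IsSign s) (u : ℝ × ℝ) :
    ∃ θ ∈ Set.Icc 0 (2 * Real.pi), sheetMap p q ε hs (u.1, θ) = sheetMap p q ε hs u := by
  have hper : Function.Periodic (fun θ => coverMap p q ε s (u.1, θ)) (2 * Real.pi) :=
    fun θ => coverMap_add_two_pi s u.1 θ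
  obtain ⟨θ, hθ, h⟩ := hper.exists_mem_Ico₀ Real.two_pi_pos u.2
  exact ⟨θ, ⟨hθ.1, hθ.2.le⟩, Subtype.ext h.symm⟩

lemma norm_leaf_sq (y : ℝ × ℝ) (θ : ℝ) : ‖leaf p q y θ‖ ^ 2 = y.1 ^ 2 / p + y.2 ^ 2 / q := by
  rw [leaf, norm_frame_sq]
  simp only [norm_mul, Complex.norm_I, one_mul, Complex.norm_real, Real.norm_eq_abs,
    sq_abs, div_pow, Real.sq_sqrt (Nat.cast_nonneg (α := ℝ) _)]

include hp hq in
lemma sq_add_sq_le_norm_leaf (y : ℝ × ℝ) (θ : ℝ) :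
    y.1 ^ 2 + y.2 ^ 2 ≤ (p + q) * ‖leaf p q y θ‖ ^ 2 := by
  have hp' : (0 : ℝ) < p := by exact_mod_cast hp
  have hq' : (0 : ℝ) < q := by exact_mod_cast hq
  rw [norm_leaf_sq]
  have h1 : (p : ℝ) * (y.1 ^ 2 / p) = y.1 ^ 2 := by field_simp
  have h2 : (q : ℝ) * (y.2 ^ 2 / q) = y.2 ^ 2 := by field_simp
  have h3 : 0 ≤ (q : ℝ) * (y.1 ^ 2 / p) := by positivity
  have h4 : 0 ≤ (p : ℝ) * (y.2 ^ 2 / q) := by positivity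
  linarith

include hp hq hε in
-- On a leaf $y_1^2+y_2^2=(e^{2v}+e^{-2v})/2$, since the cross terms cancel, so bounded sets of
-- $\mathbb C^2$ have bounded parameter $v$.
lemma abs_le_of_norm_surf_le {s : ℝ} (hs : IsSign s) {R : ℝ} {u : ℝ × ℝ}
    (h : ‖surf p q ε s u‖ ≤ R) : |u.1| ≤ 2 * (p + q) * R ^ 2 + 1 := by
  have h1 := sq_add_sq_le_norm_leaf hp hq (s • hyper ε u.1) u.2
  have h2 : ‖surf p q ε s u‖ ^ 2 ≤ R ^ 2 := pow_le_pow_left₀ (norm_nonneg _) h 2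
  have hpq : (0 : ℝ) ≤ p + q := by positivity
  have h3 : (s • hyper ε u.1).1 ^ 2 + (s • hyper ε u.1).2 ^ 2 ≤ (p + q) * R ^ 2 :=
    h1.trans (mul_le_mul_of_nonneg_left h2 hpq)
  have h4 : (s • hyper ε u.1).1 ^ 2 + (s • hyper ε u.1).2 ^ 2 =
      (Real.exp u.1 ^ 2 + Real.exp (-u.1) ^ 2) / 2 := by
    simp only [hyper, Prod.smul_fst, Prod.smul_snd, smul_eq_mul, mul_pow, hs.sq]
    linear_combination (Real.exp (-u.1) ^ 2 / 2) * hε.sq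
  rw [h4] at h3
  have h5 := Real.add_one_le_exp u.1
  have h6 := Real.add_one_le_exp (-u.1)
  have h7 := sq_nonneg (Real.exp u.1 - 1)
  have h8 := sq_nonneg (Real.exp (-u.1) - 1)
  rw [abs_le]
  constructor <;> nlinarith [sq_nonneg (Real.exp u.1), sq_nonneg (Real.exp (-u.1))]

/-- The preimage of a compact set is closed and lies in the images of two compact rectangles, one
for each sheet: $v$ is bounded by the norm estimate and $\theta$ may be taken in $[0,2\pi]$. -/
lemma isProperMap_immersion {l : ℝ} (hl : l ≠ 0) :
    IsProperMap fun x => l • immersion hp hq hε x := by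
  rw [isProperMap_iff_isCompact_preimage]
  have hc := (continuous_immersion hp hq hε).const_smul l
  refine ⟨hc, fun K hK => ?_⟩
  obtain ⟨R, hR⟩ := hK.isBounded.exists_norm_le
  set B := 2 * (p + q) * (R / |l|) ^ 2 + 1 with hB
  have key (s : ℝ) (hs : IsSign s) : IsCompact (sheetMap p q ε hs ''
      (Set.Icc (-B) B ×ˢ Set.Icc 0 (2 * Real.pi))) :=
    (isCompact_Icc.prod isCompact_Icc).image (continuous_sheetMap hs)
  refine ((key 1 isSign_one).union (key (-1) isSign_neg_one)).of_isClosed_subset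
    (hK.isClosed.preimage hc) fun x hx => ?_
  obtain ⟨s, hs, u, rfl⟩ := exists_sheetMap_eq x
  have h1 : ‖surf p q ε s u‖ ≤ R / |l| := by
    rw [le_div_iff₀ (abs_pos.2 hl), mul_comm, ← Real.norm_eq_abs, ← norm_smul]
    exact hR _ hx
  have h2 := abs_le.1 (abs_le_of_norm_surf_le hp hq hε hs h1)
  obtain ⟨θ, hθ, h⟩ := exists_sheetMap_eq_Icc (p := p) (q := q) (ε := ε) hs u
  rcases hs with rfl | rfl
  · exact Or.inl ⟨(u.1, θ), ⟨⟨h2.1, h2.2⟩, hθ⟩, h⟩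
  · exact Or.inr ⟨(u.1, θ), ⟨⟨h2.1, h2.2⟩, hθ⟩, h⟩

lemma isHamiltonianStationary_surface {l : ℝ} (hl : l ≠ 0) :
    IsHamiltonianStationary (surface hp hq hε) fun x => l • immersion hp hq hε x where
  immersion :=
    { smooth := contMDiff_immersion hp hq hε l
      immersive := fun x => by
        obtain ⟨s, hs, h, -⟩ := exists_localRep_eq hp hq hε l x
        rw [h]
        exact injective_fderiv_surf hp hq hε.ne_zero (mul_ne_zero hl hs.ne_zero) _
      proper := isProperMap_immersion hp hq hε hl }
  lagrangian := fun x v w => by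
    obtain ⟨s, hs, h, -⟩ := exists_localRep_eq hp hq hε l x
    rw [h]
    exact lagrangian_surf hp hq _ v w
  harmonic := fun x => by
    obtain ⟨s, hs, h, -⟩ := exists_localRep_eq hp hq hε l x
    rw [h]
    exact ⟨fun w => ((p : ℝ) - q) * w.2, (contDiff_const.mul contDiff_snd).contDiffAt,
      Eventually.of_forall fun u => isLagrangianAngleAt_surf hp hq u,
      laplaceBeltrami_surf hp hq hε.ne_zero (mul_ne_zero hl hs.ne_zero) _⟩

/-- With $\tau=l^2\varepsilon=2t(q-p)$, the identity $(q-p)F^\perp=\tau H$ is divided by $q-p\neq0$.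
-/
lemma isSelfSimilar_surface (hne : p ≠ q) {l t : ℝ} (hl : l ≠ 0)
    (ht : l ^ 2 * ε = 2 * t * ((q : ℝ) - p)) :
    IsSelfSimilar (surface hp hq hε) (fun x => l • immersion hp hq hε x) t := by
  intro x
  obtain ⟨s, hs, h, hx⟩ := exists_localRep_eq hp hq hε l x
  have hls : l * s ≠ 0 := mul_ne_zero hl hs.ne_zero
  have hF : l • immersion hp hq hε x =
      surf p q ε (l * s) (coord (surface hp hq hε) x) := by
    rw [surf_mul, immersion, hx, coverMap]
  have hd : (q : ℝ) - p ≠ 0 := sub_ne_zero.2 (by exact_mod_cast hne.symm)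
  simp only [h, hF, normalPart, tangentProj_surf hp hq hε.ne_zero hls,
    meanCurvature_surf hp hq hε.ne_zero hls]
  have := surf_sub_planeProj hp hq hε.ne_zero hls (coord (surface hp hq hε) x)
  rw [mul_pow, hs.sq, mul_one, ht, mul_comm (2 * t), mul_smul ((q : ℝ) - p)] at this
  exact smul_right_injective _ hd this

end Surface

/-! ### Periodic integrals -/

lemma setLIntegral_Ioo_periodic {f : ℝ → ENNReal} {T : ℝ} (hT : 0 < T)
    (hf : Function.Periodic f T) (a b : ℝ) :
    ∫⁻ x in Set.Ioo a (a + T), f x = ∫⁻ x in Set.Ioo b (b + T), f x := by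
  rw [setLIntegral_congr Ioo_ae_eq_Ioc, setLIntegral_congr Ioo_ae_eq_Ioc]
  refine (isAddFundamentalDomain_Ioc hT a).setLIntegral_eq (isAddFundamentalDomain_Ioc hT b) f ?_
  rintro ⟨g, k, rfl⟩ x
  have := hf.int_mul k x
  rw [← this]
  congr 1
  change k • T + x = x + k * T
  rw [zsmul_eq_mul, add_comm]

/-! ### Sweeping a profile curve around -/

/-- The measure on `ℂ² × G(4,2)` swept out by the profile curve `y` with parameters in `A` under
all rotations, with density `w`. -/
def sweep (p q : ℕ) (A : Set ℝ) (y : ℝ → ℝ × ℝ) (w : ℝ → ℝ) : Measure (C2 × (C2 →L[ℝ] C2)) :=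
  ((volume.restrict (A ×ˢ Set.Ioo (0 : ℝ) (2 * Real.pi))).withDensity
    fun u => ENNReal.ofReal (w u.1)).map fun u => leafPlane p q (y u.1) u.2

section Sweep

variable {p q : ℕ} {A : Set ℝ} {y : ℝ → ℝ × ℝ} {w : ℝ → ℝ}

lemma measurable_leafPlane_comp (hy : Measurable y) :
    Measurable fun u : ℝ × ℝ => leafPlane p q (y u.1) u.2 :=
  (measurable_leafPlane p q).comp ((hy.comp measurable_fst).prodMk measurable_snd)

lemma lintegral_withDensity_strip (hw : Measurable w) {g : ℝ × ℝ → ENNReal} (hg : Measurable g)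
    (B : Set ℝ) :
    ∫⁻ u, g u ∂((volume.restrict (A ×ˢ B)).withDensity fun u => ENNReal.ofReal (w u.1)) =
      ∫⁻ θ in B, ∫⁻ r in A, ENNReal.ofReal (w r) * g (r, θ) := by
  have hw' : Measurable fun u : ℝ × ℝ => ENNReal.ofReal (w u.1) :=
    (hw.comp measurable_fst).ennreal_ofReal
  rw [lintegral_withDensity_eq_lintegral_mul _ hw' hg, Measure.volume_eq_prod,
    ← Measure.prod_restrict, lintegral_prod_symm _ (hw'.mul hg).aemeasurable]
  rfl

lemma lintegral_sweep (hy : Measurable y) (hw : Measurable w)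
    {g : C2 × (C2 →L[ℝ] C2) → ENNReal} (hg : Measurable g) :
    ∫⁻ z, g z ∂sweep p q A y w = ∫⁻ θ in Set.Ioo 0 (2 * Real.pi), ∫⁻ r in A,
      ENNReal.ofReal (w r) * g (leafPlane p q (y r) θ) := by
  rw [sweep, lintegral_map hg (measurable_leafPlane_comp hy),
    lintegral_withDensity_strip hw (g := fun u => g (leafPlane p q (y u.1) u.2))
      (hg.comp (measurable_leafPlane_comp hy))]

lemma sweep_congr (hA : MeasurableSet A) {y' : ℝ → ℝ × ℝ} {w' : ℝ → ℝ} (hy : Measurable y)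
    (hw : Measurable w) (hy' : Measurable y') (hw' : Measurable w')
    (h1 : ∀ r ∈ A, y r = y' r) (h2 : ∀ r ∈ A, w r = w' r) :
    sweep p q A y w = sweep p q A y' w' := by
  refine Measure.ext_of_lintegral _ fun g hg => ?_
  rw [lintegral_sweep hy hw hg, lintegral_sweep hy' hw' hg]
  refine lintegral_congr fun θ => setLIntegral_congr_fun hA fun r hr => ?_
  simp only [h1 r hr, h2 r hr]

lemma sweep_image (hA : MeasurableSet A) {φ φ' : ℝ → ℝ} (hφ : Measurable φ) (hφ' : Measurable φ')
    (hd : ∀ r ∈ A, HasDerivAt φ (φ' r) r) (hi : Set.InjOn φ A) (hy : Measurable y)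
    (hw : Measurable w) :
    sweep p q (φ '' A) y w = sweep p q A (y ∘ φ) (fun r => |φ' r| * w (φ r)) := by
  refine Measure.ext_of_lintegral _ fun g hg => ?_
  have hw' : Measurable fun r => |φ' r| * w (φ r) :=
    (measurable_norm.comp hφ').mul (hw.comp hφ)
  rw [lintegral_sweep hy hw hg, lintegral_sweep (hy.comp hφ) hw' hg]
  refine lintegral_congr fun θ => ?_
  rw [lintegral_image_eq_lintegral_abs_deriv_mul hA (fun r hr => (hd r hr).hasDerivWithinAt) hi]
  refine lintegral_congr fun r => ?_
  rw [← mul_assoc, ← ENNReal.ofReal_mul (abs_nonneg _)]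
  rfl

lemma sweep_univ (hy : Measurable y) (hw : Measurable w) :
    sweep p q Set.univ y w = sweep p q (Set.Ioi 0) y w + sweep p q (Set.Iio 0) y w := by
  refine Measure.ext_of_lintegral _ fun g hg => ?_
  rw [lintegral_add_measure, lintegral_sweep hy hw hg, lintegral_sweep hy hw hg,
    lintegral_sweep hy hw hg]
  have hm : Measurable fun u : ℝ × ℝ =>
      ENNReal.ofReal (w u.1) * g (leafPlane p q (y u.1) u.2) :=
    (hw.comp measurable_fst).ennreal_ofReal.mul (hg.comp (measurable_leafPlane_comp hy))
  rw [← lintegral_add_left (hm.lintegral_prod_left' (μ := volume.restrict (Set.Ioi 0)))]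
  refine lintegral_congr fun θ => ?_
  rw [Measure.restrict_univ, ← lintegral_add_compl _ measurableSet_Ioi (A := Set.Ioi 0),
    Set.compl_Ioi, setLIntegral_congr (Iio_ae_eq_Iic (a := (0 : ℝ)))]

/-- The half turn `θ ↦ θ + π` acts by signs on the profile. -/
lemma sweep_half_turn (hy : Measurable y) (hw : Measurable w) :
    sweep p q A (fun r => ((-1) ^ p * (y r).1, (-1) ^ q * (y r).2)) w = sweep p q A y w := by
  have hy' : Measurable fun r => ((-1 : ℝ) ^ p * (y r).1, (-1 : ℝ) ^ q * (y r).2) := by fun_prop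
  refine Measure.ext_of_lintegral _ fun g hg => ?_
  rw [lintegral_sweep hy hw hg, lintegral_sweep hy' hw hg]
  set f : ℝ → ENNReal := fun θ => ∫⁻ r in A, ENNReal.ofReal (w r) * g (leafPlane p q (y r) θ)
    with hf
  have hper : Function.Periodic f (2 * Real.pi) := fun θ => by
    simp only [hf, leafPlane_add_two_pi]
  have h1 := setLIntegral_Ioo_periodic Real.two_pi_pos hper 0 (0 + Real.pi)
  rw [zero_add] at h1
  rw [h1]
  have h2 : Set.Ioo (0 + Real.pi) (0 + Real.pi + 2 * Real.pi) =
      (fun θ => θ + Real.pi) '' Set.Ioo 0 (2 * Real.pi) := by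
    rw [Set.image_add_const_Ioo]; congr 1; ring
  rw [h2, ← (measurePreserving_add_right volume Real.pi).setLIntegral_comp_emb
    (measurableEmbedding_addRight Real.pi) f]
  simp only [hf, leafPlane_add_pi]

end Sweep

/-! ### The measures of the leaves -/

/-- One quarter of the hyperbola `y₁² - y₂² = τ`, parametrised by `r > √|τ|`. -/
def arm (τ s₁ s₂ r : ℝ) : ℝ × ℝ := (s₁ * ((r + τ / r) / 2), s₂ * ((r - τ / r) / 2))

/-- The area density in the parametrisation `arm`. -/
def armDensity (p q : ℕ) (τ r : ℝ) : ℝ := (√(p * q : ℝ))⁻¹ * sqLen p q (arm τ 1 1 r) / r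

/-- The varifold measure of the leaf `y₁² - y₂² = τ`, each point being attained twice in the
sum because of the half turn. -/
def leafMeasure (p q : ℕ) (τ : ℝ) : Measure (C2 × (C2 →L[ℝ] C2)) :=
  (2⁻¹ : ENNReal) •
    ((sweep p q (Set.Ioi √|τ|) (arm τ 1 1) (armDensity p q τ) +
      sweep p q (Set.Ioi √|τ|) (arm τ (-1) (-1)) (armDensity p q τ)) +
    (sweep p q (Set.Ioi √|τ|) (arm τ 1 (-1)) (armDensity p q τ) +
      sweep p q (Set.Ioi √|τ|) (arm τ (-1) 1) (armDensity p q τ)))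

/-- The area density in conformal coordinates. -/
def sheetDensity (p q : ℕ) (ε l v : ℝ) : ℝ := (√(p * q : ℝ))⁻¹ * sqLen p q (l • hyper ε v)

lemma measurable_arm (τ s₁ s₂ : ℝ) : Measurable (arm τ s₁ s₂) := by
  unfold arm; fun_prop

lemma measurable_armDensity (p q : ℕ) (τ : ℝ) : Measurable (armDensity p q τ) := by
  unfold armDensity
  exact (((continuous_sqLen p q).measurable.comp (measurable_arm τ 1 1)).const_mul _).div
    measurable_id

lemma continuous_hyper (ε : ℝ) : Continuous (hyper ε) := by unfold hyper; fun_prop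

lemma continuous_sheetDensity (p q : ℕ) (ε l : ℝ) : Continuous (sheetDensity p q ε l) := by
  unfold sheetDensity
  exact continuous_const.mul ((continuous_sqLen p q).comp ((continuous_hyper ε).const_smul l))

lemma sheetDensity_neg_arg {p q : ℕ} {ε : ℝ} (hε : IsSign ε) (l v : ℝ) :
    sheetDensity p q ε l (-v) = sheetDensity p q ε l v := by
  simp only [sheetDensity, sqLen, hyper, Prod.smul_fst, Prod.smul_snd, smul_eq_mul, neg_neg]
  rcases hε with rfl | rfl <;> ring

/-- The substitution $r=l\,e^v$; the division by $r$ in `armDensity` is cancelled by $dr=r\,dv$. -/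
lemma sweep_Ioi_exp {p q : ℕ} {ε : ℝ} {l : ℝ} (hl : 0 < l) (s₁ s₂ : ℝ) :
    sweep p q (Set.Ioi l) (arm (l ^ 2 * ε) s₁ s₂) (armDensity p q (l ^ 2 * ε)) =
      sweep p q (Set.Ioi 0) (fun v => (s₁ * (l * (hyper ε v).1), s₂ * (l * (hyper ε v).2)))
        (sheetDensity p q ε l) := by
  have himg : Set.Ioi l = (fun v => l * Real.exp v) '' Set.Ioi 0 := by
    ext r
    constructor
    · intro hr
      have hr' : l < r := hr
      refine ⟨Real.log (r / l), Real.log_pos ((one_lt_div hl).2 hr'), ?_⟩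
      simp only
      rw [Real.exp_log (div_pos (hl.trans hr') hl)]; field_simp
    · rintro ⟨v, hv, rfl⟩
      have hv' : (0 : ℝ) < v := hv
      have := Real.one_lt_exp_iff.2 hv'
      change l < l * Real.exp v
      nlinarith
  have harm (s₁ s₂ v : ℝ) : arm (l ^ 2 * ε) s₁ s₂ (l * Real.exp v) =
      (s₁ * (l * (hyper ε v).1), s₂ * (l * (hyper ε v).2)) := by
    have hne := (Real.exp_pos v).ne'
    simp only [arm, hyper, Real.exp_neg]
    ext <;> · simp only; field_simp
  rw [himg, sweep_image measurableSet_Ioi (φ' := fun v => l * Real.exp v) (by fun_prop)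
    (by fun_prop) (fun r _ => (Real.hasDerivAt_exp r).const_mul l) ?_ (measurable_arm _ _ _)
    (measurable_armDensity _ _ _)]
  · have hm : Measurable fun v => (s₁ * (l * (hyper ε v).1), s₂ * (l * (hyper ε v).2)) := by
      have := (continuous_hyper ε).measurable
      fun_prop
    have he : Measurable fun v => l * Real.exp v := by fun_prop
    refine sweep_congr measurableSet_Ioi ((measurable_arm _ _ _).comp he)
      ((measurable_norm.comp he).mul ((measurable_armDensity _ _ _).comp he)) hm
      (continuous_sheetDensity _ _ _ _).measurable (fun v _ => harm s₁ s₂ v) fun v _ => ?_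
    · have h0 : 0 < l * Real.exp v := by positivity
      rw [armDensity, harm, abs_of_pos h0, sheetDensity]
      field_simp
      congr 1
  · intro a _ b _ hab
    exact Real.exp_injective (mul_left_cancel₀ hl.ne' hab)

/-- The substitution $v\mapsto-v$. The hyperbola at $-v$ is $\varepsilon(y_1,-y_2)$, which explains
the signs of the arm. -/
lemma sweep_Iio_exp {p q : ℕ} {ε : ℝ} (hε : IsSign ε) {l : ℝ} (hl : 0 < l) (s : ℝ) :
    sweep p q (Set.Iio 0) (fun v => (s * l) • hyper ε v) (sheetDensity p q ε l) =
      sweep p q (Set.Ioi l) (arm (l ^ 2 * ε) (s * ε) (-(s * ε)))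
        (armDensity p q (l ^ 2 * ε)) := by
  have himg : Set.Iio (0 : ℝ) = (fun v => -v) '' Set.Ioi 0 := by simp
  have hm := (continuous_hyper ε).measurable
  rw [sweep_Ioi_exp hl, himg, sweep_image measurableSet_Ioi (φ' := fun v => -1) (by fun_prop)
    (by fun_prop) (fun r _ => hasDerivAt_neg r) neg_injective.injOn (by fun_prop)
    (continuous_sheetDensity _ _ _ _).measurable]
  refine sweep_congr measurableSet_Ioi (by fun_prop) ?_ (by fun_prop)
    (continuous_sheetDensity _ _ _ _).measurable (fun v _ => ?_) fun v _ => ?_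
  · exact measurable_const.mul ((continuous_sheetDensity _ _ _ _).measurable.comp measurable_neg)
  · simp only [Function.comp, hyper, neg_neg]
    rcases hε with rfl | rfl <;> ext <;> simp <;> ring
  · rw [sheetDensity_neg_arg hε]; simp

/-- Each of the two sheets $\pm l$ is cut at $v=0$ into two of the four arms. The arms are suited to
the limit $\tau\to0$, the sheets to calculus on a smooth surface. -/
lemma leafMeasure_eq_sheets {p q : ℕ} {ε : ℝ} (hε : IsSign ε) {l : ℝ} (hl : 0 < l) :
    leafMeasure p q (l ^ 2 * ε) = (2⁻¹ : ENNReal) •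
      (sweep p q Set.univ (fun v => l • hyper ε v) (sheetDensity p q ε l) +
        sweep p q Set.univ (fun v => (-l) • hyper ε v) (sheetDensity p q ε l)) := by
  have hsq : √|l ^ 2 * ε| = l := by
    rcases hε with rfl | rfl <;> simp [Real.sqrt_sq hl.le, abs_of_pos hl]
  have hm := (continuous_hyper ε).measurable
  have hd := (continuous_sheetDensity p q ε l).measurable
  have h1 := sweep_Iio_exp (p := p) (q := q) hε hl 1
  have h2 := sweep_Iio_exp (p := p) (q := q) hε hl (-1)
  simp only [one_mul, neg_mul, neg_neg] at h1 h2
  have e1 : (fun v => ((1 : ℝ) * (l * (hyper ε v).1), (1 : ℝ) * (l * (hyper ε v).2))) =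
      fun v => l • hyper ε v := by ext v <;> simp
  have e2 : (fun v => ((-1 : ℝ) * (l * (hyper ε v).1), (-1 : ℝ) * (l * (hyper ε v).2))) =
      fun v => (-l) • hyper ε v := by ext v <;> simp
  rw [leafMeasure, hsq, sweep_univ (by fun_prop) hd, sweep_univ (by fun_prop) hd, h1, h2,
    sweep_Ioi_exp hl 1 1, sweep_Ioi_exp hl (-1) (-1), e1, e2]
  congr 1
  rcases hε with rfl | rfl
  · abel
  · simp only [neg_neg]; abel

/-! ### The cones as leaves -/

/-- The profile coordinate of the unit vectors in the cones. -/
def coneCoord (p q : ℕ) : ℝ := √((p * q : ℝ) / (p + q))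

section Cone

variable {p q : ℕ}

lemma coneCoord_sq (p q : ℕ) : coneCoord p q ^ 2 = (p * q : ℝ) / (p + q) :=
  Real.sq_sqrt (by positivity)

lemma coneCoord_pos (hp : 0 < p) (hq : 0 < q) : 0 < coneCoord p q := by
  unfold coneCoord; positivity

lemma coneCoord_div_sqrt_left (hp : 0 < p) :
    coneCoord p q / √p = √((q : ℝ) / (p + q)) := by
  rw [coneCoord, ← Real.sqrt_div (by positivity)]
  congr 1
  have : (p : ℝ) ≠ 0 := by positivity
  field_simp

lemma coneCoord_div_sqrt_right (hq : 0 < q) :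
    coneCoord p q / √q = √((p : ℝ) / (p + q)) := by
  rw [coneCoord, ← Real.sqrt_div (by positivity)]
  congr 1
  have : (q : ℝ) ≠ 0 := by positivity
  field_simp

lemma leaf_coneCoord (hp : 0 < p) (hq : 0 < q) (a b θ : ℝ) :
    leaf p q (a * coneCoord p q, b * coneCoord p q) θ =
      !₂[(a : ℂ) * curve p q θ 0, (b : ℂ) * curve p q θ 1] := by
  rw [leaf]
  simp only [mul_div_assoc, coneCoord_div_sqrt_left hp, coneCoord_div_sqrt_right hq]
  apply C2_ext <;> simp [curve] <;> ring

lemma curve_eq_leaf (hp : 0 < p) (hq : 0 < q) :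
    curve p q = leaf p q (1 * coneCoord p q, 1 * coneCoord p q) := by
  ext1 θ
  rw [leaf_coneCoord hp hq]
  apply C2_ext <;> simp

lemma companionCurve_eq_leaf_of_odd (hp : 0 < p) (hq : 0 < q) (h : Odd p) :
    companionCurve p q = leaf p q (1 * coneCoord p q, -1 * coneCoord p q) := by
  ext1 θ
  rw [leaf_coneCoord hp hq, companionCurve, if_pos h]
  apply C2_ext <;> simp

lemma companionCurve_eq_leaf_of_even (hp : 0 < p) (hq : 0 < q) (h : Even p) :
    companionCurve p q = leaf p q (-1 * coneCoord p q, 1 * coneCoord p q) := by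
  ext1 θ
  rw [leaf_coneCoord hp hq, companionCurve, if_neg (Nat.not_odd_iff_even.2 h)]
  apply C2_ext <;> simp

/-- On the lines $y_2=\pm y_1$ the position vector is tangent to the profile, as it must be for a
cone. -/
lemma profileTangent_of_eq_mul (hp : 0 < p) (hq : 0 < q) {k m θ : ℝ} (hm : IsSign m) :
    leaf p q (k, m * k) θ = (m * (√(p * q : ℝ))⁻¹) • profileTangent p q (k, m * k) θ := by
  have hP0 : √(p : ℝ) ≠ 0 := by positivity
  have hQ0 : √(q : ℝ) ≠ 0 := by positivity
  rw [leaf, profileTangent, smul_frame, Real.sqrt_mul (Nat.cast_nonneg p)]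
  congr 1
  · rw [← Complex.ofReal_mul, Complex.ofReal_inj]
    field_simp
    linear_combination (-k) * hm.sq
  · rw [mul_left_comm, ← Complex.ofReal_mul]
    congr 2
    field_simp

/-- For $k^2=pq/(p+q)$ the vectors $(k,\pm k)$ give a curve of unit vectors with `sqLen` equal to
$pq$. The polar parametrisation then has orthogonal coordinate vectors and area density
$\sqrt{pq}\,r$. -/
lemma coneMeasure_leaf (hp : 0 < p) (hq : 0 < q) {k m : ℝ} (hk : k ^ 2 = (p * q : ℝ) / (p + q))
    (hm : IsSign m) :
    coneMeasure (leaf p q (k, m * k)) =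
      sweep p q (Set.Ioi 0) (fun r => r • (k, m * k)) (fun r => √(p * q : ℝ) * r) := by
  have hp' : (0 : ℝ) < p := by exact_mod_cast hp
  have hq' : (0 : ℝ) < q := by exact_mod_cast hq
  set y : ℝ × ℝ := (k, m * k) with hy
  have hparam (u : ℝ × ℝ) : coneParam (leaf p q y) u = leaf p q (u.1 • y) u.2 := by
    rw [coneParam, leaf_smul]
  have hk' : k ^ 2 * (p + q) = p * q := by rw [hk]; field_simp
  have hlen : sqLen p q y = p * q := by
    rw [hy, sqLen, mul_pow, hm.sq]; linear_combination hk'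
  have h0 (u : ℝ × ℝ) : pd 0 (coneParam (leaf p q y)) u = leaf p q y u.2 := by
    rw [funext hparam]
    have hα : ∀ c v : ℝ, HasDerivAt (fun s : ℝ => ((s * c : ℝ) : ℂ)) (c : ℂ) v := fun c v => by
      simpa using ((hasDerivAt_id v).mul_const c).ofReal_comp
    have hc : ∀ c : ℝ, ContDiff ℝ ∞ (fun s : ℝ => ((s * c : ℝ) : ℂ)) := fun c =>
      Complex.ofRealCLM.contDiff.comp (contDiff_id.mul contDiff_const)
    have := pd_zero_frame (p := p) (q := q) (u := u) (hc (y.1 / √p))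
      (contDiff_const.mul (hc (y.2 / √q)))
      (hα (y.1 / √p) u.1) ((hα (y.2 / √q) u.1).const_mul Complex.I)
    simp only [← mul_div_assoc] at this
    exact this
  have h1 (u : ℝ × ℝ) : pd 1 (coneParam (leaf p q y)) u = angularTangent p q (u.1 • y) u.2 := by
    rw [funext hparam]
    have hc : ∀ c : ℝ, ContDiff ℝ ∞ (fun s : ℝ => ((s * c : ℝ) : ℂ)) := fun c =>
      Complex.ofRealCLM.contDiff.comp (contDiff_id.mul contDiff_const)
    have := pd_one_frame (p := p) (q := q) (u := u)
      (β := fun s : ℝ => Complex.I * ((s * (y.2 / √q) : ℝ) : ℂ)) (hc (y.1 / √p))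
      (contDiff_const.mul (hc (y.2 / √q)))
    simp only [← mul_div_assoc] at this
    refine this.trans ?_
    rw [angularTangent]
    have hP0 : ((√p : ℝ) : ℂ) ≠ 0 := by rw [Complex.ofReal_ne_zero]; positivity
    have hQ0 : ((√q : ℝ) : ℂ) ≠ 0 := by rw [Complex.ofReal_ne_zero]; positivity
    have hPc : ((√p : ℝ) : ℂ) ^ 2 = p := by
      rw [← Complex.ofReal_pow, Real.sq_sqrt (Nat.cast_nonneg p)]; simp
    have hQc : ((√q : ℝ) : ℂ) ^ 2 = q := by
      rw [← Complex.ofReal_pow, Real.sq_sqrt (Nat.cast_nonneg q)]; simp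
    congr 1
    · simp; rw [← hPc]; field_simp
    · simp; rw [← hQc]; field_simp; simp
  have hns : √(p * q : ℝ) ≠ 0 := by positivity
  have hs2 : √(p * q : ℝ) ^ 2 = p * q := Real.sq_sqrt (by positivity)
  have hA (θ : ℝ) : leaf p q y θ = (m * (√(p * q : ℝ))⁻¹) • profileTangent p q y θ :=
    profileTangent_of_eq_mul hp hq hm
  have hAB (u : ℝ × ℝ) : inner ℝ (leaf p q y u.2) (angularTangent p q (u.1 • y) u.2) = 0 := by
    rw [hA, angularTangent_smul, real_inner_smul_left, real_inner_smul_right,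
      inner_profileTangent_angularTangent]
    simp
  have ha (u : ℝ × ℝ) : inner ℝ (leaf p q y u.2) (leaf p q y u.2) = (1 : ℝ) := by
    rw [hA, real_inner_smul_left, real_inner_smul_right, inner_profileTangent_self, hlen]
    generalize √(p * q : ℝ) = R at hs2 hns
    rw [← hs2]
    field_simp
    exact hm.sq
  have hb (u : ℝ × ℝ) : inner ℝ (angularTangent p q (u.1 • y) u.2)
      (angularTangent p q (u.1 • y) u.2) = u.1 ^ 2 * (p * q) := by
    rw [inner_angularTangent_self, sqLen_smul, hlen]
  have hmem : ∀ᵐ u ∂(volume.restrict (Set.Ioi (0 : ℝ) ×ˢ Set.Ioo (0 : ℝ) (2 * Real.pi))),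
      0 < u.1 := by
    filter_upwards [ae_restrict_mem (measurableSet_Ioi.prod measurableSet_Ioo)] with u hu
    exact hu.1
  rw [coneMeasure, sweep]
  have hdens : (fun u => ENNReal.ofReal (areaDensity (coneParam (leaf p q y)) u)) =ᵐ[
      volume.restrict (Set.Ioi (0 : ℝ) ×ˢ Set.Ioo (0 : ℝ) (2 * Real.pi))]
      fun u => ENNReal.ofReal (√(p * q : ℝ) * u.1) := by
    filter_upwards [hmem] with u hu
    rw [areaDensity_of_orthogonal (h0 u) (h1 u) (hAB u) (ha u) (hb u), one_mul,
      Real.sqrt_mul (sq_nonneg _), Real.sqrt_sq hu.le, mul_comm]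
  rw [withDensity_congr_ae hdens]
  refine Measure.map_congr ((withDensity_absolutelyContinuous _ _).ae_le ?_)
  filter_upwards [hmem] with u hu
  refine Prod.ext (hparam u) ?_
  have hu0 : u.1 ^ 2 * (p * q : ℝ) ≠ 0 := by positivity
  change tangentProj _ _ = planeProj p q (u.1 • y) u.2
  rw [tangentProj_of_orthogonal (h0 u) (h1 u) (hAB u) (ha u) (hb u) one_ne_zero hu0,
    planeProj, sqLen_smul, hlen]
  ext1 v
  rw [pairProj_apply, pairProj_apply]
  congr 1
  rw [hA, profileTangent_smul, real_inner_smul_left, real_inner_smul_left, smul_smul, smul_smul]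
  congr 1
  generalize √(p * q : ℝ) = R at hs2 hns
  rw [← hs2]
  field_simp
  rw [hm.sq, one_mul]

lemma sweep_arm_zero (hp : 0 < p) (hq : 0 < q) (s₁ s₂ : ℝ) :
    sweep p q (Set.Ioi √|0|) (arm 0 s₁ s₂) (armDensity p q 0) =
      sweep p q (Set.Ioi 0) (fun r => r • (s₁ * coneCoord p q, s₂ * coneCoord p q))
        (fun r => √(p * q : ℝ) * r) := by
  have hκ := coneCoord_pos hp hq
  have hκ2 := coneCoord_sq p q
  -- At $\tau=0$ the arm is $(r/2)(s_1,s_2)$; the factor $2\,$`coneCoord` makes the new parameter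
  -- the distance to the origin.
  have himg : Set.Ioi √|(0 : ℝ)| = (fun r => (2 * coneCoord p q) * r) '' Set.Ioi 0 := by
    rw [Set.image_mul_left_Ioi (by positivity)]; simp
  have hm1 : Measurable fun r : ℝ => (2 * coneCoord p q) * r := by fun_prop
  rw [himg, sweep_image measurableSet_Ioi (φ' := fun _ => 2 * coneCoord p q) hm1
    measurable_const (fun r _ => by simpa using (hasDerivAt_id r).const_mul (2 * coneCoord p q))
    (fun a _ b _ hab => mul_left_cancel₀ (by positivity) hab) (measurable_arm _ _ _)
    (measurable_armDensity _ _ _)]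
  refine sweep_congr measurableSet_Ioi ((measurable_arm _ _ _).comp hm1)
    (measurable_const.mul ((measurable_armDensity _ _ _).comp hm1)) (by fun_prop) (by fun_prop)
    (fun r _ => ?_) fun r hr => ?_
  · ext <;> simp [arm] <;> ring
  · have hr' : (0 : ℝ) < r := hr
    have hs2 : √(p * q : ℝ) ^ 2 = p * q := Real.sq_sqrt (by positivity)
    have hns : √(p * q : ℝ) ≠ 0 := by positivity
    have hp' : (0 : ℝ) < p := by exact_mod_cast hp
    have hq' : (0 : ℝ) < q := by exact_mod_cast hq
    have h3 : coneCoord p q ^ 2 * (p + q) = √(p * q : ℝ) ^ 2 := by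
      rw [hκ2, hs2]; field_simp
    simp only [armDensity, sqLen, arm, zero_div, add_zero, sub_zero, one_mul]
    rw [abs_of_pos (by positivity)]
    field_simp
    linear_combination h3

/-- The half turn identifies the rays $(s_1,s_2)$ and $((-1)^ps_1,(-1)^qs_2)$. As $p$ and $q$ are
not both even, the four rays form two pairs with equal measures, and the factor $1/2$ leaves one
copy of each. The companion is defined by the parity of $p$ so as to represent the pair that does
not contain $(1,1)$. -/
lemma leafMeasure_zero (hp : 0 < p) (hq : 0 < q) (hpq : Nat.Coprime p q) :
    leafMeasure p q 0 = coneMeasure (curve p q) + coneMeasure (companionCurve p q) := by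
  set S : ℝ → ℝ → Measure (C2 × (C2 →L[ℝ] C2)) := fun s₁ s₂ =>
    sweep p q (Set.Ioi 0) (fun r => r • (s₁ * coneCoord p q, s₂ * coneCoord p q))
        (fun r => √(p * q : ℝ) * r) with hS
  have hκ2 := coneCoord_sq p q
  have hcone (s₁ s₂ : ℝ) (h1 : IsSign s₁) (h2 : IsSign s₂) :
      coneMeasure (leaf p q (s₁ * coneCoord p q, s₂ * coneCoord p q)) = S s₁ s₂ := by
    have e : s₂ * coneCoord p q = (s₁ * s₂) * (s₁ * coneCoord p q) := by
      linear_combination (-(s₂ * coneCoord p q)) * h1.mul_self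
    simp only [hS]
    rw [e]
    exact coneMeasure_leaf hp hq (by rw [mul_pow, h1.sq, one_mul, hκ2]) (h1.mul h2)
  have hturn (s₁ s₂ : ℝ) : S ((-1) ^ p * s₁) ((-1) ^ q * s₂) = S s₁ s₂ := by
    simp only [hS]
    rw [← sweep_half_turn (y := fun r => r • (s₁ * coneCoord p q, s₂ * coneCoord p q))
      (by fun_prop) (by fun_prop)]
    congr 1
    ext r <;> · simp; ring
  have hL : leafMeasure p q 0 =
      (2⁻¹ : ENNReal) • ((S 1 1 + S (-1) (-1)) + (S 1 (-1) + S (-1) 1)) := by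
    rw [leafMeasure]
    simp only [sweep_arm_zero hp hq, hS]
  have hhalf (μ ν : Measure (C2 × (C2 →L[ℝ] C2))) :
      (2⁻¹ : ENNReal) • ((μ + μ) + (ν + ν)) = μ + ν := by
    rw [← two_smul ENNReal μ, ← two_smul ENNReal ν, ← smul_add, smul_smul,
      ENNReal.inv_mul_cancel (by norm_num) (by norm_num), one_smul]
  have hc1 : coneMeasure (curve p q) = S 1 1 := by
    rw [curve_eq_leaf hp hq, hcone 1 1 isSign_one isSign_one]
  rw [hL, hc1]
  have a := hturn 1 1
  have b := hturn 1 (-1)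
  have c := hturn (-1) 1
  rcases Nat.even_or_odd p with hpe | hpo
  · have hqo : Odd q := by
      rw [← Nat.not_even_iff_odd]
      intro hqe
      have := Nat.dvd_gcd hpe.two_dvd hqe.two_dvd
      rw [hpq] at this
      omega
    have hc2 : coneMeasure (companionCurve p q) = S (-1) 1 := by
      rw [companionCurve_eq_leaf_of_even hp hq hpe, hcone (-1) 1 isSign_neg_one isSign_one]
    rw [hpe.neg_one_pow, hqo.neg_one_pow] at a c
    norm_num at a c
    rw [hc2, a, c, add_add_add_comm, hhalf]
  · have hc2 : coneMeasure (companionCurve p q) = S 1 (-1) := by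
      rw [companionCurve_eq_leaf_of_odd hp hq hpo, hcone 1 (-1) isSign_one isSign_neg_one]
    rcases Nat.even_or_odd q with hqe | hqo
    · rw [hpo.neg_one_pow, hqe.neg_one_pow] at a b
      norm_num at a b
      rw [hc2, a, b, add_comm (S 1 (-1)) (S 1 1), add_add_add_comm, hhalf]
    · rw [hpo.neg_one_pow, hqo.neg_one_pow] at a b
      norm_num at a b
      rw [hc2, a, b, hhalf]

end Cone

/-! ### The area measure of the surface -/

lemma setLIntegral_Ioo_two_mul {f : ℝ → ENNReal} {T : ℝ} (hT : 0 < T)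
    (hf : Function.Periodic f T) (a : ℝ) :
    ∫⁻ x in Set.Ioo 0 (2 * T), f x = 2 * ∫⁻ x in Set.Ioo a (a + T), f x := by
  have h1 := setLIntegral_Ioo_periodic hT hf a 0
  have h2 := setLIntegral_Ioo_periodic hT hf a T
  rw [zero_add] at h1
  rw [setLIntegral_congr Ioo_ae_eq_Ioc, setLIntegral_congr Ioo_ae_eq_Ioc] at h1 h2
  rw [setLIntegral_congr Ioo_ae_eq_Ioc, setLIntegral_congr Ioo_ae_eq_Ioc,
    ← Set.Ioc_union_Ioc_eq_Ioc hT.le (by linarith : T ≤ 2 * T),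
    lintegral_union measurableSet_Ioc (Set.Ioc_disjoint_Ioc_of_le le_rfl), ← h1, two_mul T, ← h2,
    two_mul]

section AreaMeasure

variable {p q : ℕ} {ε : ℝ}

lemma sheetDensity_mul_sign {s : ℝ} (hs : IsSign s) (l : ℝ) :
    sheetDensity p q ε (l * s) = sheetDensity p q ε l := by
  ext v
  rw [sheetDensity, sheetDensity, sqLen_smul, sqLen_smul, mul_pow, hs.sq, mul_one]

/-- The area measure of the sheets in conformal coordinates. -/
def sheetMeasure (p q : ℕ) (ε l : ℝ) : Measure (ℝ × ℝ) :=
  (volume.restrict (Set.univ ×ˢ Set.Ioo (0 : ℝ) (2 * Real.pi))).withDensity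
    fun u => ENNReal.ofReal (sheetDensity p q ε l u.1)

/-- The area measure of the surface dilated by `l`. -/
def surfaceMeasure (p q : ℕ) (ε l : ℝ) : Measure (surfaceSet p q ε) :=
  (2⁻¹ : ENNReal) • ((sheetMeasure p q ε l).map (sheetMap p q ε isSign_one) +
    (sheetMeasure p q ε l).map (sheetMap p q ε isSign_neg_one))

lemma coverMap_deck (hε : IsSign ε) : ∃ d n : ℝ, IsSign d ∧ IsSign n ∧
    ∀ s v θ, coverMap p q ε s (v, θ + Real.pi) = coverMap p q ε (s * d) (n * v, θ) := by
  obtain ⟨d, n, hd, hn, h⟩ := exists_deck p q hε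
  refine ⟨d, n, hd, hn, fun s v θ => Prod.ext ?_ (congrArg Prod.fst (h s v θ))⟩
  change Complex.exp _ = Complex.exp _
  rw [Complex.exp_eq_exp_iff_exists_int]
  exact ⟨1, by push_cast; ring⟩

lemma lintegral_comp_sign_mul {n : ℝ} (hn : IsSign n) (f : ℝ → ENNReal) :
    ∫⁻ v, f (n * v) = ∫⁻ v, f v := by
  rcases hn with rfl | rfl
  · simp
  · simp only [neg_mul, one_mul]
    exact lintegral_neg_eq_self f

variable (hp : 0 < p) (hq : 0 < q) (hε : IsSign ε)

/-- The angular densities of the two sheets have a $\pi$-periodic sum, by the deck transformation.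
Half of its integral over $(0,2\pi)$ is therefore the integral over the strip of the chart, which
has width $\pi$. Over that strip the chart domain meets only one sheet. -/
lemma isAreaMeasure_surfaceMeasure (l : ℝ) :
    IsAreaMeasure (surface hp hq hε) (fun x => l • immersion hp hq hε x)
      (surfaceMeasure p q ε l) := by
  intro x A hA hAx
  obtain ⟨s, hs, θ₀, hchart⟩ := exists_chartAt_eq hp hq hε x
  have hdens : areaDensity (localRep (surface hp hq hε) (fun x => l • immersion hp hq hε x) x) =
      fun u => sheetDensity p q ε l u.1 := by
    have : localRep (surface hp hq hε) (fun x => l • immersion hp hq hε x) x =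
        surf p q ε (l * s) := by
      ext1 u
      rw [localRep, hchart, surf_mul]
      rfl
    ext1 u
    rw [this, areaDensity_surf hp hq, ← sheetDensity_mul_sign hs l, sheetDensity]
  rw [hchart] at hAx
  simp only [hdens, hchart]
  change Set (surfaceSet p q ε) at A
  -- Membership is tested in the ambient space, so that the sheet index can be an arbitrary real
  -- number and no proof that it is a sign has to be carried along.
  set B : Set (ℂ × C2) := Subtype.val '' A with hB
  have hBA {s : ℝ} (hs : IsSign s) (u : ℝ × ℝ) :
      coverMap p q ε s u ∈ B ↔ sheetMap p q ε hs u ∈ A :=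
    Subtype.val_injective.mem_set_image (a := sheetMap p q ε hs u)
  have hBm {s : ℝ} (hs : IsSign s) : MeasurableSet (coverMap p q ε s ⁻¹' B) := by
    have : coverMap p q ε s ⁻¹' B = sheetMap p q ε hs ⁻¹' A := by
      ext u; exact hBA hs u
    rw [this]
    exact (continuous_sheetMap hs).measurable hA
  have hw := (continuous_sheetDensity p q ε l).measurable
  set g : ℝ → ℝ → ENNReal := fun s θ => ∫⁻ v, ENNReal.ofReal (sheetDensity p q ε l v) *
    (coverMap p q ε s ⁻¹' B).indicator 1 (v, θ) with hg
  have hgm {s : ℝ} (hs : IsSign s) : Measurable (g s) := by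
    have : Measurable fun u : ℝ × ℝ => ENNReal.ofReal (sheetDensity p q ε l u.1) *
        (coverMap p q ε s ⁻¹' B).indicator 1 u :=
      (hw.comp measurable_fst).ennreal_ofReal.mul (measurable_one.indicator (hBm hs))
    exact this.lintegral_prod_left' (μ := volume)
  have hstrip {s : ℝ} (hs : IsSign s) (I : Set ℝ) :
      ((volume.restrict (Set.univ ×ˢ I)).withDensity
        fun u => ENNReal.ofReal (sheetDensity p q ε l u.1)) (coverMap p q ε s ⁻¹' B) =
        ∫⁻ θ in I, g s θ := by
    rw [← lintegral_indicator_one (hBm hs), lintegral_withDensity_strip hw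
      (measurable_one.indicator (hBm hs)), Measure.restrict_univ]
  have hmap {s : ℝ} (hs : IsSign s) : (sheetMeasure p q ε l).map (sheetMap p q ε hs) A =
      ∫⁻ θ in Set.Ioo 0 (2 * Real.pi), g s θ := by
    rw [Measure.map_apply (continuous_sheetMap hs).measurable hA, sheetMeasure, ← hstrip hs]
    congr 1
    ext u; exact (hBA hs u).symm
  obtain ⟨d, n, hd, hn, hdeck⟩ := coverMap_deck (p := p) (q := q) hε
  -- The map $v\mapsto nv$ with $n=\pm1$ preserves both Lebesgue measure and the area density.
  have hgpi (s θ : ℝ) : g s (θ + Real.pi) = g (s * d) θ := by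
    simp only [hg]
    rw [← lintegral_comp_sign_mul hn (fun v => ENNReal.ofReal (sheetDensity p q ε l v) *
      (coverMap p q ε (s * d) ⁻¹' B).indicator 1 (v, θ))]
    refine lintegral_congr fun v => ?_
    have h1 : sheetDensity p q ε l (n * v) = sheetDensity p q ε l v := by
      rcases hn with rfl | rfl
      · rw [one_mul]
      · rw [neg_one_mul, sheetDensity_neg_arg hε]
    rw [h1]
    congr 1
    have hmem : ((v, θ + Real.pi) : ℝ × ℝ) ∈ coverMap p q ε s ⁻¹' B ↔
        ((n * v, θ) : ℝ × ℝ) ∈ coverMap p q ε (s * d) ⁻¹' B := by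
      rw [Set.mem_preimage, hdeck]; rfl
    by_cases h : ((n * v, θ) : ℝ × ℝ) ∈ coverMap p q ε (s * d) ⁻¹' B
    · rw [Set.indicator_of_mem (hmem.2 h), Set.indicator_of_mem h]; rfl
    · rw [Set.indicator_of_notMem (fun h' => h (hmem.1 h')), Set.indicator_of_notMem h]
  have hper : Function.Periodic (fun θ => g 1 θ + g (-1) θ) Real.pi := fun θ => by
    simp only [hgpi]
    rcases hd with rfl | rfl
    · simp
    · simp [add_comm]
  have hσ : surfaceMeasure p q ε l A =
      ∫⁻ θ in Set.Ioo (θ₀ - Real.pi / 2) (θ₀ - Real.pi / 2 + Real.pi), (g 1 θ + g (-1) θ) := by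
    rw [surfaceMeasure, Measure.smul_apply, Measure.add_apply, hmap, hmap,
      ← lintegral_add_left (hgm isSign_one), setLIntegral_Ioo_two_mul Real.pi_pos hper
        (θ₀ - Real.pi / 2), smul_eq_mul, ← mul_assoc,
      ENNReal.inv_mul_cancel (by norm_num) (by norm_num), one_mul]
  have hI : θ₀ - Real.pi / 2 + Real.pi = θ₀ + Real.pi / 2 := by ring
  have hzero {s' : ℝ} (hs' : IsSign s') (hss : s' ≠ s) :
      ∀ θ ∈ Set.Ioo (θ₀ - Real.pi / 2) (θ₀ + Real.pi / 2), g s' θ = 0 := by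
    intro θ hθ
    simp only [hg]
    rw [lintegral_eq_zero_of_ae_eq_zero]
    refine Eventually.of_forall fun v => ?_
    have hnot : ((v, θ) : ℝ × ℝ) ∉ coverMap p q ε s' ⁻¹' B := fun hmem => by
      have h2 := hAx ((hBA hs' (v, θ)).1 hmem)
      exact hss ((coverMap_mem_chartDom_iff hp hq hs hs' (θ₀ := θ₀) ⟨trivial, hθ⟩).1 h2)
    simp [hnot]
  have hsum : ∀ θ ∈ Set.Ioo (θ₀ - Real.pi / 2) (θ₀ + Real.pi / 2),
      g 1 θ + g (-1) θ = g s θ := by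
    intro θ hθ
    rcases hs with rfl | rfl
    · rw [hzero isSign_neg_one (by norm_num) θ hθ, add_zero]
    · rw [hzero isSign_one (by norm_num) θ hθ, zero_add]
  refine hσ.trans ?_
  rw [hI, setLIntegral_congr_fun measurableSet_Ioo hsum, ← hstrip hs,
    withDensity_apply _ (hBm hs), Measure.restrict_restrict (hBm hs), Set.inter_comm]
  congr 2
  ext u
  exact and_congr Iff.rfl (hBA hs u)

include hp hq in
lemma leaf_injective {y y' : ℝ × ℝ} {θ : ℝ} (h : leaf p q y θ = leaf p q y' θ) : y = y' := by
  have hP0 : √(p : ℝ) ≠ 0 := by positivity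
  have hQ0 : √(q : ℝ) ≠ 0 := by positivity
  obtain ⟨h1, h2⟩ := frame_injective h
  have h2' := mul_left_cancel₀ Complex.I_ne_zero h2
  rw [Complex.ofReal_inj] at h1 h2'
  exact Prod.ext (by field_simp at h1; exact h1) (by field_simp at h2'; exact h2')

/-- The push-forward of the area measure is computed sheet by sheet. The tangent plane is defined
through the preferred chart, so it has to be shown independent of the representing parameters;
continuity of the plane along the surface then gives measurability. -/
lemma isVarifoldOf_surface {l : ℝ} (hl : 0 < l) {V : Varifold}
    (hV : V.toMeasure = leafMeasure p q (l ^ 2 * ε)) :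
    IsVarifoldOf (surface hp hq hε) (fun x => l • immersion hp hq hε x) V := by
  refine ⟨surfaceMeasure p q ε l, isAreaMeasure_surfaceMeasure hp hq hε l, ?_⟩
  set T : surfaceSet p q ε → C2 × (C2 →L[ℝ] C2) := fun x =>
    (l • immersion hp hq hε x,
      tangentProj (localRep (surface hp hq hε) (fun x => l • immersion hp hq hε x) x)
        (coord (surface hp hq hε) x)) with hT
  have hcomp {s : ℝ} (hs : IsSign s) (u : ℝ × ℝ) :
      T (sheetMap p q ε hs u) = leafPlane p q ((l * s) • hyper ε u.1) u.2 := by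
    obtain ⟨s', hs', hrep, hx⟩ := exists_localRep_eq hp hq hε l (sheetMap p q ε hs u)
    refine Prod.ext (surf_mul l s u).symm ?_
    simp only [hT, hrep]
    rw [tangentProj_surf hp hq hε.ne_zero (mul_ne_zero hl.ne' hs'.ne_zero)]
    generalize coord (surface hp hq hε) (sheetMap p q ε hs u) = c at hx
    change coverMap p q ε s u = coverMap p q ε s' c at hx
    change _ = planeProj p q _ _
    -- The representative is moved to the angle of the preferred chart. At a fixed angle a leaf
    -- point determines $y$, so the two planes coincide.
    obtain ⟨s₁, v₁, hs₁, h1⟩ :=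
      exists_leafPlane_eq_of_exp_eq p q hε (congrArg Prod.fst hx) hs u.1
    have h2 : leaf p q (s₁ • hyper ε v₁) c.2 = leaf p q (s' • hyper ε c.1) c.2 :=
      (congrArg Prod.fst h1).symm.trans (congrArg Prod.snd hx)
    rw [leaf_injective hp hq h2] at h1
    rw [mul_smul, mul_smul, planeProj_smul p q hl.ne', planeProj_smul p q hl.ne']
    exact (congrArg Prod.snd h1).symm
  have hTm : Measurable T := by
    refine Continuous.measurable (continuous_iff_continuousAt.2 fun x => ?_)
    obtain ⟨s, hs, u, rfl⟩ := exists_sheetMap_eq x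
    have hu : u ∈ (surfaceChart hp hq hε hs u.2).target :=
      ⟨trivial, by linarith [Real.pi_pos], by linarith [Real.pi_pos]⟩
    have he : surfaceChart hp hq hε hs u.2 (sheetMap p q ε hs u) = u :=
      (surfaceChart hp hq hε hs u.2).right_inv hu
    refine ((surfaceChart hp hq hε hs u.2).symm.continuousAt_iff_continuousAt_comp_right
      ((surfaceChart hp hq hε hs u.2).map_target hu)).2 ?_
    have : T ∘ (surfaceChart hp hq hε hs u.2).symm =
        fun u => leafPlane p q ((l * s) • hyper ε u.1) u.2 := by
      ext1 u; exact hcomp hs u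
    change ContinuousAt (T ∘ (surfaceChart hp hq hε hs u.2).symm)
      (surfaceChart hp hq hε hs u.2 (sheetMap p q ε hs u))
    rw [he, this]
    have hc : Continuous fun u : ℝ × ℝ => ((l * s) • hyper ε u.1, u.2) :=
      (((continuous_hyper ε).comp continuous_fst).const_smul (l * s)).prodMk continuous_snd
    refine ContinuousAt.prodMk ((continuous_leaf p q).comp hc).continuousAt ?_
    exact ContinuousAt.comp (f := fun u : ℝ × ℝ => ((l * s) • hyper ε u.1, u.2))
      (continuousAt_planeProj hp hq (smul_hyper_ne_zero hε.ne_zero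
        (mul_ne_zero hl.ne' hs.ne_zero) u.1)) hc.continuousAt
  rw [hV, leafMeasure_eq_sheets hε hl]
  change _ = (surfaceMeasure p q ε l).map T
  rw [surfaceMeasure, Measure.map_smul, Measure.map_add _ _ hTm,
    Measure.map_map hTm (continuous_sheetMap _).measurable,
    Measure.map_map hTm (continuous_sheetMap _).measurable]
  have h1 : T ∘ sheetMap p q ε isSign_one = fun u => leafPlane p q (l • hyper ε u.1) u.2 := by
    ext1 u; rw [Function.comp_apply, hcomp, mul_one]
  have h2 : T ∘ sheetMap p q ε isSign_neg_one =
      fun u => leafPlane p q ((-l) • hyper ε u.1) u.2 := by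
    ext1 u; rw [Function.comp_apply, hcomp, mul_neg_one]
  rw [h1, h2]
  rfl

end AreaMeasure

/-! ### Integrals over swept measures -/

section SweepIntegral

variable {p q : ℕ} {A : Set ℝ} {y : ℝ → ℝ × ℝ} {w : ℝ → ℝ} {E : Type*} [NormedAddCommGroup E]
  [NormedSpace ℝ E] {G : C2 × (C2 →L[ℝ] C2) → E}

lemma integrable_sweep_iff (hA : MeasurableSet A) (hy : Measurable y) (hw : Measurable w)
    (hw0 : ∀ r ∈ A, 0 ≤ w r) (hG : StronglyMeasurable G) :
    Integrable G (sweep p q A y w) ↔ IntegrableOn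
      (fun u : ℝ × ℝ => w u.1 • G (leafPlane p q (y u.1) u.2))
      (A ×ˢ Set.Ioo (0 : ℝ) (2 * Real.pi)) := by
  have hw' : Measurable fun u : ℝ × ℝ => ENNReal.ofReal (w u.1) :=
    (hw.comp measurable_fst).ennreal_ofReal
  rw [sweep, integrable_map_measure hG.aestronglyMeasurable
    (measurable_leafPlane_comp hy).aemeasurable, integrable_withDensity_iff_integrable_smul'
    hw' (Eventually.of_forall fun _ => ENNReal.ofReal_lt_top)]
  refine integrable_congr ?_
  filter_upwards [ae_restrict_mem (hA.prod measurableSet_Ioo)] with u hu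
  rw [ENNReal.toReal_ofReal (hw0 _ hu.1)]
  rfl

lemma integral_sweep (hA : MeasurableSet A) (hy : Measurable y) (hw : Measurable w)
    (hw0 : ∀ r ∈ A, 0 ≤ w r) (hG : StronglyMeasurable G) :
    ∫ z, G z ∂sweep p q A y w = ∫ u in A ×ˢ Set.Ioo (0 : ℝ) (2 * Real.pi),
      w u.1 • G (leafPlane p q (y u.1) u.2) := by
  have hw' : Measurable fun u : ℝ × ℝ => ENNReal.ofReal (w u.1) :=
    (hw.comp measurable_fst).ennreal_ofReal
  rw [sweep, integral_map (measurable_leafPlane_comp hy).aemeasurable hG.aestronglyMeasurable,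
    integral_withDensity_eq_integral_toReal_smul hw'
      (Eventually.of_forall fun _ => ENNReal.ofReal_lt_top)]
  refine setIntegral_congr_fun (hA.prod measurableSet_Ioo) fun u hu => ?_
  simp only [ENNReal.toReal_ofReal (hw0 _ hu.1)]

end SweepIntegral

/-! ### Bounds along the leaves -/

section Bounds

variable {p q : ℕ} (hp : 0 < p) (hq : 0 < q)

lemma armDensity_nonneg {τ r : ℝ} (hr : 0 ≤ r) : 0 ≤ armDensity p q τ r := by
  have := sqLen_nonneg p q (arm τ 1 1 r)
  unfold armDensity; positivity

lemma arm_sq_add_sq {τ s₁ s₂ r : ℝ} (h₁ : IsSign s₁) (h₂ : IsSign s₂) :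
    (arm τ s₁ s₂ r).1 ^ 2 + (arm τ s₁ s₂ r).2 ^ 2 = (r ^ 2 + (τ / r) ^ 2) / 2 := by
  simp only [arm, mul_pow, h₁.sq, h₂.sq]; ring

lemma sq_div_le {τ r : ℝ} (hr : √|τ| < r) : (τ / r) ^ 2 ≤ r ^ 2 := by
  have hr0 : 0 < r := (Real.sqrt_nonneg _).trans_lt hr
  have h1 : |τ| < r ^ 2 := (Real.sqrt_lt' hr0).1 hr
  rw [div_pow, div_le_iff₀ (by positivity), ← sq_abs]
  nlinarith [abs_nonneg τ]

lemma pos_of_sqrt_lt {τ r : ℝ} (hr : √|τ| < r) : 0 < r := (Real.sqrt_nonneg _).trans_lt hr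

lemma arm_ne_zero {τ s₁ s₂ r : ℝ} (h₁ : IsSign s₁) (h₂ : IsSign s₂) (hr : √|τ| < r) :
    arm τ s₁ s₂ r ≠ 0 := by
  intro h
  have h0 := pos_of_sqrt_lt hr
  have := arm_sq_add_sq (τ := τ) (r := r) h₁ h₂
  rw [h] at this
  simp at this
  nlinarith [sq_nonneg (τ / r), sq_pos_of_pos h0]

include hp hq in
-- The parameter $r$ is at most a constant times the distance to the origin, with a constant
-- independent of $\tau$. With `armDensity_le` this gives dominations that are uniform in $\tau$.
lemma le_norm_leaf_arm {τ s₁ s₂ r : ℝ} (h₁ : IsSign s₁) (h₂ : IsSign s₂) (hr : √|τ| < r)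
    (θ : ℝ) : r ≤ √(2 * (p + q)) * ‖leaf p q (arm τ s₁ s₂ r) θ‖ := by
  have h0 := pos_of_sqrt_lt hr
  have h1 := sq_add_sq_le_norm_leaf hp hq (arm τ s₁ s₂ r) θ
  rw [arm_sq_add_sq h₁ h₂] at h1
  refine le_of_sq_le_sq ?_ (by positivity)
  rw [mul_pow, Real.sq_sqrt (by positivity)]
  nlinarith [sq_nonneg (τ / r)]

include hp hq in
lemma armDensity_le {τ r : ℝ} (hr : √|τ| < r) : armDensity p q τ r ≤ (p + q) * r := by
  have h0 := pos_of_sqrt_lt hr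
  have hp1 : (1 : ℝ) ≤ p := by exact_mod_cast hp
  have hq1 : (1 : ℝ) ≤ q := by exact_mod_cast hq
  have h1 := arm_sq_add_sq (τ := τ) (r := r) isSign_one isSign_one
  have h2 := sq_div_le hr
  have h3 : sqLen p q (arm τ 1 1 r) ≤ (p + q) * r ^ 2 := by
    have h4 : sqLen p q (arm τ 1 1 r) ≤
        (p + q) * ((arm τ 1 1 r).1 ^ 2 + (arm τ 1 1 r).2 ^ 2) := by
      rw [sqLen]
      have a1 := mul_nonneg (Nat.cast_nonneg (α := ℝ) q) (sq_nonneg (arm τ 1 1 r).1)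
      have a2 := mul_nonneg (Nat.cast_nonneg (α := ℝ) p) (sq_nonneg (arm τ 1 1 r).2)
      linarith
    refine h4.trans (mul_le_mul_of_nonneg_left ?_ (by positivity))
    rw [h1]; linarith
  have h5 : (√(p * q : ℝ))⁻¹ ≤ 1 := inv_le_one_of_one_le₀ (Real.one_le_sqrt.2 (by nlinarith))
  rw [armDensity, div_le_iff₀ h0]
  have := mul_le_mul h5 h3 (sqLen_nonneg _ _ _) zero_le_one
  linarith

end Bounds

/-! ### Functions with a mild singularity at the origin -/

/-- `G` vanishes for large `z`, and is at most `C / ‖z‖`. -/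
structure MildlySingular (p q : ℕ) {E : Type*} [NormedAddCommGroup E]
    (G : C2 × (C2 →L[ℝ] C2) → E) : Prop where
  stronglyMeasurable : StronglyMeasurable G
  bound : ∃ C R : ℝ, 0 ≤ C ∧ ∀ y θ, y ≠ 0 → ‖leaf p q y θ‖ * ‖G (leafPlane p q y θ)‖ ≤ C ∧
    (R < ‖leaf p q y θ‖ → G (leafPlane p q y θ) = 0)

section MildlySingular

variable {p q : ℕ} {E : Type*} [NormedAddCommGroup E]
  [NormedSpace ℝ E] {G : C2 × (C2 →L[ℝ] C2) → E}

/-- The area density is $O(r)$ and $r$ is at most a multiple of $|z|$, which cancels the singularity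
$1/|z|$. The bound is the same for all $\tau$ and is integrable. -/
lemma MildlySingular.exists_bound (hp : 0 < p) (hq : 0 < q) (hG : MildlySingular p q G) :
    ∃ K R : ℝ, 0 ≤ K ∧ ∀ τ s₁ s₂ r θ, IsSign s₁ → IsSign s₂ → √|τ| < r →
      ‖armDensity p q τ r • G (leafPlane p q (arm τ s₁ s₂ r) θ)‖ ≤
        (Set.Ioc 0 R).indicator (fun _ => K) r := by
  obtain ⟨C, R, hC, h⟩ := hG.bound
  refine ⟨(p + q) * √(2 * (p + q)) * C, √(2 * (p + q)) * R, by positivity, ?_⟩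
  intro τ s₁ s₂ r θ h₁ h₂ hr
  have h0 := pos_of_sqrt_lt hr
  obtain ⟨h3, h4⟩ := h (arm τ s₁ s₂ r) θ (arm_ne_zero h₁ h₂ hr)
  have h5 := le_norm_leaf_arm hp hq h₁ h₂ hr θ
  have hpos : 0 < √(2 * (p + q) : ℝ) := by positivity
  by_cases hR : r ≤ √(2 * (p + q)) * R
  · rw [Set.indicator_of_mem (show r ∈ Set.Ioc _ _ from ⟨h0, hR⟩), norm_smul,
      Real.norm_of_nonneg (armDensity_nonneg h0.le)]
    have h6 := armDensity_le hp hq hr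
    calc armDensity p q τ r * ‖G (leafPlane p q (arm τ s₁ s₂ r) θ)‖
        ≤ (p + q) * (√(2 * (p + q)) * ‖leaf p q (arm τ s₁ s₂ r) θ‖) *
          ‖G (leafPlane p q (arm τ s₁ s₂ r) θ)‖ :=
          mul_le_mul_of_nonneg_right (h6.trans (mul_le_mul_of_nonneg_left h5 (by positivity)))
            (norm_nonneg _)
      _ = (p + q) * √(2 * (p + q)) *
          (‖leaf p q (arm τ s₁ s₂ r) θ‖ * ‖G (leafPlane p q (arm τ s₁ s₂ r) θ)‖) := by ring
      _ ≤ _ := mul_le_mul_of_nonneg_left h3 (by positivity)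
  · rw [Set.indicator_of_notMem (fun h => hR h.2), h4, smul_zero, norm_zero]
    rw [not_le] at hR
    exact lt_of_mul_lt_mul_left (hR.trans_le h5) hpos.le

lemma integrableOn_indicator_Ioc (K R : ℝ) :
    IntegrableOn (fun u : ℝ × ℝ => (Set.Ioc 0 R).indicator (fun _ => K) u.1)
      (Set.Ioi 0 ×ˢ Set.Ioo (0 : ℝ) (2 * Real.pi)) := by
  have h1 : IntegrableOn ((Set.Ioc 0 R).indicator (fun _ => K)) (Set.Ioi 0) := by
    refine Integrable.integrableOn ?_
    rw [integrable_indicator_iff measurableSet_Ioc]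
    exact integrableOn_const (by simp)
  have h2 : IntegrableOn (fun _ : ℝ => (1 : ℝ)) (Set.Ioo (0 : ℝ) (2 * Real.pi)) :=
    integrableOn_const measure_Ioo_lt_top.ne
  have := Integrable.mul_prod h1 h2
  rw [Measure.prod_restrict, ← Measure.volume_eq_prod] at this
  simpa [IntegrableOn] using this

lemma stronglyMeasurable_arm (hG : StronglyMeasurable G) (τ s₁ s₂ : ℝ) :
    StronglyMeasurable fun u : ℝ × ℝ =>
      armDensity p q τ u.1 • G (leafPlane p q (arm τ s₁ s₂ u.1) u.2) :=
  ((measurable_armDensity p q τ).comp measurable_fst).stronglyMeasurable.smul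
    (hG.comp_measurable (measurable_leafPlane_comp (measurable_arm τ s₁ s₂)))

lemma MildlySingular.integrableOn_arm (hp : 0 < p) (hq : 0 < q) (hG : MildlySingular p q G)
    (τ : ℝ) {s₁ s₂ : ℝ} (h₁ : IsSign s₁) (h₂ : IsSign s₂) :
    IntegrableOn (fun u : ℝ × ℝ => armDensity p q τ u.1 • G (leafPlane p q (arm τ s₁ s₂ u.1) u.2))
      (Set.Ioi √|τ| ×ˢ Set.Ioo (0 : ℝ) (2 * Real.pi)) := by
  obtain ⟨K, R, hK, h⟩ := hG.exists_bound hp hq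
  have hsub : Set.Ioi √|τ| ×ˢ Set.Ioo (0 : ℝ) (2 * Real.pi) ⊆
      Set.Ioi 0 ×ˢ Set.Ioo (0 : ℝ) (2 * Real.pi) :=
    Set.prod_mono (Set.Ioi_subset_Ioi (Real.sqrt_nonneg _)) subset_rfl
  refine Integrable.mono' ((integrableOn_indicator_Ioc K R).mono_set hsub)
    (stronglyMeasurable_arm hG.stronglyMeasurable τ s₁ s₂).aestronglyMeasurable ?_
  filter_upwards [ae_restrict_mem (measurableSet_Ioi.prod measurableSet_Ioo)] with u hu
  exact h τ s₁ s₂ u.1 u.2 h₁ h₂ hu.1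

lemma armDensity_nonneg_of_mem {τ : ℝ} : ∀ r ∈ Set.Ioi √|τ|, 0 ≤ armDensity p q τ r :=
  fun _ hr => armDensity_nonneg (pos_of_sqrt_lt hr).le

lemma MildlySingular.integrable_sweep (hp : 0 < p) (hq : 0 < q) (hG : MildlySingular p q G)
    (τ : ℝ) {s₁ s₂ : ℝ} (h₁ : IsSign s₁) (h₂ : IsSign s₂) :
    Integrable G (sweep p q (Set.Ioi √|τ|) (arm τ s₁ s₂) (armDensity p q τ)) := by
  rw [integrable_sweep_iff measurableSet_Ioi (measurable_arm _ _ _) (measurable_armDensity _ _ _)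
    armDensity_nonneg_of_mem hG.stronglyMeasurable]
  exact hG.integrableOn_arm hp hq τ h₁ h₂

lemma MildlySingular.integrable (hp : 0 < p) (hq : 0 < q) (hG : MildlySingular p q G) (τ : ℝ) :
    Integrable G (leafMeasure p q τ) :=
  (((hG.integrable_sweep hp hq τ isSign_one isSign_one).add_measure
    (hG.integrable_sweep hp hq τ isSign_neg_one isSign_neg_one)).add_measure
    ((hG.integrable_sweep hp hq τ isSign_one isSign_neg_one).add_measure
    (hG.integrable_sweep hp hq τ isSign_neg_one isSign_one))).smul_measure (by norm_num)

lemma MildlySingular.integral_leafMeasure (hp : 0 < p) (hq : 0 < q) (hG : MildlySingular p q G)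
    (τ : ℝ) : ∫ z, G z ∂leafMeasure p q τ = (2⁻¹ : ℝ) •
      ((∫ z, G z ∂sweep p q (Set.Ioi √|τ|) (arm τ 1 1) (armDensity p q τ) +
        ∫ z, G z ∂sweep p q (Set.Ioi √|τ|) (arm τ (-1) (-1)) (armDensity p q τ)) +
      (∫ z, G z ∂sweep p q (Set.Ioi √|τ|) (arm τ 1 (-1)) (armDensity p q τ) +
        ∫ z, G z ∂sweep p q (Set.Ioi √|τ|) (arm τ (-1) 1) (armDensity p q τ))) := by
  have h1 := hG.integrable_sweep hp hq τ isSign_one isSign_one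
  have h2 := hG.integrable_sweep hp hq τ isSign_neg_one isSign_neg_one
  have h3 := hG.integrable_sweep hp hq τ isSign_one isSign_neg_one
  have h4 := hG.integrable_sweep hp hq τ isSign_neg_one isSign_one
  rw [leafMeasure, integral_smul_measure, integral_add_measure (h1.add_measure h2)
    (h3.add_measure h4), integral_add_measure h1 h2, integral_add_measure h3 h4]
  simp

lemma tendsto_arm {s₁ s₂ r : ℝ} :
    Tendsto (fun τ => arm τ s₁ s₂ r) (𝓝 0) (𝓝 (arm 0 s₁ s₂ r)) := by
  have : Continuous fun τ => arm τ s₁ s₂ r := by unfold arm; fun_prop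
  exact this.tendsto 0

lemma tendsto_armDensity {r : ℝ} :
    Tendsto (fun τ => armDensity p q τ r) (𝓝 0) (𝓝 (armDensity p q 0 r)) := by
  have : Continuous fun τ => armDensity p q τ r := by unfold armDensity arm sqLen; fun_prop
  exact this.tendsto 0

lemma leaf_ne_zero (hp : 0 < p) (hq : 0 < q) {y : ℝ × ℝ} (hy : y ≠ 0) (θ : ℝ) :
    leaf p q y θ ≠ 0 := by
  intro h
  have h1 := sq_add_sq_le_norm_leaf hp hq y θ
  rw [h, norm_zero] at h1
  have h2 : y.1 ^ 2 + y.2 ^ 2 = 0 := le_antisymm (by simpa using h1) (by positivity)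
  apply hy
  ext
  · exact pow_eq_zero_iff two_ne_zero |>.1 (by nlinarith [sq_nonneg y.1, sq_nonneg y.2])
  · exact pow_eq_zero_iff two_ne_zero |>.1 (by nlinarith [sq_nonneg y.1, sq_nonneg y.2])

lemma continuousAt_leafPlane (hp : 0 < p) (hq : 0 < q) {y : ℝ × ℝ} (hy : y ≠ 0) (θ : ℝ) :
    ContinuousAt (fun y => leafPlane p q y θ) y := by
  have h : ContinuousAt (fun y : ℝ × ℝ => (y, θ)) y := by fun_prop
  have h1 : ContinuousAt (fun y => leaf p q y θ) y :=
    ContinuousAt.comp (f := fun y : ℝ × ℝ => (y, θ)) (g := fun x : (ℝ × ℝ) × ℝ => leaf p q x.1 x.2)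
      (continuous_leaf p q).continuousAt h
  have h2 : ContinuousAt (fun y => planeProj p q y θ) y :=
    ContinuousAt.comp (f := fun y : ℝ × ℝ => (y, θ))
      (g := fun x : (ℝ × ℝ) × ℝ => planeProj p q x.1 x.2) (continuousAt_planeProj hp hq hy) h
  exact h1.prodMk h2

lemma tendsto_leafPlane (hp : 0 < p) (hq : 0 < q) {α : Type*} {f : α → ℝ × ℝ} {l : Filter α}
    {y : ℝ × ℝ} (hy : y ≠ 0) (hf : Tendsto f l (𝓝 y)) (θ : ℝ) :
    Tendsto (fun τ => leafPlane p q (f τ) θ) l (𝓝 (leafPlane p q y θ)) :=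
  (continuousAt_leafPlane hp hq hy θ).tendsto.comp hf

/-- Dominated convergence. The domains $r>\sqrt{|\tau|}$ vary, so the integrals are written over the
fixed domain $r>0$ with an indicator; for fixed $r$ the indicator is eventually $1$. Continuity at
the origin is not needed, since $r>0$ keeps the limit point away from it. -/
lemma MildlySingular.tendsto_sweep (hp : 0 < p) (hq : 0 < q) (hG : MildlySingular p q G)
    (hc : ∀ z : C2 × (C2 →L[ℝ] C2), z.1 ≠ 0 → ContinuousAt G z)
    {s₁ s₂ : ℝ} (h₁ : IsSign s₁) (h₂ : IsSign s₂) :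
    Tendsto (fun τ => ∫ z, G z ∂sweep p q (Set.Ioi √|τ|) (arm τ s₁ s₂) (armDensity p q τ)) (𝓝 0)
      (𝓝 (∫ z, G z ∂sweep p q (Set.Ioi √|0|) (arm 0 s₁ s₂) (armDensity p q 0))) := by
  obtain ⟨K, R, hK, h⟩ := hG.exists_bound hp hq
  set Ω : Set (ℝ × ℝ) := Set.Ioi 0 ×ˢ Set.Ioo (0 : ℝ) (2 * Real.pi) with hΩ
  set g : ℝ → ℝ × ℝ → E := fun τ u =>
    armDensity p q τ u.1 • G (leafPlane p q (arm τ s₁ s₂ u.1) u.2) with hg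
  have hrep (τ : ℝ) : ∫ z, G z ∂sweep p q (Set.Ioi √|τ|) (arm τ s₁ s₂) (armDensity p q τ) =
      ∫ u in Ω, (Set.Ioi √|τ| ×ˢ Set.univ).indicator (g τ) u := by
    rw [integral_sweep measurableSet_Ioi (measurable_arm _ _ _) (measurable_armDensity _ _ _)
      armDensity_nonneg_of_mem hG.stronglyMeasurable, setIntegral_indicator
      (measurableSet_Ioi.prod MeasurableSet.univ), hΩ, Set.prod_inter_prod, Set.inter_univ,
      Set.inter_eq_right.2 (Set.Ioi_subset_Ioi (Real.sqrt_nonneg _))]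
  simp only [hrep]
  refine tendsto_integral_filter_of_dominated_convergence
    (fun u => (Set.Ioc 0 R).indicator (fun _ => K) u.1) ?_ ?_ (integrableOn_indicator_Ioc K R) ?_
  · exact Eventually.of_forall fun τ => ((stronglyMeasurable_arm hG.stronglyMeasurable τ s₁
      s₂).indicator (measurableSet_Ioi.prod MeasurableSet.univ)).aestronglyMeasurable
  · refine Eventually.of_forall fun τ => Eventually.of_forall fun u => ?_
    by_cases hu : √|τ| < u.1
    · rw [Set.indicator_of_mem (show u ∈ Set.Ioi _ ×ˢ Set.univ from ⟨hu, trivial⟩)]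
      exact h τ s₁ s₂ u.1 u.2 h₁ h₂ hu
    · rw [Set.indicator_of_notMem (fun hu' => hu hu'.1), norm_zero]
      exact Set.indicator_nonneg (fun _ _ => hK) _
  · filter_upwards [ae_restrict_mem (measurableSet_Ioi.prod measurableSet_Ioo)] with u hu
    have hu0 : (0 : ℝ) < u.1 := hu.1
    have hs : Tendsto (fun τ : ℝ => √|τ|) (𝓝 0) (𝓝 0) := by
      have : Continuous fun τ : ℝ => √|τ| := by fun_prop
      simpa using this.tendsto 0
    have h0 : (Set.Ioi √|(0 : ℝ)| ×ˢ Set.univ).indicator (g 0) u = g 0 u :=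
      Set.indicator_of_mem (show u ∈ Set.Ioi _ ×ˢ Set.univ from ⟨by simpa using hu0, trivial⟩) _
    rw [h0]
    have hne : arm 0 s₁ s₂ u.1 ≠ 0 := arm_ne_zero h₁ h₂ (by simpa using hu0)
    have hlim : Tendsto (fun τ => g τ u) (𝓝 0) (𝓝 (g 0 u)) :=
      tendsto_armDensity.smul (Tendsto.comp (hc _ (leaf_ne_zero hp hq hne u.2))
        (tendsto_leafPlane hp hq hne tendsto_arm u.2))
    refine hlim.congr' ?_
    filter_upwards [hs.eventually (gt_mem_nhds hu0)] with τ hτ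
    rw [Set.indicator_of_mem (show u ∈ Set.Ioi _ ×ˢ Set.univ from ⟨hτ, trivial⟩)]

lemma MildlySingular.tendsto_leafMeasure (hp : 0 < p) (hq : 0 < q) (hG : MildlySingular p q G)
    (hc : ∀ z : C2 × (C2 →L[ℝ] C2), z.1 ≠ 0 → ContinuousAt G z) :
    Tendsto (fun τ => ∫ z, G z ∂leafMeasure p q τ) (𝓝 0) (𝓝 (∫ z, G z ∂leafMeasure p q 0)) := by
  simp only [hG.integral_leafMeasure hp hq]
  exact (((hG.tendsto_sweep hp hq hc isSign_one isSign_one).add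
    (hG.tendsto_sweep hp hq hc isSign_neg_one isSign_neg_one)).add
    ((hG.tendsto_sweep hp hq hc isSign_one isSign_neg_one).add
    (hG.tendsto_sweep hp hq hc isSign_neg_one isSign_one))).const_smul _

end MildlySingular

/-! ### The planes of the leaves -/

section Planes

variable {p q : ℕ} (hp : 0 < p) (hq : 0 < q)

/-- The trace on `End(ℝ⁴)` as a continuous linear functional. -/
def traceCLM : (C2 →L[ℝ] C2) →L[ℝ] ℝ :=
  LinearMap.toContinuousLinearMap
    ((LinearMap.trace ℝ C2).comp (ContinuousLinearMap.coeLM ℝ : (C2 →L[ℝ] C2) →ₗ[ℝ] C2 →ₗ[ℝ] C2))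

lemma traceCLM_apply (P : C2 →L[ℝ] C2) :
    traceCLM P = LinearMap.trace ℝ C2 (P : C2 →ₗ[ℝ] C2) := rfl

lemma traceCLM_pairProj_comp (a b : ℝ) (A B : C2) (D : C2 →L[ℝ] C2) :
    traceCLM (pairProj a b A B ∘L D) = a⁻¹ * inner ℝ A (D A) + b⁻¹ * inner ℝ B (D B) := by
  have h (A : C2) : traceCLM ((innerSL ℝ A).smulRight A ∘L D) = inner ℝ A (D A) := by
    rw [traceCLM_apply]
    have : (((innerSL ℝ A).smulRight A ∘L D : C2 →L[ℝ] C2) : C2 →ₗ[ℝ] C2) =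
        LinearMap.smulRight (((innerSL ℝ A) ∘L D : C2 →L[ℝ] ℝ) : C2 →ₗ[ℝ] ℝ) A := by
      ext v; simp
    rw [this, LinearMap.trace_smulRight]; rfl
  rw [pairProj, ContinuousLinearMap.add_comp, ContinuousLinearMap.smul_comp,
    ContinuousLinearMap.smul_comp, map_add, map_smul, map_smul, h, h, smul_eq_mul, smul_eq_mul]

/-- The rank of an idempotent is its trace. Replacing the rank by the trace makes the condition
closed, hence measurable. -/
lemma isPlaneProj_of_trace {P : C2 →L[ℝ] C2} (h1 : P ∘L P = P)
    (h2 : ∀ v w, inner ℝ (P v) w = inner ℝ v (P w)) (h3 : traceCLM P = 2) : IsPlaneProj P := by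
  refine ⟨h1, h2, ?_⟩
  have h4 : IsIdempotentElem (P : C2 →ₗ[ℝ] C2) := by
    ext v : 1
    exact DFunLike.congr_fun h1 v
  have h5 := (LinearMap.IsIdempotentElem.isProj_range _ h4).trace
  rw [← traceCLM_apply, h3] at h5
  exact_mod_cast h5.symm

lemma pairProj_comp_self {a b : ℝ} {A B : C2} (ha : inner ℝ A A = a) (hb : inner ℝ B B = b)
    (hAB : inner ℝ A B = (0 : ℝ)) (ha0 : a ≠ 0) (hb0 : b ≠ 0) :
    pairProj a b A B ∘L pairProj a b A B = pairProj a b A B := by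
  have hBA : inner ℝ B A = (0 : ℝ) := by rw [real_inner_comm]; exact hAB
  ext1 v
  rw [ContinuousLinearMap.comp_apply, pairProj_apply a b A B v, map_add, map_smul, map_smul,
    pairProj_apply, pairProj_apply, ha, hb, hAB, hBA]
  simp [ha0, hb0]

lemma inner_pairProj (a b : ℝ) (A B v w : C2) :
    inner ℝ (pairProj a b A B v) w = inner ℝ v (pairProj a b A B w) := by
  simp only [pairProj_apply, inner_add_left, inner_add_right, real_inner_smul_left,
    real_inner_smul_right, real_inner_comm v]
  ring

include hp hq in
lemma isPlaneProj_planeProj {y : ℝ × ℝ} (hy : y ≠ 0) (θ : ℝ) :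
    planeProj p q y θ ∘L planeProj p q y θ = planeProj p q y θ ∧
    (∀ v w, inner ℝ (planeProj p q y θ v) w = inner ℝ v (planeProj p q y θ w)) ∧
    traceCLM (planeProj p q y θ) = 2 := by
  have hD := (sqLen_pos hp hq hy).ne'
  have h1 := inner_profileTangent_self p q y θ
  have h2 := inner_angularTangent_self p q y θ
  refine ⟨pairProj_comp_self h1 h2 (inner_profileTangent_angularTangent p q y θ) hD hD,
    inner_pairProj _ _ _ _, ?_⟩
  have := traceCLM_pairProj_comp (sqLen p q y) (sqLen p q y) (profileTangent p q y θ)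
    (angularTangent p q y θ) (ContinuousLinearMap.id ℝ C2)
  rw [ContinuousLinearMap.comp_id] at this
  rw [planeProj, this, ContinuousLinearMap.id_apply, ContinuousLinearMap.id_apply, h1, h2,
    inv_mul_cancel₀ hD]
  norm_num

include hp hq in
lemma norm_planeProj_le {y : ℝ × ℝ} (hy : y ≠ 0) (θ : ℝ) : ‖planeProj p q y θ‖ ≤ 2 := by
  have hD := sqLen_pos hp hq hy
  have h (A : C2) (hA : inner ℝ A A = sqLen p q y) :
      ‖(sqLen p q y)⁻¹ • (innerSL ℝ A).smulRight A‖ ≤ 1 := by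
    rw [norm_smul, ContinuousLinearMap.norm_smulRight_apply, innerSL_apply_norm,
      ← real_inner_self_eq_norm_mul_norm, hA, norm_inv, Real.norm_of_nonneg hD.le,
      inv_mul_cancel₀ hD.ne']
  have := norm_add_le_of_le (h _ (inner_profileTangent_self p q y θ))
    (h _ (inner_angularTangent_self p q y θ))
  rw [planeProj, pairProj]
  linarith

lemma isClosed_setOf_idempotent : IsClosed {z : C2 × (C2 →L[ℝ] C2) | z.2 ∘L z.2 = z.2 ∧
    (∀ v w, inner ℝ (z.2 v) w = inner ℝ v (z.2 w)) ∧ traceCLM z.2 = 2} := by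
  have hev (v : C2) : Continuous fun z : C2 × (C2 →L[ℝ] C2) => z.2 v := by fun_prop
  refine (isClosed_eq (by fun_prop) continuous_snd).inter (IsClosed.inter ?_ ?_)
  · have : {z : C2 × (C2 →L[ℝ] C2) | ∀ v w, inner ℝ (z.2 v) w = inner ℝ v (z.2 w)} =
        ⋂ v, ⋂ w, {z | inner ℝ (z.2 v) w = inner ℝ v (z.2 w)} := by ext; simp
    change IsClosed {z : C2 × (C2 →L[ℝ] C2) | ∀ v w, inner ℝ (z.2 v) w = inner ℝ v (z.2 w)}
    rw [this]
    exact isClosed_iInter fun v => isClosed_iInter fun w =>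
      isClosed_eq ((hev v).inner continuous_const) (continuous_const.inner (hev w))
  · exact isClosed_eq (by fun_prop) continuous_const

end Planes

/-! ### Almost everywhere statements -/

section AE

variable {p q : ℕ}

lemma ae_sweep {A : Set ℝ} {y : ℝ → ℝ × ℝ} {w : ℝ → ℝ} (hA : MeasurableSet A) (hy : Measurable y)
    {S : Set (C2 × (C2 →L[ℝ] C2))} (hS : MeasurableSet S)
    (h : ∀ r ∈ A, ∀ θ, leafPlane p q (y r) θ ∈ S) : ∀ᵐ z ∂sweep p q A y w, z ∈ S := by
  refine (ae_map_iff (measurable_leafPlane_comp hy).aemeasurable hS).2 ?_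
  refine (withDensity_absolutelyContinuous _ _).ae_le ?_
  filter_upwards [ae_restrict_mem (hA.prod measurableSet_Ioo)] with u hu
  exact h _ hu.1 _

lemma arm_sq_sub_sq {τ s₁ s₂ r : ℝ} (h₁ : IsSign s₁) (h₂ : IsSign s₂) (hr : 0 < r) :
    (arm τ s₁ s₂ r).1 ^ 2 - (arm τ s₁ s₂ r).2 ^ 2 = τ := by
  simp only [arm, mul_pow, h₁.sq, h₂.sq]
  field_simp; ring

/-- A property of points with their planes needs to be checked only at parameters $y\neq0$ on the
hyperbola. The identities between geometric quantities on a leaf enter the integrals in this way. -/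
lemma ae_leafMeasure {τ : ℝ} {S : Set (C2 × (C2 →L[ℝ] C2))} (hS : MeasurableSet S)
    (h : ∀ y θ, y ≠ 0 → y.1 ^ 2 - y.2 ^ 2 = τ → leafPlane p q y θ ∈ S) :
    ∀ᵐ z ∂leafMeasure p q τ, z ∈ S := by
  have key {s₁ s₂ : ℝ} (h₁ : IsSign s₁) (h₂ : IsSign s₂) :
      ∀ᵐ z ∂sweep p q (Set.Ioi √|τ|) (arm τ s₁ s₂) (armDensity p q τ), z ∈ S :=
    ae_sweep measurableSet_Ioi (measurable_arm _ _ _) hS fun r hr θ =>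
      h _ _ (arm_ne_zero h₁ h₂ hr) (arm_sq_sub_sq h₁ h₂ (pos_of_sqrt_lt hr))
  refine Measure.ae_smul_measure ?_ _
  simp only [ae_add_measure_iff]
  exact ⟨⟨key isSign_one isSign_one, key isSign_neg_one isSign_neg_one⟩,
    key isSign_one isSign_neg_one, key isSign_neg_one isSign_one⟩

end AE

/-! ### Examples of mildly singular functions -/

section Examples

variable {p q : ℕ} (hp : 0 < p) (hq : 0 < q) {E : Type*} [NormedAddCommGroup E]

include hp hq in
-- The planes of the leaves have norm at most $2$, so the bound is required only there; this admits
-- integrands that are unbounded in the plane variable, such as the tangential divergence.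
lemma mildlySingular_of_bound {G : C2 × (C2 →L[ℝ] C2) → E} (hG : StronglyMeasurable G) {C R : ℝ}
    (h1 : ∀ z, ‖z.2‖ ≤ 2 → ‖z.1‖ * ‖G z‖ ≤ C) (h2 : ∀ z, R < ‖z.1‖ → G z = 0) :
    MildlySingular p q G := by
  have h3 (y θ) (hy : y ≠ 0) :
      ‖leaf p q y θ‖ * ‖G (leafPlane p q y θ)‖ ≤ max C 0 := by
    have h4 := h1 (leafPlane p q y θ) (norm_planeProj_le hp hq hy θ)
    rw [leafPlane] at h4 ⊢
    exact le_max_of_le_left h4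
  have h5 (y θ) (hR : R < ‖leaf p q y θ‖) : G (leafPlane p q y θ) = 0 := h2 (leafPlane p q y θ) hR
  exact ⟨hG, max C 0, R, le_max_right _ _, fun y θ hy => ⟨h3 y θ hy, h5 y θ⟩⟩

lemma meanCurvatureField_denom_ge (hp : 0 < p) (hq : 0 < q) (z : C2) :
    ‖z‖ ^ 2 ≤ p ^ 2 * ‖z 0‖ ^ 2 + q ^ 2 * ‖z 1‖ ^ 2 := by
  have hp1 : (1 : ℝ) ≤ p ^ 2 := one_le_pow₀ (by exact_mod_cast hp)
  have hq1 : (1 : ℝ) ≤ q ^ 2 := one_le_pow₀ (by exact_mod_cast hq)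
  rw [EuclideanSpace.norm_sq_eq, Fin.sum_univ_two]
  nlinarith [sq_nonneg ‖z 0‖, sq_nonneg ‖z 1‖]

/-- With $D$ the denominator of the field, the numerator vector has norm $\sqrt D$, while
$|z|\le\sqrt D$. -/
lemma norm_mul_norm_meanCurvatureField_le (hp : 0 < p) (hq : 0 < q) (z : C2) :
    ‖z‖ * ‖meanCurvatureField p q z‖ ≤ |(q : ℝ) - p| := by
  have h1 := meanCurvatureField_denom_ge hp hq z
  set D : ℝ := p ^ 2 * ‖z 0‖ ^ 2 + q ^ 2 * ‖z 1‖ ^ 2 with hD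
  have hD0 : 0 ≤ D := by positivity
  have h2 : ‖(!₂[(p : ℂ) * z 0, -(q : ℂ) * z 1] : C2)‖ = √D := by
    rw [EuclideanSpace.norm_eq, Fin.sum_univ_two, hD]
    simp [mul_pow]
  have h3 : ‖z‖ ≤ √D := Real.le_sqrt_of_sq_le h1
  rw [meanCurvatureField, ← hD, norm_smul, h2, norm_div, Real.norm_eq_abs, Real.norm_of_nonneg hD0]
  rcases hD0.eq_or_lt with h0 | h0
  · simp [← h0]
  calc ‖z‖ * (|(q : ℝ) - p| / D * √D) ≤ √D * (|(q : ℝ) - p| / D * √D) := by gcongr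
    _ = |(q : ℝ) - p| * (√D * √D) / D := by ring
    _ = |(q : ℝ) - p| := by rw [Real.mul_self_sqrt hD0]; field_simp

lemma continuous_meanCurvatureField_num (p q : ℕ) :
    Continuous fun z : C2 => (!₂[(p : ℂ) * z 0, -(q : ℂ) * z 1] : C2) := by
  refine (PiLp.continuous_toLp 2 _).comp (continuous_pi fun i => ?_)
  fin_cases i <;> simp <;> fun_prop

lemma continuous_meanCurvatureField_denom (p q : ℕ) :
    Continuous fun z : C2 => (p ^ 2 * ‖z 0‖ ^ 2 + q ^ 2 * ‖z 1‖ ^ 2 : ℝ) := by fun_prop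

lemma measurable_meanCurvatureField (p q : ℕ) : Measurable (meanCurvatureField p q) := by
  have h1 : Measurable fun z : C2 =>
      ((q : ℝ) - p) / (p ^ 2 * ‖z 0‖ ^ 2 + q ^ 2 * ‖z 1‖ ^ 2 : ℝ) :=
    measurable_const.div (continuous_meanCurvatureField_denom p q).measurable
  exact h1.smul (continuous_meanCurvatureField_num p q).measurable

lemma continuousAt_meanCurvatureField (hp : 0 < p) (hq : 0 < q) {z : C2} (hz : z ≠ 0) :
    ContinuousAt (meanCurvatureField p q) z := by
  have h1 : ContinuousAt (fun z : C2 =>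
      ((q : ℝ) - p) / (p ^ 2 * ‖z 0‖ ^ 2 + q ^ 2 * ‖z 1‖ ^ 2 : ℝ)) z := by
    refine continuousAt_const.div (continuous_meanCurvatureField_denom p q).continuousAt ?_
    have := meanCurvatureField_denom_ge hp hq z
    have : 0 < ‖z‖ ^ 2 := by positivity
    linarith
  exact h1.smul (continuous_meanCurvatureField_num p q).continuousAt

end Examples

/-! ### The varifolds of the leaves -/

section LeafVarifold

variable {p q : ℕ} (hp : 0 < p) (hq : 0 < q) (τ : ℝ)

include hp hq in
lemma mildlySingular_indicator_closedBall (R : ℝ) : MildlySingular p q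
    ((Metric.closedBall (0 : C2) R ×ˢ Set.univ).indicator
      fun _ : C2 × (C2 →L[ℝ] C2) => (1 : ℝ)) := by
  have hS : MeasurableSet (Metric.closedBall (0 : C2) R ×ˢ
      (Set.univ : Set (C2 →L[ℝ] C2))) := Metric.isClosed_closedBall.measurableSet.prod .univ
  refine mildlySingular_of_bound hp hq (C := |R|) (R := R)
    (stronglyMeasurable_const.indicator hS) (fun z _ => ?_) (fun z hz => ?_)
  · by_cases hz : z.1 ∈ Metric.closedBall (0 : C2) R
    · rw [Set.indicator_of_mem (show z ∈ _ ×ˢ Set.univ from ⟨hz, trivial⟩), norm_one, mul_one]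
      exact (mem_closedBall_zero_iff.1 hz).trans (le_abs_self R)
    · rw [Set.indicator_of_notMem (fun h => hz h.1), norm_zero, mul_zero]
      positivity
  · exact Set.indicator_of_notMem (fun h => hz.not_ge (mem_closedBall_zero_iff.1 h.1)) _

/-- The varifold of the leaf `y₁² - y₂² = τ`. -/
def leafVarifold : Varifold where
  toMeasure := leafMeasure p q τ
  finite_on_compacts K hK := by
    obtain ⟨R, hR⟩ := hK.isBounded.subset_closedBall (0 : C2)
    have hS : MeasurableSet (Metric.closedBall (0 : C2) R ×ˢ
      (Set.univ : Set (C2 →L[ℝ] C2))) := Metric.isClosed_closedBall.measurableSet.prod .univ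
    have h := (mildlySingular_indicator_closedBall hp hq R).integrable hp hq τ
    rw [integrable_indicator_iff hS, integrableOn_const_iff] at h
    refine (measure_mono (Set.prod_mono hR subset_rfl)).trans_lt (h.resolve_left ?_)
    simp
  ae_plane := by
    filter_upwards [ae_leafMeasure (τ := τ) isClosed_setOf_idempotent.measurableSet
      fun y θ hy _ => isPlaneProj_planeProj hp hq hy θ] with z hz
    exact isPlaneProj_of_trace hz.1 hz.2.1 hz.2.2

variable {E : Type*} [NormedAddCommGroup E]

lemma integral_weight [NormedSpace ℝ E] {g : C2 → E} (hg : StronglyMeasurable g) :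
    ∫ x, g x ∂(leafVarifold hp hq τ).weight = ∫ z, g z.1 ∂leafMeasure p q τ :=
  integral_map measurable_fst.aemeasurable hg.aestronglyMeasurable

lemma integrable_weight_iff {g : C2 → E} (hg : StronglyMeasurable g) :
    Integrable g (leafVarifold hp hq τ).weight ↔ Integrable (fun z => g z.1) (leafMeasure p q τ) :=
  integrable_map_measure hg.aestronglyMeasurable measurable_fst.aemeasurable

lemma stronglyMeasurable_meanCurvatureField : StronglyMeasurable (meanCurvatureField p q) :=
  (measurable_meanCurvatureField p q).stronglyMeasurable

lemma locallyIntegrable_meanCurvatureField :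
    LocallyIntegrable (meanCurvatureField p q) (leafVarifold hp hq τ).weight := by
  intro x
  refine ⟨Metric.closedBall 0 (‖x‖ + 1), ?_, ?_⟩
  · refine mem_of_superset (Metric.ball_mem_nhds x one_pos) fun y hy => ?_
    rw [mem_closedBall_zero_iff]
    have := norm_sub_norm_le y x
    rw [mem_ball_iff_norm] at hy
    linarith
  · have hS : MeasurableSet (Metric.closedBall (0 : C2) (‖x‖ + 1)) :=
      Metric.isClosed_closedBall.measurableSet
    have hm := (stronglyMeasurable_meanCurvatureField (p := p) (q := q)).indicator hS
    rw [← integrable_indicator_iff hS, integrable_weight_iff hp hq τ hm]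
    refine (mildlySingular_of_bound hp hq (C := |(q : ℝ) - p|) (R := ‖x‖ + 1)
      (hm.comp_measurable measurable_fst) (fun z _ => ?_) (fun z hz => ?_)).integrable hp hq τ
    · refine (mul_le_mul_of_nonneg_left (norm_indicator_le_norm_self _ _) (norm_nonneg _)).trans ?_
      exact norm_mul_norm_meanCurvatureField_le hp hq z.1
    · exact Set.indicator_of_notMem (fun h => hz.not_ge (mem_closedBall_zero_iff.1 h)) _

end LeafVarifold

/-! ### Test functions and fields as mildly singular functions -/

section TestFields

variable {p q : ℕ} {E : Type*} [NormedAddCommGroup E]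

lemma exists_bound_of_hasCompactSupport {g : C2 → E} (hg : Continuous g)
    (hc : HasCompactSupport g) :
    ∃ C R : ℝ, 0 ≤ C ∧ (∀ x, ‖g x‖ ≤ C) ∧ (∀ x, R < ‖x‖ → g x = 0) := by
  obtain ⟨C, hC⟩ := hc.exists_bound_of_continuous hg
  obtain ⟨R, hR⟩ := hc.isBounded.subset_closedBall (0 : C2)
  refine ⟨C, R, (norm_nonneg _).trans (hC 0), hC, fun x hx => ?_⟩
  exact image_eq_zero_of_notMem_tsupport fun h => hx.not_ge (mem_closedBall_zero_iff.1 (hR h))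

lemma mildlySingular_of_bounded (hp : 0 < p) (hq : 0 < q) {G : C2 × (C2 →L[ℝ] C2) → E}
    (hG : StronglyMeasurable G) {C R : ℝ} (hC : 0 ≤ C) (h1 : ∀ z, ‖z.2‖ ≤ 2 → ‖G z‖ ≤ C)
    (h2 : ∀ z, R < ‖z.1‖ → G z = 0) : MildlySingular p q G := by
  refine mildlySingular_of_bound hp hq hG (C := |R| * C) (R := R) (fun z hz => ?_) h2
  by_cases hR : R < ‖z.1‖
  · rw [h2 z hR, norm_zero, mul_zero]; positivity
  · exact mul_le_mul ((not_lt.1 hR).trans (le_abs_self R)) (h1 z hz) (norm_nonneg _) (abs_nonneg _)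

lemma mildlySingular_comp_fst (hp : 0 < p) (hq : 0 < q) {g : C2 → E} (hg : Continuous g)
    (hc : HasCompactSupport g) : MildlySingular p q fun z => g z.1 := by
  obtain ⟨C, R, hC, h1, h2⟩ := exists_bound_of_hasCompactSupport hg hc
  have hm : StronglyMeasurable g := hg.stronglyMeasurable_of_hasCompactSupport hc
  exact mildlySingular_of_bounded hp hq (hm.comp_measurable measurable_fst) hC
    (fun z _ => h1 z.1) fun z hz => h2 z.1 hz

lemma mildlySingular_apply_meanCurvatureField (hp : 0 < p) (hq : 0 < q) {g : C2 → C2 →L[ℝ] ℝ}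
    (hg : Continuous g) (hc : HasCompactSupport g) :
    MildlySingular p q fun z => g z.1 (meanCurvatureField p q z.1) := by
  obtain ⟨C, R, hC, h1, h2⟩ := exists_bound_of_hasCompactSupport hg hc
  have hm : Measurable fun x => g x (meanCurvatureField p q x) :=
    (by fun_prop : Continuous fun u : (C2 →L[ℝ] ℝ) × C2 => u.1 u.2).measurable.comp
      (hg.measurable.prodMk (measurable_meanCurvatureField p q))
  refine mildlySingular_of_bound hp hq (C := C * |(q : ℝ) - p|) (R := R)
    (hm.comp measurable_fst).stronglyMeasurable (fun z _ => ?_) (fun z hz => ?_)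
  · calc ‖z.1‖ * ‖g z.1 (meanCurvatureField p q z.1)‖
        ≤ ‖z.1‖ * (‖g z.1‖ * ‖meanCurvatureField p q z.1‖) := by
          gcongr; exact (g z.1).le_opNorm _
      _ = ‖g z.1‖ * (‖z.1‖ * ‖meanCurvatureField p q z.1‖) := by ring
      _ ≤ _ := mul_le_mul (h1 z.1) (norm_mul_norm_meanCurvatureField_le hp hq z.1)
          (by positivity) hC
  · rw [h2 z.1 hz, zero_apply]

lemma continuousAt_apply_meanCurvatureField (hp : 0 < p) (hq : 0 < q) {g : C2 → C2 →L[ℝ] ℝ}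
    (hg : Continuous g) {z : C2 × (C2 →L[ℝ] C2)} (hz : z.1 ≠ 0) :
    ContinuousAt (fun z : C2 × (C2 →L[ℝ] C2) => g z.1 (meanCurvatureField p q z.1)) z := by
  have h1 : ContinuousAt (fun x => g x (meanCurvatureField p q x)) z.1 :=
    hg.continuousAt.clm_apply (continuousAt_meanCurvatureField hp hq hz)
  exact ContinuousAt.comp (f := Prod.fst) (g := fun x => g x (meanCurvatureField p q x)) h1
    continuousAt_fst

/-- The divergence of `X` along the plane `z.2`. -/
def planeDiv (X : C2 → C2) (z : C2 × (C2 →L[ℝ] C2)) : ℝ := traceCLM (z.2 ∘L fderiv ℝ X z.1)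

lemma continuous_planeDiv {X : C2 → C2} (hX : ContDiff ℝ 1 X) : Continuous (planeDiv X) := by
  have h1 : Continuous (fderiv ℝ X) := hX.continuous_fderiv (by simp)
  unfold planeDiv
  fun_prop

lemma mildlySingular_planeDiv (hp : 0 < p) (hq : 0 < q) {X : C2 → C2} (hX : ContDiff ℝ 1 X)
    (hc : HasCompactSupport X) : MildlySingular p q (planeDiv X) := by
  obtain ⟨C, R, hC, h1, h2⟩ := exists_bound_of_hasCompactSupport
    (hX.continuous_fderiv (by simp)) (hc.fderiv (𝕜 := ℝ))
  refine mildlySingular_of_bounded hp hq (continuous_planeDiv hX).stronglyMeasurable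
    (C := ‖traceCLM‖ * (2 * C)) (R := R) (by positivity) (fun z hz => ?_) (fun z hz => ?_)
  · refine (traceCLM.le_opNorm _).trans (mul_le_mul_of_nonneg_left ?_ (norm_nonneg _))
    refine (ContinuousLinearMap.opNorm_comp_le _ _).trans ?_
    exact mul_le_mul hz (h1 _) (norm_nonneg _) zero_le_two
  · rw [planeDiv, h2 _ hz, ContinuousLinearMap.comp_zero, map_zero]

end TestFields

/-! ### The divergence theorem on a strip -/

lemma pd_eq_zero_of_vanishing {f : ℝ × ℝ → ℝ} {N : ℝ} (hf : ∀ u, N ≤ |u.1| → f u = 0) (i : Fin 2)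
    {u : ℝ × ℝ} (hu : N < |u.1|) : pd i f u = 0 := by
  have h1 : f =ᶠ[𝓝 u] fun _ => 0 := by
    have : ∀ᶠ w : ℝ × ℝ in 𝓝 u, N < |w.1| :=
      (by fun_prop : Continuous fun w : ℝ × ℝ => |w.1|).continuousAt.eventually (lt_mem_nhds hu)
    filter_upwards [this] with w hw using hf w hw.le
  rw [pd, h1.fderiv_eq]
  simp

lemma continuous_pd {f : ℝ × ℝ → ℝ} (hf : ContDiff ℝ 1 f) (i : Fin 2) : Continuous (pd i f) :=
  (hf.continuous_fderiv (by simp)).clm_apply continuous_const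

/-- The divergence theorem on a long rectangle: the boundary terms in $v$ vanish by the support
condition, those in $\theta$ cancel by periodicity. -/
lemma integral_pd_strip {f g : ℝ × ℝ → ℝ} (hf : ContDiff ℝ 1 f) (hg : ContDiff ℝ 1 g) {N : ℝ}
    (hN : 0 ≤ N) (hfN : ∀ u, N ≤ |u.1| → f u = 0) (hgN : ∀ u, N ≤ |u.1| → g u = 0)
    (hper : ∀ v, g (v, 2 * Real.pi) = g (v, 0)) :
    ∫ u in Set.univ ×ˢ Set.Ioo (0 : ℝ) (2 * Real.pi), (pd 0 f u + pd 1 g u) = 0 := by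
  set D : ℝ × ℝ → ℝ := fun u => pd 0 f u + pd 1 g u with hD
  have hDc : Continuous D := (continuous_pd hf 0).add (continuous_pd hg 1)
  -- The rectangle is wider than the support, so that outside it $N<|v|$ holds strictly and the
  -- derivatives vanish as well.
  have hle : -(N + 1) ≤ N + 1 := by linarith
  have h1 : ∫ u in Set.univ ×ˢ Set.Ioo (0 : ℝ) (2 * Real.pi), D u =
      ∫ u in Set.Ioc (-(N + 1)) (N + 1) ×ˢ Set.Ioo (0 : ℝ) (2 * Real.pi), D u := by
    refine setIntegral_eq_of_subset_of_forall_sdiff_eq_zero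
      (MeasurableSet.univ.prod measurableSet_Ioo) (Set.prod_mono (Set.subset_univ _) subset_rfl) ?_
    rintro u ⟨⟨-, hu2⟩, hu⟩
    have hu' : N < |u.1| := by
      by_contra hcon
      rw [not_lt, abs_le] at hcon
      exact hu ⟨⟨by linarith [hcon.1], by linarith [hcon.2]⟩, hu2⟩
    rw [hD]
    simp only [pd_eq_zero_of_vanishing hfN 0 hu', pd_eq_zero_of_vanishing hgN 1 hu', add_zero]
  have h2 : ∫ u in Set.Ioc (-(N + 1)) (N + 1) ×ˢ Set.Ioo (0 : ℝ) (2 * Real.pi), D u =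
      ∫ v in (-(N + 1))..(N + 1), ∫ θ in (0 : ℝ)..(2 * Real.pi), D (v, θ) := by
    rw [Measure.volume_eq_prod, setIntegral_prod, intervalIntegral.integral_of_le hle]
    · refine integral_congr_ae (Eventually.of_forall fun v => ?_)
      simp only
      rw [intervalIntegral.integral_of_le Real.two_pi_pos.le, integral_Ioc_eq_integral_Ioo]
    · rw [← Measure.volume_eq_prod]
      refine (hDc.continuousOn.integrableOn_compact
        (isCompact_Icc.prod isCompact_Icc)).mono_set (s := _)
        (Set.prod_mono Set.Ioc_subset_Icc_self Set.Ioo_subset_Icc_self)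
  have h3 := integral2_divergence_prod_of_hasFDerivAt_off_countable f g (fderiv ℝ f) (fderiv ℝ g)
    (-(N + 1)) 0 (N + 1) (2 * Real.pi) ∅ Set.countable_empty hf.continuous.continuousOn
    hg.continuous.continuousOn
    (fun x _ => (hf.differentiable (by simp)).differentiableAt.hasFDerivAt)
    (fun x _ => (hg.differentiable (by simp)).differentiableAt.hasFDerivAt)
    (hDc.continuousOn.integrableOn_compact (isCompact_uIcc.prod isCompact_uIcc))
  rw [h1, h2]
  refine h3.trans ?_
  have h4 (θ : ℝ) : f (N + 1, θ) = 0 := hfN _ (by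
    change N ≤ |N + 1|; rw [abs_of_nonneg (by linarith)]; linarith)
  have h5 (θ : ℝ) : f (-(N + 1), θ) = 0 := hfN _ (by
    change N ≤ |-(N + 1)|; rw [abs_neg, abs_of_nonneg (by linarith)]; linarith)
  simp only [h4, h5, hper, intervalIntegral.integral_zero, sub_self, add_zero]

/-! ### The first variation of a sheet -/

section Sheet

variable {p q : ℕ} (hp : 0 < p) (hq : 0 < q) (ε l : ℝ) {X : C2 → C2}

lemma contDiff_pd_surf (i : Fin 2) : ContDiff ℝ 1 (pd i (surf p q ε l)) :=
  ((contDiff_surf ε l).fderiv_right (m := 1) (by norm_cast)).clm_apply contDiff_const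

lemma pd_inner_surf (hX : ContDiff ℝ 1 X) (i j : Fin 2) (u : ℝ × ℝ) :
    pd i (fun u => inner ℝ (X (surf p q ε l u)) (pd j (surf p q ε l) u)) u =
      inner ℝ (X (surf p q ε l u)) (pd i (pd j (surf p q ε l)) u) +
      inner ℝ (fderiv ℝ X (surf p q ε l u) (pd i (surf p q ε l) u)) (pd j (surf p q ε l) u) := by
  have h1 : HasFDerivAt (surf p q ε l) (fderiv ℝ (surf p q ε l) u) u :=
    ((contDiff_surf ε l).differentiable (by simp)).differentiableAt.hasFDerivAt
  have h2 : HasFDerivAt X (fderiv ℝ X (surf p q ε l u)) (surf p q ε l u) :=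
    (hX.differentiable (by simp)).differentiableAt.hasFDerivAt
  have h3 : HasFDerivAt (pd j (surf p q ε l)) (fderiv ℝ (pd j (surf p q ε l)) u) u :=
    ((contDiff_pd_surf ε l j).differentiable (by simp)).differentiableAt.hasFDerivAt
  have h4 := ((h2.comp u h1).inner ℝ h3).fderiv
  simp only [Function.comp_def] at h4
  rw [pd, h4]
  simp [fderivInnerCLM_apply, pd]

include hp hq in
-- Since $F_{vv}=F$, the left side is $pq\,F_{vv}+F_{\theta\theta}$, the Laplacian of $F$ up to a
-- factor, and it is already normal.
lemma smul_surf_add_pd_one_pd_one {u : ℝ × ℝ} (hy : l • hyper ε u.1 ≠ 0) :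
    (p * q : ℝ) • surf p q ε l u + pd 1 (pd 1 (surf p q ε l)) u =
      sqLen p q (l • hyper ε u.1) • meanCurvatureField p q (surf p q ε l u) := by
  have hD := (sqLen_pos hp hq hy).ne'
  have hP0 : ((√p : ℝ) : ℂ) ≠ 0 := by rw [Complex.ofReal_ne_zero]; positivity
  have hQ0 : ((√q : ℝ) : ℂ) ≠ 0 := by rw [Complex.ofReal_ne_zero]; positivity
  have hPc : ((√p : ℝ) : ℂ) ^ 2 = p := by
    rw [← Complex.ofReal_pow, Real.sq_sqrt (Nat.cast_nonneg p)]; simp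
  have hQc : ((√q : ℝ) : ℂ) ^ 2 = q := by
    rw [← Complex.ofReal_pow, Real.sq_sqrt (Nat.cast_nonneg q)]; simp
  rw [pd_one_pd_one_surf, surf, meanCurvatureField_leaf hp hq, smul_smul, mul_div_cancel₀ _ hD]
  unfold leaf
  rw [smul_frame, smul_frame, frame_add]
  congr 1
  · simp only [Complex.ofReal_mul, Complex.ofReal_sub, Complex.ofReal_natCast, Prod.smul_fst,
      Complex.ofReal_div, smul_eq_mul]
    rw [← hPc, ← hQc]; field_simp; ring
  · simp only [Complex.ofReal_mul, Complex.ofReal_sub, Complex.ofReal_natCast, Prod.smul_snd,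
      Complex.ofReal_div, smul_eq_mul]
    rw [← hPc, ← hQc]; field_simp; ring

include hp hq in
-- The defect of the first variation formula in divergence form: the derivatives falling on $X$
-- produce the divergence along the plane, those falling on the tangent vectors produce the mean
-- curvature.
lemma pd_add_pd_eq_density_mul (hX : ContDiff ℝ 1 X) {u : ℝ × ℝ} (hy : l • hyper ε u.1 ≠ 0) :
    pd 0 (fun u => √(p * q : ℝ) * inner ℝ (X (surf p q ε l u)) (pd 0 (surf p q ε l) u)) u +
      pd 1 (fun u => (√(p * q : ℝ))⁻¹ * inner ℝ (X (surf p q ε l u)) (pd 1 (surf p q ε l) u)) u =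
    sheetDensity p q ε l u.1 * (planeDiv X (leafPlane p q (l • hyper ε u.1) u.2) +
      inner ℝ (X (surf p q ε l u)) (meanCurvatureField p q (surf p q ε l u))) := by
  have hD := (sqLen_pos hp hq hy).ne'
  have hr : √(p * q : ℝ) ≠ 0 := by positivity
  have hr2 : √(p * q : ℝ) * √(p * q : ℝ) = p * q := Real.mul_self_sqrt (by positivity)
  have hdiff (j : Fin 2) : DifferentiableAt ℝ
      (fun u => inner ℝ (X (surf p q ε l u)) (pd j (surf p q ε l) u)) u :=
    ((((hX.comp ((contDiff_surf ε l).of_le (by norm_cast))).inner ℝ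
      (contDiff_pd_surf ε l j))).differentiable (by simp)).differentiableAt
  have hmul (c : ℝ) (i j : Fin 2) :
      pd i (fun u => c * inner ℝ (X (surf p q ε l u)) (pd j (surf p q ε l) u)) u =
        c * pd i (fun u => inner ℝ (X (surf p q ε l u)) (pd j (surf p q ε l) u)) u := by
    rw [pd, fderiv_const_mul (hdiff j)]; rfl
  have hdiv : planeDiv X (leafPlane p q (l • hyper ε u.1) u.2) = (sqLen p q (l • hyper ε u.1))⁻¹ *
      inner ℝ (profileTangent p q (l • hyper ε u.1) u.2)
        (fderiv ℝ X (surf p q ε l u) (profileTangent p q (l • hyper ε u.1) u.2)) +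
      (sqLen p q (l • hyper ε u.1))⁻¹ * inner ℝ (angularTangent p q (l • hyper ε u.1) u.2)
        (fderiv ℝ X (surf p q ε l u) (angularTangent p q (l • hyper ε u.1) u.2)) :=
    traceCLM_pairProj_comp _ _ _ _ _
  have hvec : √(p * q : ℝ) • surf p q ε l u + (√(p * q : ℝ))⁻¹ • pd 1 (pd 1 (surf p q ε l)) u =
      sheetDensity p q ε l u.1 • meanCurvatureField p q (surf p q ε l u) := by
    rw [sheetDensity, mul_smul, ← smul_surf_add_pd_one_pd_one hp hq ε l hy, smul_add, smul_smul,
      (by rw [inv_mul_eq_iff_eq_mul₀ hr, hr2] : (√(p * q : ℝ))⁻¹ * (p * q : ℝ) = √(p * q : ℝ))]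
  have hin := congrArg (inner ℝ (X (surf p q ε l u))) hvec
  rw [inner_add_right, real_inner_smul_right, real_inner_smul_right, real_inner_smul_right] at hin
  rw [hmul, hmul, pd_inner_surf ε l hX, pd_inner_surf ε l hX, pd_zero_pd_zero_surf, mul_add,
    mul_add, mul_add, ← hin, hdiv, pd_zero_surf hp hq, pd_one_surf hp hq, sheetDensity, map_smul,
    real_inner_smul_left, real_inner_smul_right, real_inner_comm (angularTangent _ _ _ _),
    real_inner_comm (profileTangent _ _ _ _)]
  field_simp
  ring

include hp hq in
lemma abs_le_of_norm_surf_le' {ε : ℝ} (hε : IsSign ε) {l : ℝ} (hl : l ≠ 0) {R : ℝ} {u : ℝ × ℝ}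
    (h : ‖surf p q ε l u‖ ≤ R) : |u.1| ≤ 2 * (p + q) * (R / |l|) ^ 2 + 1 := by
  refine abs_le_of_norm_surf_le hp hq hε isSign_one ?_
  rw [le_div_iff₀ (by positivity), mul_comm, ← Real.norm_eq_abs, ← norm_smul, ← surf_mul, mul_one]
  exact h

lemma surf_two_pi (v : ℝ) : surf p q ε l (v, 2 * Real.pi) = surf p q ε l (v, 0) := by
  have := frame_add_two_pi p q 0
  rw [zero_add] at this
  exact this _ _

lemma angularTangent_two_pi (y : ℝ × ℝ) :
    angularTangent p q y (2 * Real.pi) = angularTangent p q y 0 := by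
  have := frame_add_two_pi p q 0
  rw [zero_add] at this
  exact this _ _

/-- The integrand of `δV(X) + ∫ ⟨h, X⟩ d‖V‖`. -/
def firstVariationDefect (p q : ℕ) (X : C2 → C2) (z : C2 × (C2 →L[ℝ] C2)) : ℝ :=
  planeDiv X z + inner ℝ (X z.1) (meanCurvatureField p q z.1)

include hp hq in
lemma mildlySingular_inner_meanCurvatureField (hX : Continuous X) (hc : HasCompactSupport X) :
    MildlySingular p q fun z => inner ℝ (X z.1) (meanCurvatureField p q z.1) :=
  mildlySingular_apply_meanCurvatureField hp hq (g := fun x => innerSL ℝ (X x))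
    ((innerSL ℝ).continuous.comp hX) (hc.comp_left (map_zero _))

lemma MildlySingular.add {E : Type*} [NormedAddCommGroup E] {G G' : C2 × (C2 →L[ℝ] C2) → E}
    (hG : MildlySingular p q G) (hG' : MildlySingular p q G') :
    MildlySingular p q fun z => G z + G' z := by
  obtain ⟨C, R, hC, h⟩ := hG.bound
  obtain ⟨C', R', hC', h'⟩ := hG'.bound
  refine ⟨hG.stronglyMeasurable.add hG'.stronglyMeasurable, C + C', max R R',
    add_nonneg hC hC', fun y θ hy => ⟨?_, fun hR => ?_⟩⟩
  · refine (mul_le_mul_of_nonneg_left (norm_add_le _ _) (norm_nonneg _)).trans ?_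
    rw [mul_add]
    exact add_le_add (h y θ hy).1 (h' y θ hy).1
  · rw [(h y θ hy).2 ((le_max_left _ _).trans_lt hR),
      (h' y θ hy).2 ((le_max_right _ _).trans_lt hR), add_zero]

include hp hq in
lemma mildlySingular_firstVariationDefect (hX : ContDiff ℝ 1 X) (hc : HasCompactSupport X) :
    MildlySingular p q (firstVariationDefect p q X) :=
  (mildlySingular_planeDiv hp hq hX hc).add
    (mildlySingular_inner_meanCurvatureField hp hq hX.continuous hc)

include hp hq in
lemma continuousAt_firstVariationDefect (hX : ContDiff ℝ 1 X) {z : C2 × (C2 →L[ℝ] C2)}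
    (hz : z.1 ≠ 0) : ContinuousAt (firstVariationDefect p q X) z :=
  (continuous_planeDiv hX).continuousAt.add (continuousAt_apply_meanCurvatureField hp hq
    (g := fun x => innerSL ℝ (X x)) ((innerSL ℝ).continuous.comp hX.continuous) hz)

lemma sheetDensity_nonneg (v : ℝ) : 0 ≤ sheetDensity p q ε l v := by
  have := sqLen_nonneg p q (l • hyper ε v)
  unfold sheetDensity; positivity

lemma measurable_smul_hyper : Measurable fun v => l • hyper ε v :=
  ((continuous_hyper ε).const_smul l).measurable

include hp hq in
lemma integral_firstVariationDefect_sheet {ε : ℝ} (hε : IsSign ε) {l : ℝ} (hl : l ≠ 0)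
    (hX : ContDiff ℝ 1 X) (hc : HasCompactSupport X) :
    ∫ z, firstVariationDefect p q X z
      ∂sweep p q Set.univ (fun v => l • hyper ε v) (sheetDensity p q ε l) = 0 := by
  rw [integral_sweep MeasurableSet.univ (measurable_smul_hyper ε l)
    (continuous_sheetDensity p q ε l).measurable (fun v _ => sheetDensity_nonneg ε l v)
    (mildlySingular_firstVariationDefect hp hq hX hc).stronglyMeasurable]
  obtain ⟨C, R, -, -, hR⟩ := exists_bound_of_hasCompactSupport hX.continuous hc
  have hXs : ContDiff ℝ 1 fun u => X (surf p q ε l u) :=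
    hX.comp ((contDiff_surf ε l).of_le (by norm_cast))
  have hzero (u : ℝ × ℝ) (hu : 2 * (p + q) * (R / |l|) ^ 2 + 2 ≤ |u.1|) :
      X (surf p q ε l u) = 0 := by
    refine hR _ (not_le.1 fun h => ?_)
    have := abs_le_of_norm_surf_le' hp hq hε hl h
    linarith
  refine (setIntegral_congr_fun (MeasurableSet.univ.prod measurableSet_Ioo) fun u _ => ?_).trans
    (integral_pd_strip
    (f := fun u => √(p * q : ℝ) * inner ℝ (X (surf p q ε l u)) (pd 0 (surf p q ε l) u))
    (g := fun u => (√(p * q : ℝ))⁻¹ * inner ℝ (X (surf p q ε l u)) (pd 1 (surf p q ε l) u))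
    (contDiff_const.mul (hXs.inner ℝ (contDiff_pd_surf ε l 0)))
    (contDiff_const.mul (hXs.inner ℝ (contDiff_pd_surf ε l 1)))
    (N := 2 * (p + q) * (R / |l|) ^ 2 + 2) (by positivity) (fun u hu => ?_) (fun u hu => ?_)
    (fun v => ?_))
  · exact (pd_add_pd_eq_density_mul hp hq ε l hX (smul_hyper_ne_zero hε.ne_zero hl u.1)).symm
  · simp only [hzero u hu, inner_zero_left, mul_zero]
  · simp only [hzero u hu, inner_zero_left, mul_zero]
  · simp only [surf_two_pi, pd_one_surf hp hq, angularTangent_two_pi]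

include hp hq in
lemma MildlySingular.integral_leafMeasure_eq_sheets {E : Type*} [NormedAddCommGroup E]
    [NormedSpace ℝ E] {G : C2 × (C2 →L[ℝ] C2) → E} (hG : MildlySingular p q G) {ε : ℝ}
    (hε : IsSign ε) {l : ℝ} (hl : 0 < l) : ∫ z, G z ∂leafMeasure p q (l ^ 2 * ε) =
      (2⁻¹ : ℝ) • (∫ z, G z ∂sweep p q Set.univ (fun v => l • hyper ε v) (sheetDensity p q ε l) +
        ∫ z, G z ∂sweep p q Set.univ (fun v => (-l) • hyper ε v) (sheetDensity p q ε l)) := by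
  have h1 := hG.integrable hp hq (l ^ 2 * ε)
  rw [leafMeasure_eq_sheets hε hl] at h1 ⊢
  rw [integrable_smul_measure (by norm_num) (by norm_num)] at h1
  rw [integral_smul_measure, integral_add_measure h1.left_of_add_measure h1.right_of_add_measure]
  simp

lemma exists_sign_mul_sq {τ : ℝ} (hτ : τ ≠ 0) : ∃ l ε : ℝ, 0 < l ∧ IsSign ε ∧ τ = l ^ 2 * ε := by
  refine ⟨√|τ|, SignType.sign τ, by positivity, ?_, ?_⟩
  · rcases hτ.lt_or_gt with h | h
    · right; simp [h]
    · left; simp [h]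
  · rw [Real.sq_sqrt (abs_nonneg _), mul_comm, sign_mul_abs]

lemma sheetDensity_neg (l v : ℝ) : sheetDensity p q ε (-l) v = sheetDensity p q ε l v := by
  rw [sheetDensity, sheetDensity, sqLen_smul, sqLen_smul, neg_sq]

include hp hq in
-- For $\tau\ne0$ both sheets contribute zero. The case of the cone follows by letting $\tau\to0$,
-- as the defect is $O(1/|z|)$ and continuous off the origin; in particular the first variation has
-- no singular part at the vertex.
lemma integral_firstVariationDefect (hX : ContDiff ℝ 1 X) (hc : HasCompactSupport X) (τ : ℝ) :
    ∫ z, firstVariationDefect p q X z ∂leafMeasure p q τ = 0 := by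
  have hG := mildlySingular_firstVariationDefect hp hq hX hc
  have hne (τ : ℝ) (hτ : τ ≠ 0) : ∫ z, firstVariationDefect p q X z ∂leafMeasure p q τ = 0 := by
    obtain ⟨l, ε, hl, hε, rfl⟩ := exists_sign_mul_sq hτ
    have h2 := integral_firstVariationDefect_sheet hp hq hε (neg_ne_zero.2 hl.ne') hX hc
    rw [funext (sheetDensity_neg ε l)] at h2
    rw [hG.integral_leafMeasure_eq_sheets hp hq hε hl,
      integral_firstVariationDefect_sheet hp hq hε hl.ne' hX hc, h2, add_zero, smul_zero]
  rcases eq_or_ne τ 0 with rfl | hτ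
  · have h1 := hG.tendsto_leafMeasure hp hq fun z hz =>
      continuousAt_firstVariationDefect hp hq hX hz
    refine tendsto_nhds_unique (h1.mono_left (nhdsWithin_le_nhds (s := {0}ᶜ))) ?_
    refine tendsto_const_nhds.congr' ?_
    filter_upwards [self_mem_nhdsWithin] with τ hτ using (hne τ hτ).symm
  · exact hne τ hτ

lemma isGenMeanCurvature_leafVarifold (τ : ℝ) :
    (leafVarifold hp hq τ).IsGenMeanCurvature (meanCurvatureField p q) := by
  refine ⟨locallyIntegrable_meanCurvatureField hp hq τ, fun X hX hc => ?_⟩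
  have h1 := integral_firstVariationDefect hp hq hX hc τ
  have h2 := mildlySingular_inner_meanCurvatureField hp hq hX.continuous hc
  unfold firstVariationDefect at h1
  rw [integral_add ((mildlySingular_planeDiv hp hq hX hc).integrable hp hq τ)
    (h2.integrable hp hq τ)] at h1
  have hm : StronglyMeasurable fun x => inner ℝ (meanCurvatureField p q x) (X x) :=
    ((measurable_meanCurvatureField p q).inner hX.continuous.measurable).stronglyMeasurable
  rw [integral_weight hp hq τ hm]
  simp only [real_inner_comm (X _)]
  exact eq_neg_of_add_eq_zero_left h1

end Sheet

/-! ### Differentiating integrals over a strip -/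

/-- Differentiation under the integral: near $x_0$ all integrands are supported in one compact range
of $v$, on which $F'$ is bounded by continuity. -/
lemma hasDerivAt_integral_strip {F F' : ℝ → ℝ × ℝ → ℝ} {x₀ δ N : ℝ} (hδ : 0 < δ)
    (hF : ∀ x, Continuous (F x)) (hF' : Continuous fun w : ℝ × (ℝ × ℝ) => F' w.1 w.2)
    (hd : ∀ u x, HasDerivAt (fun x => F x u) (F' x u) x)
    (hN : ∀ x ∈ Set.Icc (x₀ - δ) (x₀ + δ), ∀ u, N < |u.1| → F x u = 0)
    (hN' : ∀ x ∈ Set.Icc (x₀ - δ) (x₀ + δ), ∀ u, N < |u.1| → F' x u = 0) :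
    HasDerivAt (fun x => ∫ u in Set.univ ×ˢ Set.Ioo (0 : ℝ) (2 * Real.pi), F x u)
      (∫ u in Set.univ ×ˢ Set.Ioo (0 : ℝ) (2 * Real.pi), F' x₀ u) x₀ := by
  have hbdd (c : ℝ) : IntegrableOn ((Set.Icc (-N) N ×ˢ Set.univ).indicator fun _ : ℝ × ℝ => c)
      (Set.univ ×ˢ Set.Ioo (0 : ℝ) (2 * Real.pi)) := by
    rw [IntegrableOn, integrable_indicator_iff (measurableSet_Icc.prod .univ), IntegrableOn,
      Measure.restrict_restrict (measurableSet_Icc.prod .univ), Set.prod_inter_prod,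
      Set.inter_univ, Set.univ_inter]
    refine integrableOn_const (ne_of_lt ?_)
    rw [Measure.volume_eq_prod, Measure.prod_prod]
    exact ENNReal.mul_lt_top measure_Icc_lt_top measure_Ioo_lt_top
  have habs {u : ℝ × ℝ} (hu : u ∉ Set.Icc (-N) N ×ˢ (Set.univ : Set ℝ)) : N < |u.1| :=
    not_le.1 fun h => hu ⟨abs_le.1 h, trivial⟩
  obtain ⟨K, hK⟩ := ((isCompact_Icc (a := x₀ - δ) (b := x₀ + δ)).prod
    ((isCompact_Icc (a := -N) (b := N)).prod (isCompact_Icc (a := (0 : ℝ)) (b := 2 * Real.pi)))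
    ).exists_bound_of_continuousOn hF'.continuousOn
  obtain ⟨K₀, hK₀⟩ := ((isCompact_Icc (a := -N) (b := N)).prod (isCompact_Icc (a := (0 : ℝ))
    (b := 2 * Real.pi))).exists_bound_of_continuousOn (hF x₀).continuousOn
  have hx₀ : x₀ ∈ Set.Icc (x₀ - δ) (x₀ + δ) := ⟨by linarith, by linarith⟩
  have hstrip := ae_restrict_mem (μ := volume)
    (MeasurableSet.univ.prod measurableSet_Ioo : MeasurableSet
      (Set.univ ×ˢ Set.Ioo (0 : ℝ) (2 * Real.pi) : Set (ℝ × ℝ)))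
  refine (hasDerivAt_integral_of_dominated_loc_of_deriv_le
    (bound := (Set.Icc (-N) N ×ˢ Set.univ).indicator fun _ => K)
    (Icc_mem_nhds (by linarith) (by linarith) : Set.Icc (x₀ - δ) (x₀ + δ) ∈ 𝓝 x₀)
    (Eventually.of_forall fun x => (hF x).aestronglyMeasurable) ?_
    (by fun_prop : Continuous (F' x₀)).aestronglyMeasurable ?_ (hbdd K)
    (Eventually.of_forall fun u x _ => hd u x)).2
  · refine (hbdd K₀).mono' (hF x₀).aestronglyMeasurable ?_
    filter_upwards [hstrip] with u hu
    by_cases h : u ∈ Set.Icc (-N) N ×ˢ (Set.univ : Set ℝ)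
    · rw [Set.indicator_of_mem h]
      exact hK₀ u ⟨h.1, Set.Ioo_subset_Icc_self hu.2⟩
    · rw [Set.indicator_of_notMem h, hN x₀ hx₀ u (habs h), norm_zero]
  · filter_upwards [hstrip] with u hu x hx
    by_cases h : u ∈ Set.Icc (-N) N ×ˢ (Set.univ : Set ℝ)
    · rw [Set.indicator_of_mem h]
      exact hK (x, u) ⟨hx, h.1, Set.Ioo_subset_Icc_self hu.2⟩
    · rw [Set.indicator_of_notMem h, hN' x hx u (habs h), norm_zero]

/-! ### The derivative of the mass -/

section Mass

variable {p q : ℕ} (hp : 0 < p) (hq : 0 < q) {φ : C2 → ℝ}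

/-- The logarithmic derivative of the mass of dilations. -/
def dilationField (φ : C2 → ℝ) (x : C2) : ℝ := 2 * φ x + fderiv ℝ φ x x

lemma continuous_dilationField (hφ : ContDiff ℝ 1 φ) : Continuous (dilationField φ) :=
  (continuous_const.mul hφ.continuous).add
    ((hφ.continuous_fderiv (by simp)).clm_apply continuous_id)

lemma dilationField_eq_zero {x : C2} (h1 : φ x = 0) (h2 : fderiv ℝ φ x = 0) :
    dilationField φ x = 0 := by
  simp [dilationField, h1, h2]

lemma hasCompactSupport_dilationField (hc : HasCompactSupport φ) :
    HasCompactSupport (dilationField φ) := by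
  refine hc.mono' fun x hx => ?_
  by_contra h
  exact hx (dilationField_eq_zero (image_eq_zero_of_notMem_tsupport h)
    (image_eq_zero_of_notMem_tsupport fun h' => h (tsupport_fderiv_subset ℝ h')))

lemma sheetDensity_eq (ε l v : ℝ) : sheetDensity p q ε l v = l ^ 2 * sheetDensity p q ε 1 v := by
  rw [sheetDensity, sheetDensity, sqLen_smul, sqLen_smul]; ring

lemma surf_eq_smul (ε l : ℝ) (u : ℝ × ℝ) : surf p q ε l u = l • surf p q ε 1 u := by
  rw [← surf_mul, mul_one]

/-- The integral of `φ` over a sheet. -/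
def sheetMass (p q : ℕ) (φ : C2 → ℝ) (ε l : ℝ) : ℝ :=
  ∫ u in Set.univ ×ˢ Set.Ioo (0 : ℝ) (2 * Real.pi), sheetDensity p q ε l u.1 * φ (surf p q ε l u)

lemma sheetMass_neg_eq (φ : C2 → ℝ) (ε l : ℝ) : sheetMass p q φ ε (-l) =
    ∫ u in Set.univ ×ˢ Set.Ioo (0 : ℝ) (2 * Real.pi),
      sheetDensity p q ε l u.1 * φ (surf p q ε (-l) u) := by
  simp only [sheetMass, sheetDensity_neg]

include hp hq in
lemma integral_comp_fst_eq_sheetMass {g : C2 → ℝ} (hg : Continuous g) (hc : HasCompactSupport g)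
    {ε : ℝ} (hε : IsSign ε) {l : ℝ} (hl : 0 < l) : ∫ z, g z.1 ∂leafMeasure p q (l ^ 2 * ε) =
      2⁻¹ * (sheetMass p q g ε l + sheetMass p q g ε (-l)) := by
  have hG := mildlySingular_comp_fst hp hq hg hc
  rw [hG.integral_leafMeasure_eq_sheets hp hq hε hl, sheetMass_neg_eq,
    integral_sweep MeasurableSet.univ (measurable_smul_hyper ε l)
      (continuous_sheetDensity p q ε l).measurable (fun v _ => sheetDensity_nonneg ε l v)
      hG.stronglyMeasurable,
    integral_sweep MeasurableSet.univ (measurable_smul_hyper ε (-l))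
      (continuous_sheetDensity p q ε l).measurable (fun v _ => sheetDensity_nonneg ε l v)
      hG.stronglyMeasurable]
  rfl

include hp hq in
-- The sheet at $l$ is $l$ times a fixed sheet, with area multiplied by $l^2$, so the integrand is
-- $l^2\varphi(lx)$ and its derivative is $l^{-1}\cdot l^2\,(2\varphi+D\varphi(\cdot))$ at $lx$.
lemma hasDerivAt_sheetMass (hφ : ContDiff ℝ 1 φ) (hc : HasCompactSupport φ) {ε : ℝ}
    (hε : IsSign ε) {l : ℝ} (hl : l ≠ 0) :
    HasDerivAt (sheetMass p q φ ε) (l⁻¹ * sheetMass p q (dilationField φ) ε l) l := by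
  obtain ⟨C, R, -, -, hR⟩ := exists_bound_of_hasCompactSupport hφ.continuous hc
  obtain ⟨C', R', -, -, hR'⟩ := exists_bound_of_hasCompactSupport
    (hφ.continuous_fderiv (by simp)) (hc.fderiv (𝕜 := ℝ))
  set R₁ := max (max R R') 0 with hR₁
  set N := 2 * (p + q) * (R₁ / (|l| / 2)) ^ 2 + 1 with hN
  have hl' : 0 < |l| := abs_pos.2 hl
  -- A scale within $|l|/2$ of $l$ has absolute value at least $|l|/2$, so one bound on $v$ serves
  -- all of them.
  have hlarge (x : ℝ) (hx : x ∈ Set.Icc (l - |l| / 2) (l + |l| / 2)) (u : ℝ × ℝ)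
      (hu : N < |u.1|) : R₁ < ‖surf p q ε x u‖ := by
    have hxl : |l| / 2 ≤ |x| := by
      have h1 : |x - l| ≤ |l| / 2 := abs_le.2 ⟨by linarith [hx.1], by linarith [hx.2]⟩
      have h2 := abs_sub_abs_le_abs_sub l x
      rw [abs_sub_comm] at h2
      linarith
    by_contra hcon
    have h1 := abs_le_of_norm_surf_le' hp hq hε (abs_pos.1 (by linarith)) (not_lt.1 hcon)
    have h2 : R₁ / |x| ≤ R₁ / (|l| / 2) :=
      div_le_div_of_nonneg_left (le_max_right _ _) (by linarith) hxl
    have h3 : (R₁ / |x|) ^ 2 ≤ (R₁ / (|l| / 2)) ^ 2 :=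
      pow_le_pow_left₀ (div_nonneg (le_max_right _ _) (abs_nonneg _)) h2 2
    have h4 : 2 * (p + q) * (R₁ / |x|) ^ 2 ≤ 2 * (p + q) * (R₁ / (|l| / 2)) ^ 2 := by gcongr
    linarith
  have hφ0 {x : C2} (hx : R₁ < ‖x‖) : φ x = 0 :=
    hR x (((le_max_left _ _).trans (le_max_left _ _)).trans_lt hx)
  have hφ0' {x : C2} (hx : R₁ < ‖x‖) : fderiv ℝ φ x = 0 :=
    hR' x (((le_max_right _ _).trans (le_max_left _ _)).trans_lt hx)
  have hs := (contDiff_surf (p := p) (q := q) ε 1).continuous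
  have hdens := continuous_sheetDensity p q ε 1
  have hdil := continuous_dilationField hφ
  have hφc := hφ.continuous
  have hDφ := hφ.continuous_fderiv (by simp)
  have hmain := hasDerivAt_integral_strip (x₀ := l) (δ := |l| / 2) (N := N)
    (F := fun x u => x ^ 2 * sheetDensity p q ε 1 u.1 * φ (x • surf p q ε 1 u))
    (F' := fun x u => 2 * x * sheetDensity p q ε 1 u.1 * φ (x • surf p q ε 1 u) +
      x ^ 2 * sheetDensity p q ε 1 u.1 * fderiv ℝ φ (x • surf p q ε 1 u) (surf p q ε 1 u))
    (by positivity) (fun x => by fun_prop) (by fun_prop) (fun u x => ?_) (fun x hx u hu => ?_)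
    (fun x hx u hu => ?_)
  · have hrep : sheetMass p q φ ε = fun x => ∫ u in Set.univ ×ˢ Set.Ioo (0 : ℝ) (2 * Real.pi),
        x ^ 2 * sheetDensity p q ε 1 u.1 * φ (x • surf p q ε 1 u) := by
      funext x
      simp only [sheetMass, sheetDensity_eq ε x, surf_eq_smul ε x]
    rw [hrep]
    convert hmain using 1
    rw [sheetMass, ← integral_const_mul]
    refine integral_congr_ae (Eventually.of_forall fun u => ?_)
    simp only [sheetDensity_eq ε l, surf_eq_smul ε l, dilationField, map_smul, smul_eq_mul]
    field_simp
  · have h1 : HasDerivAt (fun x : ℝ => x • surf p q ε 1 u) (surf p q ε 1 u) x := by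
      simpa using (hasDerivAt_id x).smul_const (surf p q ε 1 u)
    have h2 := ((hφ.differentiable (by simp)).differentiableAt
      (x := x • surf p q ε 1 u)).hasFDerivAt.comp_hasDerivAt x h1
    have h3 := (((hasDerivAt_pow 2 x).mul_const (sheetDensity p q ε 1 u.1))).mul h2
    refine h3.congr_deriv ?_
    simp [Function.comp]
  · have := hlarge x hx u hu
    rw [surf_eq_smul] at this
    simp only [hφ0 this, mul_zero]
  · have := hlarge x hx u hu
    rw [surf_eq_smul] at this
    simp only [hφ0 this, hφ0' this, mul_zero, zero_apply, add_zero]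

include hp hq in
lemma hasDerivAt_integral_leafMeasure (hφ : ContDiff ℝ 1 φ) (hc : HasCompactSupport φ) {τ : ℝ}
    (hτ : τ ≠ 0) : HasDerivAt (fun τ => ∫ z, φ z.1 ∂leafMeasure p q τ)
      ((2 * τ)⁻¹ * ∫ z, dilationField φ z.1 ∂leafMeasure p q τ) τ := by
  obtain ⟨l, ε, hl, hε, rfl⟩ := exists_sign_mul_sq hτ
  have hsq : √(l ^ 2 * ε * ε) = l := by
    rw [mul_assoc, hε.mul_self, mul_one, Real.sqrt_sq hl.le]
  have hpos : 0 < l ^ 2 * ε * ε := by rw [mul_assoc, hε.mul_self, mul_one]; positivity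
  -- The scale is $l=\sqrt{\tau\varepsilon}$, and
  -- $\frac{\varepsilon}{2l}\cdot\frac1l=\frac1{2\tau}$.
  have h0 : HasDerivAt (fun τ : ℝ => √(τ * ε)) (ε / (2 * l)) (l ^ 2 * ε) := by
    have := ((hasDerivAt_id (l ^ 2 * ε)).mul_const ε).sqrt hpos.ne'
    simpa [hsq] using this
  have h1 := hasDerivAt_sheetMass hp hq hφ hc hε hl.ne'
  have h2 := hasDerivAt_sheetMass hp hq hφ hc hε (neg_ne_zero.2 hl.ne')
  rw [← hsq] at h1
  have h3 := h1.comp (l ^ 2 * ε) h0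
  have h2' : HasDerivAt (sheetMass p q φ ε) ((-l)⁻¹ * sheetMass p q (dilationField φ) ε (-l))
    (-√(l ^ 2 * ε * ε)) := by rw [hsq]; exact h2
  have h4 := h2'.comp (l ^ 2 * ε) h0.neg
  rw [hsq] at h3
  have h5 := (h3.add h4).const_mul (2⁻¹ : ℝ)
  rw [integral_comp_fst_eq_sheetMass hp hq (continuous_dilationField hφ)
    (hasCompactSupport_dilationField hc) hε hl]
  refine (h5.congr_of_eventuallyEq ?_).congr_deriv ?_
  · have : ∀ᶠ τ in 𝓝 (l ^ 2 * ε), 0 < τ * ε :=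
      (by fun_prop : Continuous fun τ : ℝ => τ * ε).continuousAt.eventually (lt_mem_nhds hpos)
    filter_upwards [this] with τ hτ'
    have h6 := integral_comp_fst_eq_sheetMass hp hq hφ.continuous hc hε (Real.sqrt_pos.2 hτ')
    rw [Real.sq_sqrt hτ'.le, mul_assoc, hε.mul_self, mul_one] at h6
    exact h6
  · have := hε.ne_zero
    have h7 := hε.mul_self
    rw [show (ε : ℝ) / (2 * l) = 1 / (2 * l * ε) by field_simp; linear_combination h7]
    field_simp

end Mass

section Dissipation

variable {p q : ℕ} (hp : 0 < p) (hq : 0 < q) {φ : C2 → ℝ}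

/-! ### The position vector and the mean curvature -/

include hp hq in
-- The inner product of $(q-p)x^\perp=\tau h$ with the normal vector $h$.
lemma inner_leaf_meanCurvatureField {y : ℝ × ℝ} (hy : y ≠ 0) (θ : ℝ) :
    ((q : ℝ) - p) * inner ℝ (leaf p q y θ) (meanCurvatureField p q (leaf p q y θ)) =
      (y.1 ^ 2 - y.2 ^ 2) * ‖meanCurvatureField p q (leaf p q y θ)‖ ^ 2 := by
  have hD := (sqLen_pos hp hq hy).ne'
  have hP0 : √(p : ℝ) ≠ 0 := by positivity
  have hQ0 : √(q : ℝ) ≠ 0 := by positivity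
  rw [norm_meanCurvatureField_leaf_sq hp hq hy, meanCurvatureField_leaf hp hq,
    real_inner_smul_right, leaf, inner_frame]
  have h1 : (starRingEnd ℂ ((y.1 / √p : ℝ) : ℂ) * ((√p * y.1 : ℝ) : ℂ)).re = y.1 ^ 2 := by
    rw [Complex.conj_ofReal, ← Complex.ofReal_mul, Complex.ofReal_re]; field_simp
  have h2 : (starRingEnd ℂ (Complex.I * (y.2 / √q : ℝ)) *
      -(Complex.I * ((√q * y.2 : ℝ) : ℂ))).re = -y.2 ^ 2 := by
    simp; field_simp
  rw [h1, h2]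
  field_simp; ring

lemma planeDiv_smul (hφ : ContDiff ℝ 1 φ) (z : C2 × (C2 →L[ℝ] C2)) :
    planeDiv (fun x => φ x • x) z = φ z.1 * traceCLM z.2 + fderiv ℝ φ z.1 (z.2 z.1) := by
  have h1 : HasFDerivAt φ (fderiv ℝ φ z.1) z.1 :=
    (hφ.differentiable (by simp)).differentiableAt.hasFDerivAt
  have h2 : fderiv ℝ (fun x => φ x • x) z.1 =
      φ z.1 • ContinuousLinearMap.id ℝ C2 + (fderiv ℝ φ z.1).smulRight z.1 :=
    (h1.smul (hasFDerivAt_id (𝕜 := ℝ) z.1)).fderiv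
  rw [planeDiv, h2, ContinuousLinearMap.comp_add, map_add, ContinuousLinearMap.comp_smul,
    ContinuousLinearMap.comp_id, map_smul, smul_eq_mul]
  congr 1
  rw [traceCLM_apply]
  have : ((z.2 ∘L (fderiv ℝ φ z.1).smulRight z.1 : C2 →L[ℝ] C2) : C2 →ₗ[ℝ] C2) =
      LinearMap.smulRight ((fderiv ℝ φ z.1 : C2 →L[ℝ] ℝ) : C2 →ₗ[ℝ] ℝ) (z.2 z.1) := by
    ext v; simp
  rw [this, LinearMap.trace_smulRight]; rfl

/-- The integrand of Brakke's inequality. -/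
def dissipation (p q : ℕ) (φ : C2 → ℝ) (x : C2) : ℝ :=
  fderiv ℝ φ x (meanCurvatureField p q x) - φ x * ‖meanCurvatureField p q x‖ ^ 2

include hp hq in
-- The key identity. For a plane $P$ one has $\mathrm{div}_P(\varphi x)=2\varphi+D\varphi(Px)$, so
-- the dilation field is this divergence plus $D\varphi(x^\perp)$, where
-- $x^\perp=\frac{\tau}{q-p}h$. Adding and subtracting $\varphi\langle
-- x,h\rangle=\frac{\tau}{q-p}\varphi|h|^2$ produces the defect, whose integral is zero, and the
-- dissipation.
lemma dilationField_leaf (hφ : ContDiff ℝ 1 φ) {y : ℝ × ℝ} (hy : y ≠ 0) (θ : ℝ) (hne : p ≠ q) :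
    dilationField φ (leaf p q y θ) =
      firstVariationDefect p q (fun x => φ x • x) (leafPlane p q y θ) +
      (y.1 ^ 2 - y.2 ^ 2) / ((q : ℝ) - p) * dissipation p q φ (leaf p q y θ) := by
  have hqp : (q : ℝ) - p ≠ 0 := sub_ne_zero.2 (by exact_mod_cast hne.symm)
  have h1 := congrArg (fderiv ℝ φ (leaf p q y θ)) (leaf_sub_planeProj hp hq hy θ)
  rw [map_smul, map_smul, map_sub, smul_eq_mul, smul_eq_mul] at h1
  have h2 := inner_leaf_meanCurvatureField hp hq hy θ
  have h3 := (isPlaneProj_planeProj hp hq hy θ).2.2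
  have h4 : planeDiv (fun x => φ x • x) (leafPlane p q y θ) = φ (leaf p q y θ) *
      traceCLM (planeProj p q y θ) + fderiv ℝ φ (leaf p q y θ) (planeProj p q y θ (leaf p q y θ)) :=
    planeDiv_smul hφ _
  have h5 : firstVariationDefect p q (fun x => φ x • x) (leafPlane p q y θ) =
      planeDiv (fun x => φ x • x) (leafPlane p q y θ) +
      inner ℝ (φ (leaf p q y θ) • leaf p q y θ) (meanCurvatureField p q (leaf p q y θ)) := rfl
  rw [h5, h4, h3, real_inner_smul_left, dilationField, dissipation]
  field_simp
  linear_combination h1 - φ (leaf p q y θ) * h2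

/-! ### Integrability of `φ |h|²` -/

lemma measurable_mul_norm_sq (hφ : Continuous φ) :
    Measurable fun x => φ x * ‖meanCurvatureField p q x‖ ^ 2 :=
  hφ.measurable.mul ((measurable_meanCurvatureField p q).norm.pow_const 2)

lemma sq_norm_mul_sq_norm_le (hp : 0 < p) (hq : 0 < q) (x : C2) :
    ‖x‖ ^ 2 * ‖meanCurvatureField p q x‖ ^ 2 ≤ ((q : ℝ) - p) ^ 2 := by
  rw [← mul_pow, ← sq_abs ((q : ℝ) - p)]
  exact pow_le_pow_left₀ (by positivity) (norm_mul_norm_meanCurvatureField_le hp hq x) 2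

include hp hq in
-- A leaf with $\tau\neq0$ stays away from the origin, so the factor $|h|^2=O(|z|^{-2})$ is bounded
-- on it.
lemma integrable_mul_norm_sq_of_ne_zero (hφ : Continuous φ) (hc : HasCompactSupport φ) {τ : ℝ}
    (hτ : τ ≠ 0) :
    Integrable (fun z => φ z.1 * ‖meanCurvatureField p q z.1‖ ^ 2) (leafMeasure p q τ) := by
  obtain ⟨C, R, hC, h1, h2⟩ := exists_bound_of_hasCompactSupport hφ hc
  -- This radius comes from $|\tau|\le y_1^2+y_2^2\le(p+q)|z|^2$.
  set δ := √(|τ| / (p + q)) with hδ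
  have hpq : (0 : ℝ) < p + q := by positivity
  have hδ0 : 0 < δ := Real.sqrt_pos.2 (div_pos (abs_pos.2 hτ) hpq)
  set S : Set (C2 × (C2 →L[ℝ] C2)) := {z | δ ≤ ‖z.1‖} with hS
  have hSm : MeasurableSet S := (isClosed_le continuous_const (by fun_prop)).measurableSet
  have hm : Measurable fun z : C2 × (C2 →L[ℝ] C2) => φ z.1 * ‖meanCurvatureField p q z.1‖ ^ 2 :=
    (measurable_mul_norm_sq hφ).comp measurable_fst
  have hG : MildlySingular p q
      (S.indicator fun z => φ z.1 * ‖meanCurvatureField p q z.1‖ ^ 2) := by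
    refine mildlySingular_of_bound hp hq (hm.indicator hSm).stronglyMeasurable
      (C := C * ((q : ℝ) - p) ^ 2 / δ) (R := R) (fun z _ => ?_) (fun z hz => ?_)
    · by_cases hz : z ∈ S
      · rw [Set.indicator_of_mem hz, le_div_iff₀ hδ0, norm_mul, norm_pow, norm_norm]
        calc ‖z.1‖ * (‖φ z.1‖ * ‖meanCurvatureField p q z.1‖ ^ 2) * δ
            ≤ ‖z.1‖ * (‖φ z.1‖ * ‖meanCurvatureField p q z.1‖ ^ 2) * ‖z.1‖ :=
              mul_le_mul_of_nonneg_left hz (by positivity)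
          _ = ‖φ z.1‖ * (‖z.1‖ ^ 2 * ‖meanCurvatureField p q z.1‖ ^ 2) := by ring
          _ ≤ C * ((q : ℝ) - p) ^ 2 :=
              mul_le_mul (h1 _) (sq_norm_mul_sq_norm_le hp hq z.1) (by positivity) hC
      · rw [Set.indicator_of_notMem hz, norm_zero, mul_zero]; positivity
    · rw [Set.indicator_apply_eq_zero]
      intro _
      rw [h2 _ hz, zero_mul]
  have hae : ∀ᵐ z ∂leafMeasure p q τ, z ∈ S := by
    refine ae_leafMeasure hSm fun y θ hy hyτ => ?_
    have h3 := sq_add_sq_le_norm_leaf hp hq y θ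
    have h4 : |τ| ≤ y.1 ^ 2 + y.2 ^ 2 := by
      rw [← hyτ, abs_le]
      constructor <;> linarith [sq_nonneg y.1, sq_nonneg y.2]
    change δ ≤ ‖leaf p q y θ‖
    refine Real.sqrt_le_iff.2 ⟨norm_nonneg _, ?_⟩
    rw [div_le_iff₀ hpq]
    linarith
  refine (hG.integrable hp hq τ).congr ?_
  filter_upwards [hae] with z hz using Set.indicator_of_mem hz _

include hp hq in
-- A $C^1$ function of compact support is Lipschitz. With $\varphi(0)=0$ this gains a factor $|z|$
-- against $|h|^2=O(|z|^{-2})$.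
lemma mildlySingular_mul_norm_sq (hφ : ContDiff ℝ 1 φ) (hc : HasCompactSupport φ) (h0 : φ 0 = 0) :
    MildlySingular p q fun z => φ z.1 * ‖meanCurvatureField p q z.1‖ ^ 2 := by
  obtain ⟨L, hL⟩ := hφ.lipschitzWith_of_hasCompactSupport hc (by simp)
  obtain ⟨C, R, hC, h1, h2⟩ := exists_bound_of_hasCompactSupport hφ.continuous hc
  refine mildlySingular_of_bound hp hq (C := L * ((q : ℝ) - p) ^ 2) (R := R)
    ((measurable_mul_norm_sq hφ.continuous).comp measurable_fst).stronglyMeasurable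
    (fun z _ => ?_) (fun z hz => ?_)
  · have h3 : ‖φ z.1‖ ≤ L * ‖z.1‖ := by
      simpa [h0] using hL.norm_sub_le z.1 0
    rw [norm_mul, norm_pow, norm_norm]
    calc ‖z.1‖ * (‖φ z.1‖ * ‖meanCurvatureField p q z.1‖ ^ 2)
        ≤ ‖z.1‖ * (L * ‖z.1‖ * ‖meanCurvatureField p q z.1‖ ^ 2) := by gcongr
      _ = L * (‖z.1‖ ^ 2 * ‖meanCurvatureField p q z.1‖ ^ 2) := by ring
      _ ≤ _ := mul_le_mul_of_nonneg_left (sq_norm_mul_sq_norm_le hp hq z.1) L.coe_nonneg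
  · rw [h2 _ hz, zero_mul]

include hp hq in
lemma mildlySingular_fderiv (hφ : ContDiff ℝ 1 φ) (hc : HasCompactSupport φ) :
    MildlySingular p q fun z => fderiv ℝ φ z.1 (meanCurvatureField p q z.1) :=
  mildlySingular_apply_meanCurvatureField hp hq (hφ.continuous_fderiv (by simp))
    (hc.fderiv (𝕜 := ℝ))

include hp hq in
lemma integral_dilationField (hφ : ContDiff ℝ 1 φ) (hc : HasCompactSupport φ) (hne : p ≠ q) {τ : ℝ}
    (hτ : τ ≠ 0) : ∫ z, dilationField φ z.1 ∂leafMeasure p q τ =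
      τ / ((q : ℝ) - p) * ∫ z, dissipation p q φ z.1 ∂leafMeasure p q τ := by
  have hX : ContDiff ℝ 1 fun x : C2 => φ x • x := hφ.smul contDiff_id
  have hXc : HasCompactSupport fun x : C2 => φ x • x := hc.smul_right
  have hdm : Measurable (dissipation p q φ) :=
    ((by fun_prop : Continuous fun u : (C2 →L[ℝ] ℝ) × C2 => u.1 u.2).measurable.comp
      ((hφ.continuous_fderiv (by simp)).measurable.prodMk (measurable_meanCurvatureField p q))).sub
      (measurable_mul_norm_sq hφ.continuous)
  have hdef := mildlySingular_firstVariationDefect hp hq hX hXc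
  have hdi : Integrable (fun z => dissipation p q φ z.1) (leafMeasure p q τ) :=
    ((mildlySingular_fderiv hp hq hφ hc).integrable hp hq τ).sub
      (integrable_mul_norm_sq_of_ne_zero hp hq hφ.continuous hc hτ)
  have hae : ∀ᵐ z ∂leafMeasure p q τ, dilationField φ z.1 =
      firstVariationDefect p q (fun x => φ x • x) z +
      τ / ((q : ℝ) - p) * dissipation p q φ z.1 := by
    refine ae_leafMeasure (S := {z | dilationField φ z.1 =
      firstVariationDefect p q (fun x => φ x • x) z +
      τ / ((q : ℝ) - p) * dissipation p q φ z.1}) (measurableSet_eq_fun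
        ((continuous_dilationField hφ).measurable.comp measurable_fst)
        (hdef.stronglyMeasurable.measurable.add ((hdm.comp measurable_fst).const_mul _))) ?_
    rintro y θ hy rfl
    exact dilationField_leaf hp hq hφ hy θ hne
  rw [integral_congr_ae hae, integral_add (hdef.integrable hp hq τ) (hdi.const_mul _),
    integral_firstVariationDefect hp hq hX hXc, zero_add, integral_const_mul]

include hp hq in
-- The speed $2(q-p)$ of $\tau$ in $t$ cancels the factors $\frac1{2\tau}$ and $\frac{\tau}{q-p}$.
lemma hasDerivAt_integral_leafMeasure_time (hφ : ContDiff ℝ 1 φ) (hc : HasCompactSupport φ)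
    (hne : p ≠ q) {t : ℝ} (ht : t ≠ 0) :
    HasDerivAt (fun t => ∫ z, φ z.1 ∂leafMeasure p q (2 * t * (q - p)))
      (∫ z, dissipation p q φ z.1 ∂leafMeasure p q (2 * t * (q - p))) t := by
  have hqp : (q : ℝ) - p ≠ 0 := sub_ne_zero.2 (by exact_mod_cast hne.symm)
  have hτ : 2 * t * (q - p) ≠ 0 := mul_ne_zero (mul_ne_zero two_ne_zero ht) hqp
  have h1 := hasDerivAt_integral_leafMeasure hp hq hφ hc hτ
  have h2 : HasDerivAt (fun t : ℝ => 2 * t * ((q : ℝ) - p)) (2 * (q - p)) t := by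
    simpa using ((hasDerivAt_id t).const_mul 2).mul_const ((q : ℝ) - p)
  refine (h1.comp t h2).congr_deriv ?_
  rw [integral_dilationField hp hq hφ hc hne hτ]
  field_simp

end Dissipation

/-! ### Divergence of `∫ φ |h|²` at the cone -/

section Divergence

variable {p q : ℕ} (hp : 0 < p) (hq : 0 < q) {φ : C2 → ℝ}

include hp hq in
lemma norm_leaf_arm_le {τ s₁ s₂ r : ℝ} (h₁ : IsSign s₁) (h₂ : IsSign s₂) (hr : √|τ| < r) (θ : ℝ) :
    ‖leaf p q (arm τ s₁ s₂ r) θ‖ ≤ r := by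
  have h1 := arm_sq_add_sq (τ := τ) (r := r) h₁ h₂
  have h2 := sq_div_le hr
  have hp1 : (1 : ℝ) ≤ p := by exact_mod_cast hp
  have hq1 : (1 : ℝ) ≤ q := by exact_mod_cast hq
  refine le_of_sq_le_sq ?_ (pos_of_sqrt_lt hr).le
  rw [norm_leaf_sq]
  have h3 := div_le_self (sq_nonneg (arm τ s₁ s₂ r).1) hp1
  have h4 := div_le_self (sq_nonneg (arm τ s₁ s₂ r).2) hq1
  linarith

include hp hq in
-- The source of the logarithm: `sqLen` occurs in the area density and inversely in $|h|^2$, and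
-- what remains is exactly a constant over $r$.
lemma armDensity_mul_norm_sq {τ r : ℝ} (hr : √|τ| < r) (θ : ℝ) :
    armDensity p q τ r * ‖meanCurvatureField p q (leaf p q (arm τ 1 1 r) θ)‖ ^ 2 =
      ((q : ℝ) - p) ^ 2 / √(p * q : ℝ) / r := by
  have hy := arm_ne_zero isSign_one isSign_one hr
  have hD := (sqLen_pos hp hq hy).ne'
  have h0 := (pos_of_sqrt_lt hr).ne'
  have hr : √(p * q : ℝ) ≠ 0 := by positivity
  rw [norm_meanCurvatureField_leaf_sq hp hq hy, armDensity]
  field_simp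

lemma lintegral_Ioo_inv {a b : ℝ} (ha : 0 < a) (hab : a ≤ b) {c : ℝ} (hc : 0 ≤ c) :
    ∫⁻ r in Set.Ioo a b, ENNReal.ofReal (c / r) = ENNReal.ofReal (c * Real.log (b / a)) := by
  have h1 : ContinuousOn (fun r : ℝ => c / r) (Set.Icc a b) :=
    continuousOn_const.div continuousOn_id fun r hr => (ha.trans_le hr.1).ne'
  rw [← ofReal_integral_eq_lintegral_ofReal (h1.integrableOn_Icc.mono_set Set.Ioo_subset_Icc_self)
    ((ae_restrict_mem measurableSet_Ioo).mono fun r hr => div_nonneg hc (ha.trans hr.1).le),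
    ← integral_Ioc_eq_integral_Ioo, ← intervalIntegral.integral_of_le hab]
  simp only [div_eq_mul_inv c, intervalIntegral.integral_const_mul]
  rw [integral_inv_of_pos ha (ha.trans_le hab)]

include hp hq in
-- Near the origin $\varphi\ge\varphi(0)/2$, and a single arm over $a<r<\delta$ already contributes
-- a multiple of $\int_a^\delta dr/r$. The constants do not depend on $\tau$, so the estimate yields
-- both the divergence on the cone and the blow-up along the leaves.
lemma exists_log_le_lintegral (hne : p ≠ q) (hφ : Continuous φ) (h0 : 0 < φ 0) :
    ∃ c δ : ℝ, 0 < c ∧ 0 < δ ∧ ∀ τ a : ℝ, √|τ| ≤ a → 0 < a → a ≤ δ →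
      ENNReal.ofReal (c * Real.log (δ / a)) ≤
        ∫⁻ z, ENNReal.ofReal (φ z.1 * ‖meanCurvatureField p q z.1‖ ^ 2) ∂leafMeasure p q τ := by
  have hqp : (q : ℝ) - p ≠ 0 := sub_ne_zero.2 (by exact_mod_cast hne.symm)
  obtain ⟨δ, hδ, hφδ⟩ := Metric.eventually_nhds_iff.1
    (hφ.continuousAt.eventually (lt_mem_nhds (half_lt_self h0)))
  set m := φ 0 / 2 * (((q : ℝ) - p) ^ 2 / √(p * q : ℝ)) with hm
  have hm0 : 0 < m := by positivity
  -- The length $2\pi$ of the angular interval times the factor $1/2$ of the leaf measure.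
  refine ⟨Real.pi * m, δ, by positivity, hδ, fun τ a ha ha0 haδ => ?_⟩
  set g : C2 × (C2 →L[ℝ] C2) → ENNReal :=
    fun z => ENNReal.ofReal (φ z.1 * ‖meanCurvatureField p q z.1‖ ^ 2) with hg
  have hgm : Measurable g := ((measurable_mul_norm_sq hφ).comp measurable_fst).ennreal_ofReal
  have hle : (2⁻¹ : ENNReal) * ∫⁻ z, g z ∂sweep p q (Set.Ioi √|τ|) (arm τ 1 1) (armDensity p q τ) ≤
      ∫⁻ z, g z ∂leafMeasure p q τ := by
    rw [leafMeasure, lintegral_smul_measure, lintegral_add_measure, lintegral_add_measure,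
      smul_eq_mul]
    gcongr
    rw [add_assoc]
    exact le_self_add
  refine le_trans ?_ hle
  rw [lintegral_sweep (measurable_arm _ _ _) (measurable_armDensity _ _ _) hgm]
  have hin (θ : ℝ) : ENNReal.ofReal (m * Real.log (δ / a)) ≤ ∫⁻ r in Set.Ioi √|τ|,
      ENNReal.ofReal (armDensity p q τ r) * g (leafPlane p q (arm τ 1 1 r) θ) := by
    rw [← lintegral_Ioo_inv ha0 haδ hm0.le]
    refine le_trans (setLIntegral_mono' measurableSet_Ioo fun r hr => ?_)
      (lintegral_mono_set (fun r hr => ha.trans_lt hr.1))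
    have hr' : √|τ| < r := ha.trans_lt hr.1
    have hr0 : 0 < r := ha0.trans hr.1
    rw [← ENNReal.ofReal_mul (armDensity_nonneg hr0.le)]
    refine ENNReal.ofReal_le_ofReal ?_
    have h1 := armDensity_mul_norm_sq hp hq hr' θ
    have h2 : φ 0 / 2 ≤ φ (leaf p q (arm τ 1 1 r) θ) := by
      refine (hφδ ?_).le
      rw [dist_zero_right]
      exact (norm_leaf_arm_le hp hq isSign_one isSign_one hr' θ).trans_lt hr.2
    calc m / r = φ 0 / 2 * (((q : ℝ) - p) ^ 2 / √(p * q : ℝ) / r) := by rw [hm]; ring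
      _ ≤ φ (leaf p q (arm τ 1 1 r) θ) * (((q : ℝ) - p) ^ 2 / √(p * q : ℝ) / r) := by gcongr
      _ = armDensity p q τ r * (φ (leaf p q (arm τ 1 1 r) θ) *
          ‖meanCurvatureField p q (leaf p q (arm τ 1 1 r) θ)‖ ^ 2) := by rw [← h1]; ring
  have hout : ENNReal.ofReal (m * Real.log (δ / a)) * ENNReal.ofReal (2 * Real.pi) ≤
      ∫⁻ θ in Set.Ioo 0 (2 * Real.pi), ∫⁻ r in Set.Ioi √|τ|,
        ENNReal.ofReal (armDensity p q τ r) * g (leafPlane p q (arm τ 1 1 r) θ) := by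
    refine le_trans (le_of_eq ?_) (lintegral_mono fun θ => hin θ)
    rw [lintegral_const, Measure.restrict_apply_univ, Real.volume_Ioo, sub_zero]
  refine le_trans (le_of_eq ?_) (mul_le_mul_right hout _)
  have hlog : 0 ≤ m * Real.log (δ / a) :=
    mul_nonneg hm0.le (Real.log_nonneg ((one_le_div ha0).2 haδ))
  rw [← ENNReal.ofReal_mul hlog, show (2⁻¹ : ENNReal) = ENNReal.ofReal 2⁻¹ by
    rw [ENNReal.ofReal_inv_of_pos two_pos]; simp, ← ENNReal.ofReal_mul (by norm_num)]
  congr 1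
  ring

include hp hq in
lemma not_integrable_mul_norm_sq (hne : p ≠ q) (hφ : Continuous φ) (h0 : 0 < φ 0) :
    ¬ Integrable (fun z => φ z.1 * ‖meanCurvatureField p q z.1‖ ^ 2) (leafMeasure p q 0) := by
  intro hint
  obtain ⟨c, δ, hc, hδ, h⟩ := exists_log_le_lintegral hp hq hne hφ h0
  have hfin := hint.lintegral_lt_top
  set I := ∫⁻ z, ENNReal.ofReal (φ z.1 * ‖meanCurvatureField p q z.1‖ ^ 2) ∂leafMeasure p q 0
  -- The radius $a$ is chosen so that $c\log(\delta/a)$ exceeds the supposedly finite integral by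
  -- one.
  have h1 := h 0 (δ * Real.exp (-((I.toReal + 1) / c))) (by simp; positivity) (by positivity)
    (mul_le_of_le_one_right hδ.le (Real.exp_le_one_iff.2 (by
      have := I.toReal_nonneg
      rw [neg_nonpos]; positivity)))
  rw [div_mul_cancel_left₀ hδ.ne', Real.exp_neg, inv_inv, Real.log_exp,
    mul_div_cancel₀ _ hc.ne'] at h1
  have h2 := (ENNReal.ofReal_le_iff_le_toReal hfin.ne).1 h1
  linarith

include hp hq in
lemma tendsto_integral_mul_norm_sq_atTop (hne : p ≠ q) (hφ : Continuous φ)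
    (hc : HasCompactSupport φ) (hφ0 : ∀ x, 0 ≤ φ x) (h0 : 0 < φ 0) :
    Tendsto (fun τ => ∫ z, φ z.1 * ‖meanCurvatureField p q z.1‖ ^ 2 ∂leafMeasure p q τ) (𝓝[≠] 0)
      atTop := by
  obtain ⟨c, δ, hc0, hδ, h⟩ := exists_log_le_lintegral hp hq hne hφ h0
  have hs : Tendsto (fun τ : ℝ => √|τ|) (𝓝 0) (𝓝 0) := by
    have : Continuous fun τ : ℝ => √|τ| := by fun_prop
    simpa using this.tendsto 0
  have hs' : Tendsto (fun τ : ℝ => √|τ|) (𝓝[≠] 0) (𝓝[>] 0) := by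
    refine tendsto_nhdsWithin_iff.2 ⟨hs.mono_left nhdsWithin_le_nhds, ?_⟩
    filter_upwards [self_mem_nhdsWithin] with τ hτ
    exact Real.sqrt_pos.2 (abs_pos.2 hτ)
  have hlim : Tendsto (fun τ : ℝ => c * Real.log (δ / √|τ|)) (𝓝[≠] 0) atTop := by
    refine Tendsto.const_mul_atTop hc0 (Real.tendsto_log_atTop.comp ?_)
    simp only [div_eq_mul_inv]
    exact (tendsto_inv_nhdsGT_zero.comp hs').const_mul_atTop hδ
  refine tendsto_atTop_mono' _ ?_ hlim
  filter_upwards [self_mem_nhdsWithin,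
    (hs.mono_left nhdsWithin_le_nhds).eventually (gt_mem_nhds hδ)] with τ hτ hτδ
  have hpos : 0 < √|τ| := Real.sqrt_pos.2 (abs_pos.2 hτ)
  have h1 := h τ √|τ| le_rfl hpos hτδ.le
  have hint := integrable_mul_norm_sq_of_ne_zero hp hq hφ hc hτ
  rw [← ofReal_integral_eq_lintegral_ofReal hint
    (Eventually.of_forall fun z => mul_nonneg (hφ0 _) (by positivity))] at h1
  exact (ENNReal.ofReal_le_ofReal_iff (integral_nonneg fun z =>
    mul_nonneg (hφ0 _) (by positivity))).1 h1

end Divergence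

/-! ### The Brakke motion -/

section Motion

variable {p q : ℕ} (hp : 0 < p) (hq : 0 < q) {φ : C2 → ℝ}

/-- The Brakke motion through the leaves `y₁² - y₂² = 2 t (q - p)`. -/
def motion (t : ℝ) : Varifold := leafVarifold hp hq (2 * t * (q - p))

lemma toMeasure_motion (t : ℝ) :
    (motion hp hq t).toMeasure = leafMeasure p q (2 * t * (q - p)) := rfl

lemma mass_motion (hφ : Continuous φ) (t : ℝ) :
    (motion hp hq t).mass φ = ∫ z, φ z.1 ∂leafMeasure p q (2 * t * (q - p)) :=
  integral_weight hp hq _ hφ.measurable.stronglyMeasurable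

lemma tendsto_time (p q : ℕ) : Tendsto (fun t : ℝ => 2 * t * ((q : ℝ) - p)) (𝓝 0) (𝓝 0) := by
  have : Continuous fun t : ℝ => 2 * t * ((q : ℝ) - p) := by fun_prop
  simpa using this.tendsto 0

lemma MildlySingular.tendsto_motion {E : Type*} [NormedAddCommGroup E] [NormedSpace ℝ E]
    {G : C2 × (C2 →L[ℝ] C2) → E} (hG : MildlySingular p q G)
    (hc : ∀ z : C2 × (C2 →L[ℝ] C2), z.1 ≠ 0 → ContinuousAt G z) :
    Tendsto (fun t => ∫ z, G z ∂(motion hp hq t).toMeasure) (𝓝 0)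
      (𝓝 (∫ z, G z ∂(motion hp hq 0).toMeasure)) := by
  simp only [toMeasure_motion, mul_zero, zero_mul]
  exact (hG.tendsto_leafMeasure hp hq hc).comp (tendsto_time p q)

lemma continuousAt_comp_fst {g : C2 → ℝ} (hg : Continuous g) (z : C2 × (C2 →L[ℝ] C2)) :
    ContinuousAt (fun z : C2 × (C2 →L[ℝ] C2) => g z.1) z :=
  (hg.comp continuous_fst).continuousAt

lemma varifoldTendsto_motion : VarifoldTendsto (motion hp hq) (𝓝 0) (motion hp hq 0) := by
  intro f hf hc
  refine MildlySingular.tendsto_motion hp hq ?_ fun z _ => hf.continuousAt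
  obtain ⟨C, hC⟩ := hc.exists_bound_of_continuous hf
  obtain ⟨R, hR⟩ := hc.isBounded.subset_closedBall (0 : C2 × (C2 →L[ℝ] C2))
  refine mildlySingular_of_bounded hp hq hf.measurable.stronglyMeasurable
    ((norm_nonneg _).trans (hC 0)) (fun z _ => hC z) (R := R) fun z hz => ?_
  refine image_eq_zero_of_notMem_tsupport fun h => hz.not_ge ?_
  exact (norm_fst_le z).trans (mem_closedBall_zero_iff.1 (hR h))

lemma hasDerivAt_mass_motion (hφ : ContDiff ℝ 1 φ) (hc : HasCompactSupport φ) (hne : p ≠ q) {t : ℝ}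
    (ht : t ≠ 0) : HasDerivAt (fun t => (motion hp hq t).mass φ)
      (∫ z, dissipation p q φ z.1 ∂(motion hp hq t).toMeasure) t := by
  simp only [mass_motion hp hq hφ.continuous]
  exact hasDerivAt_integral_leafMeasure_time hp hq hφ hc hne ht

lemma tendsto_mass_motion (hφ : Continuous φ) (hc : HasCompactSupport φ) :
    Tendsto (fun t => (motion hp hq t).mass φ) (𝓝 0) (𝓝 ((motion hp hq 0).mass φ)) := by
  simp only [mass_motion hp hq hφ]
  exact (mildlySingular_comp_fst hp hq hφ hc).tendsto_motion hp hq
    fun z _ => continuousAt_comp_fst hφ z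

lemma continuous_mass_motion (hφ : ContDiff ℝ 1 φ) (hc : HasCompactSupport φ) (hne : p ≠ q) :
    Continuous fun t => (motion hp hq t).mass φ := by
  rw [continuous_iff_continuousAt]
  intro t
  rcases eq_or_ne t 0 with rfl | ht
  · exact tendsto_mass_motion hp hq hφ.continuous hc
  · exact (hasDerivAt_mass_motion hp hq hφ hc hne ht).continuousAt

/-! ### Equality in Brakke's inequality at regular and singular times. -/

lemma measurable_fderiv_meanCurvatureField (hφ : ContDiff ℝ 1 φ) :
    Measurable fun x => fderiv ℝ φ x (meanCurvatureField p q x) :=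
  (by fun_prop : Continuous fun u : (C2 →L[ℝ] ℝ) × C2 => u.1 u.2).measurable.comp
    ((hφ.continuous_fderiv (by simp)).measurable.prodMk (measurable_meanCurvatureField p q))

lemma integral_dissipation (hφ : ContDiff ℝ 1 φ) (hc : HasCompactSupport φ) {t : ℝ}
    (hint : Integrable (fun z => φ z.1 * ‖meanCurvatureField p q z.1‖ ^ 2)
      (motion hp hq t).toMeasure) :
    ∫ z, dissipation p q φ z.1 ∂(motion hp hq t).toMeasure =
      ∫ z, fderiv ℝ φ z.1 (meanCurvatureField p q z.1) ∂(motion hp hq t).toMeasure -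
        ∫ z, φ z.1 * ‖meanCurvatureField p q z.1‖ ^ 2 ∂(motion hp hq t).toMeasure :=
  integral_sub ((mildlySingular_fderiv hp hq hφ hc).integrable hp hq _) hint

lemma brakkeTerm_motion_of_integrable (hφ : ContDiff ℝ 1 φ) (hc : HasCompactSupport φ) {t : ℝ}
    (hint : Integrable (fun z => φ z.1 * ‖meanCurvatureField p q z.1‖ ^ 2)
      (motion hp hq t).toMeasure) :
    (motion hp hq t).brakkeTerm φ (meanCurvatureField p q) =
      ((∫ z, dissipation p q φ z.1 ∂(motion hp hq t).toMeasure : ℝ) : EReal) := by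
  have hm := (measurable_mul_norm_sq (p := p) (q := q) hφ.continuous).stronglyMeasurable
  have hw : Integrable (fun x => φ x * ‖meanCurvatureField p q x‖ ^ 2) (motion hp hq t).weight :=
    (integrable_weight_iff hp hq _ hm).2 hint
  rw [Varifold.brakkeTerm, if_pos hw, integral_dissipation hp hq hφ hc hint, neg_add_eq_sub]
  congr 2
  · exact integral_weight hp hq _ (measurable_fderiv_meanCurvatureField hφ).stronglyMeasurable
  · exact integral_weight hp hq _ hm

lemma brakkeTerm_motion_of_not_integrable (hφ : Continuous φ) {t : ℝ}
    (hint : ¬ Integrable (fun z => φ z.1 * ‖meanCurvatureField p q z.1‖ ^ 2)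
      (motion hp hq t).toMeasure) :
    (motion hp hq t).brakkeTerm φ (meanCurvatureField p q) = ⊥ := by
  have hm := (measurable_mul_norm_sq (p := p) (q := q) hφ).stronglyMeasurable
  exact if_neg fun h => hint ((integrable_weight_iff hp hq _ hm).1 h)

lemma two_mul_mul_sub_ne_zero (hne : p ≠ q) {t : ℝ} (ht : t ≠ 0) :
    2 * t * ((q : ℝ) - p) ≠ 0 :=
  mul_ne_zero (mul_ne_zero two_ne_zero ht) (sub_ne_zero.2 (by exact_mod_cast hne.symm))

lemma tendsto_diffQuot_of_ne_zero (hφ : ContDiff ℝ 1 φ) (hc : HasCompactSupport φ) (hne : p ≠ q)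
    {t : ℝ} (ht : t ≠ 0) : Tendsto (diffQuot (motion hp hq) φ t) (𝓝[≠] t)
      (𝓝 ((motion hp hq t).brakkeTerm φ (meanCurvatureField p q))) := by
  have hint := integrable_mul_norm_sq_of_ne_zero hp hq hφ.continuous hc
    (two_mul_mul_sub_ne_zero hne ht)
  rw [brakkeTerm_motion_of_integrable hp hq hφ hc hint]
  have h1 := hasDerivAt_iff_tendsto_slope.1 (hasDerivAt_mass_motion hp hq hφ hc hne ht)
  refine (continuous_coe_real_ereal.tendsto _).comp (h1.congr fun s => ?_)
  rw [slope_def_field]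

/-- L'Hôpital's rule for the difference quotient of the mass at the singular time. -/
lemma tendsto_quot_of_tendsto_dissipation (hφ : ContDiff ℝ 1 φ) (hc : HasCompactSupport φ)
    (hne : p ≠ q) {l : Filter ℝ}
    (h : Tendsto (fun t => ∫ z, dissipation p q φ z.1 ∂(motion hp hq t).toMeasure) (𝓝[≠] 0) l) :
    Tendsto (fun s => ((motion hp hq s).mass φ - (motion hp hq 0).mass φ) / (s - 0))
      (𝓝[≠] 0) l := by
  -- The filter `l` is arbitrary, so the same argument covers a finite limit and the limit
  -- $-\infty$.
  refine HasDerivAt.lhopital_zero_nhdsNE (g' := fun _ => 1)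
    (f' := fun t => ∫ z, dissipation p q φ z.1 ∂(motion hp hq t).toMeasure) ?_ ?_ ?_ ?_ ?_ ?_
  · filter_upwards [self_mem_nhdsWithin] with t ht
    exact (hasDerivAt_mass_motion hp hq hφ hc hne ht).sub_const _
  · exact Eventually.of_forall fun t => (hasDerivAt_id t).sub_const 0
  · exact Eventually.of_forall fun _ => one_ne_zero
  · have := (tendsto_mass_motion hp hq hφ.continuous hc).sub_const ((motion hp hq 0).mass φ)
    rw [sub_self] at this
    exact this.mono_left nhdsWithin_le_nhds
  · have : Tendsto (fun s : ℝ => s - 0) (𝓝 0) (𝓝 (0 - 0)) := tendsto_id.sub_const 0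
    rw [sub_self] at this
    exact this.mono_left nhdsWithin_le_nhds
  · simpa using h

lemma tendsto_integral_dissipation (hφ : ContDiff ℝ 1 φ) (hc : HasCompactSupport φ)
    (h0 : φ 0 = 0) : Tendsto (fun t => ∫ z, dissipation p q φ z.1 ∂(motion hp hq t).toMeasure)
      (𝓝 0) (𝓝 (∫ z, dissipation p q φ z.1 ∂(motion hp hq 0).toMeasure)) := by
  have hs := mildlySingular_mul_norm_sq hp hq hφ hc h0
  simp only [integral_dissipation hp hq hφ hc (hs.integrable hp hq _)]
  refine ((mildlySingular_fderiv hp hq hφ hc).tendsto_motion hp hq fun z hz => ?_).sub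
    (hs.tendsto_motion hp hq fun z hz => ?_)
  · exact continuousAt_apply_meanCurvatureField hp hq (hφ.continuous_fderiv (by simp)) hz
  · have h1 : ContinuousAt (fun x => φ x * ‖meanCurvatureField p q x‖ ^ 2) z.1 :=
      hφ.continuous.continuousAt.mul ((continuousAt_meanCurvatureField hp hq hz).norm.pow 2)
    exact ContinuousAt.comp (f := Prod.fst)
      (g := fun x => φ x * ‖meanCurvatureField p q x‖ ^ 2) h1 continuousAt_fst

lemma tendsto_integral_dissipation_atBot (hφ : IsTestFunction φ) (hne : p ≠ q) (h0 : 0 < φ 0) :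
    Tendsto (fun t => ∫ z, dissipation p q φ z.1 ∂(motion hp hq t).toMeasure) (𝓝[≠] 0) atBot := by
  have h1 := ((mildlySingular_fderiv hp hq hφ.contDiff hφ.compact).tendsto_motion hp hq fun z hz =>
    continuousAt_apply_meanCurvatureField hp hq (hφ.contDiff.continuous_fderiv (by simp)) hz
    ).mono_left (nhdsWithin_le_nhds (s := {0}ᶜ))
  have h2 : Tendsto (fun t : ℝ => 2 * t * ((q : ℝ) - p)) (𝓝[≠] 0) (𝓝[≠] 0) := by
    refine tendsto_nhdsWithin_iff.2 ⟨(tendsto_time p q).mono_left nhdsWithin_le_nhds, ?_⟩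
    filter_upwards [self_mem_nhdsWithin] with t ht using two_mul_mul_sub_ne_zero hne ht
  have h3 := (tendsto_integral_mul_norm_sq_atTop hp hq hne hφ.contDiff.continuous hφ.compact
    hφ.nonneg h0).comp h2
  refine (h1.add_atBot (tendsto_neg_atTop_atBot.comp h3)).congr' ?_
  filter_upwards [self_mem_nhdsWithin] with t ht
  rw [integral_dissipation hp hq hφ.contDiff hφ.compact (integrable_mul_norm_sq_of_ne_zero hp hq
    hφ.contDiff.continuous hφ.compact (two_mul_mul_sub_ne_zero hne ht)), sub_eq_add_neg]
  rfl

/-- The value $\varphi(0)$ decides: if it is zero, the dissipation is continuous up to the cone; if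
it is positive, the dissipation tends to $-\infty$, while the Brakke term of the cone is $-\infty$
by definition. -/
lemma tendsto_diffQuot_zero (hφ : IsTestFunction φ) (hne : p ≠ q) :
    Tendsto (diffQuot (motion hp hq) φ 0) (𝓝[≠] 0)
      (𝓝 ((motion hp hq 0).brakkeTerm φ (meanCurvatureField p q))) := by
  rcases (hφ.nonneg 0).eq_or_lt with h0 | h0
  · have hs := mildlySingular_mul_norm_sq hp hq hφ.contDiff hφ.compact h0.symm
    rw [brakkeTerm_motion_of_integrable hp hq hφ.contDiff hφ.compact (hs.integrable hp hq _)]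
    exact (continuous_coe_real_ereal.tendsto _).comp (tendsto_quot_of_tendsto_dissipation hp hq
      hφ.contDiff hφ.compact hne ((tendsto_integral_dissipation hp hq hφ.contDiff hφ.compact
        h0.symm).mono_left nhdsWithin_le_nhds))
  · have hnot := not_integrable_mul_norm_sq hp hq hne hφ.contDiff.continuous h0
    rw [brakkeTerm_motion_of_not_integrable hp hq hφ.contDiff.continuous
      (by rw [toMeasure_motion, mul_zero, zero_mul]; exact hnot)]
    exact EReal.tendsto_coe_nhds_bot_iff.2 (tendsto_quot_of_tendsto_dissipation hp hq
      hφ.contDiff hφ.compact hne (tendsto_integral_dissipation_atBot hp hq hφ hne h0))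

lemma tendsto_diffQuot (hφ : IsTestFunction φ) (hne : p ≠ q) (t : ℝ) :
    Tendsto (diffQuot (motion hp hq) φ t) (𝓝[≠] t)
      (𝓝 ((motion hp hq t).brakkeTerm φ (meanCurvatureField p q))) := by
  rcases eq_or_ne t 0 with rfl | ht
  · exact tendsto_diffQuot_zero hp hq hφ hne
  · exact tendsto_diffQuot_of_ne_zero hp hq hφ.contDiff hφ.compact hne ht

lemma hasNoMassLoss_motion (hne : p ≠ q) : HasNoMassLoss (motion hp hq) :=
  ⟨fun _ hφ => continuous_mass_motion hp hq hφ.contDiff hφ.compact hne, fun t =>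
    ⟨meanCurvatureField p q, isGenMeanCurvature_leafVarifold hp hq _,
      fun _ hφ => tendsto_diffQuot hp hq hφ hne t⟩⟩

lemma isBrakkeMotion_motion (hne : p ≠ q) : IsBrakkeMotion (motion hp hq) := fun t =>
  ⟨meanCurvatureField p q, isGenMeanCurvature_leafVarifold hp hq _,
    fun _ hφ => (tendsto_diffQuot hp hq hφ hne t).limsup_eq.le⟩

/-- For the times of one sign, `motion` moves by homotheties of a fixed surface. -/
lemma motion_eq_homothety (hne : p ≠ q) {ε : ℝ} (hε : IsSign ε) {t : ℝ} (ht : t ≠ 0)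
    (hpos : 0 < t / (ε / (2 * ((q : ℝ) - p)))) :
    IsHamiltonianStationary (surface hp hq hε)
        (fun x => √(t / (ε / (2 * ((q : ℝ) - p)))) • immersion hp hq hε x) ∧
      IsSelfSimilar (surface hp hq hε)
        (fun x => √(t / (ε / (2 * ((q : ℝ) - p)))) • immersion hp hq hε x) t ∧
      IsVarifoldOf (surface hp hq hε)
        (fun x => √(t / (ε / (2 * ((q : ℝ) - p)))) • immersion hp hq hε x) (motion hp hq t) := by
  have hqp : (q : ℝ) - p ≠ 0 := sub_ne_zero.2 (by exact_mod_cast hne.symm)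
  have hl : 0 < √(t / (ε / (2 * ((q : ℝ) - p)))) := Real.sqrt_pos.2 hpos
  have hsq : √(t / (ε / (2 * ((q : ℝ) - p)))) ^ 2 * ε = 2 * t * ((q : ℝ) - p) := by
    have := hε.ne_zero
    rw [Real.sq_sqrt hpos.le]
    field_simp
  refine ⟨isHamiltonianStationary_surface hp hq hε hl.ne',
    isSelfSimilar_surface hp hq hε hne hl.ne' hsq, isVarifoldOf_surface hp hq hε hl ?_⟩
  rw [toMeasure_motion, hsq]

/-- The self-similarity constant of the leaf $\tau=\varepsilon$ is $c=\varepsilon/(2(q-p))$. Taking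
$\varepsilon$ as the sign of $s(q-p)$ gives $c$ the sign $s$ of the times considered; dilation by
$\sqrt{t/c}$ then leads to $\tau=2t(q-p)$. -/
lemma exists_homothety (hne : p ≠ q) {s : ℝ} (hs : IsSign s) :
    ∃ (M : SmoothSurface) (F : M.carrier → C2) (c : ℝ), 0 < s * c ∧ ∀ t, 0 < s * t →
      IsHamiltonianStationary M (fun x => √(t / c) • F x) ∧
      IsSelfSimilar M (fun x => √(t / c) • F x) t ∧
      IsVarifoldOf M (fun x => √(t / c) • F x) (motion hp hq t) := by
  have hqp : (q : ℝ) - p ≠ 0 := sub_ne_zero.2 (by exact_mod_cast hne.symm)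
  obtain ⟨ε, hε, hεpos⟩ : ∃ ε : ℝ, IsSign ε ∧ 0 < s * (ε / (2 * ((q : ℝ) - p))) := by
    rcases hqp.lt_or_gt with h | h
    · refine ⟨-s, by simpa using isSign_neg_one.mul hs, ?_⟩
      have : s * (-s / (2 * ((q : ℝ) - p))) = s * s / (2 * (-(q - p))) := by field_simp
      rw [this, hs.mul_self]
      exact div_pos one_pos (by linarith)
    · refine ⟨s, hs, ?_⟩
      rw [← mul_div_assoc, hs.mul_self]; positivity
  refine ⟨surface hp hq hε, immersion hp hq hε, _, hεpos, fun t ht => ?_⟩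
  refine motion_eq_homothety hp hq hne hε (right_ne_zero_of_mul ht.ne') ?_
  have : t / (ε / (2 * ((q : ℝ) - p))) = (s * t) / (s * (ε / (2 * (q - p)))) := by
    rw [mul_div_mul_left _ _ hs.ne_zero]
  rw [this]
  exact div_pos ht hεpos

end Motion

/-! ### The cones meet only at the origin -/

lemma zero_mem_cone (γ : ℝ → C2) : (0 : C2) ∈ cone γ :=
  ⟨0, le_rfl, 0, ⟨le_rfl, Real.two_pi_pos⟩, (zero_smul ℝ _).symm⟩

lemma curve_zero_eq (p q : ℕ) (θ : ℝ) :
    curve p q θ 0 = (√((q : ℝ) / (p + q)) : ℂ) * Complex.exp (θ * Complex.I) ^ p := by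
  rw [← Complex.exp_nat_mul]
  simp only [curve, PiLp.toLp_apply, Matrix.cons_val_zero]
  congr 2; push_cast; ring

lemma norm_curve_zero (p q : ℕ) (θ : ℝ) : ‖curve p q θ 0‖ = √((q : ℝ) / (p + q)) := by
  rw [curve_zero_eq, norm_mul, norm_pow, Complex.norm_exp_ofReal_mul_I, one_pow, mul_one,
    Complex.norm_real, Real.norm_of_nonneg (Real.sqrt_nonneg _)]

lemma curve_one_eq (p q : ℕ) (θ : ℝ) : curve p q θ 1 =
    Complex.I * (√((p : ℝ) / (p + q)) : ℂ) * (Complex.exp (θ * Complex.I) ^ q)⁻¹ := by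
  rw [← Complex.exp_nat_mul, ← Complex.exp_neg]
  simp only [curve, PiLp.toLp_apply, Matrix.cons_val_one, Matrix.cons_val_fin_one]
  congr 2; push_cast; ring

/-- The ratio of two points of the curve whose coordinates agree up to signs. -/
lemma exists_pow_eq_of_smul_curve {p q : ℕ} (hp : 0 < p) (hq : 0 < q) {r r' θ θ' s s' : ℝ}
    (hr : 0 < r) (hr' : 0 ≤ r') (hs : IsSign s) (hs' : IsSign s')
    (h0 : (r : ℂ) * curve p q θ 0 = r' * (s * curve p q θ' 0))
    (h1 : (r : ℂ) * curve p q θ 1 = r' * (s' * curve p q θ' 1)) :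
    ∃ w : ℂ, w ^ p = s ∧ w ^ q = s' := by
  have hs1 : |s| = 1 := by rcases hs with rfl | rfl <;> simp
  have ha : √((q : ℝ) / (p + q)) ≠ 0 := by positivity
  have hb : √((p : ℝ) / (p + q)) ≠ 0 := by positivity
  have hrr : r = r' := by
    have h2 := congrArg norm h0
    rw [norm_mul, norm_mul, norm_mul, norm_curve_zero, norm_curve_zero, Complex.norm_real,
      Complex.norm_real, Complex.norm_real, Real.norm_of_nonneg hr.le, Real.norm_of_nonneg hr',
      Real.norm_eq_abs, hs1, one_mul] at h2
    exact mul_right_cancel₀ ha h2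
  subst hrr
  have hrc : (r : ℂ) ≠ 0 := Complex.ofReal_ne_zero.2 hr.ne'
  have h0' := mul_left_cancel₀ hrc h0
  have h1' := mul_left_cancel₀ hrc h1
  rw [curve_zero_eq, curve_zero_eq, mul_left_comm] at h0'
  rw [curve_one_eq, curve_one_eq, mul_left_comm] at h1'
  have h2 := mul_left_cancel₀ (Complex.ofReal_ne_zero.2 ha) h0'
  have h3 := mul_left_cancel₀ (mul_ne_zero Complex.I_ne_zero (Complex.ofReal_ne_zero.2 hb)) h1'
  have hne := Complex.exp_ne_zero (θ * Complex.I)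
  have hne' := Complex.exp_ne_zero (θ' * Complex.I)
  have hs2 : (s' : ℂ) * s' = 1 := by exact_mod_cast hs'.mul_self
  refine ⟨Complex.exp (θ * Complex.I) / Complex.exp (θ' * Complex.I), ?_, ?_⟩
  · rw [div_pow, h2, mul_div_cancel_right₀ _ (pow_ne_zero _ hne')]
  · have h4 : Complex.exp (θ * Complex.I) ^ q = s' * Complex.exp (θ' * Complex.I) ^ q := by
      rw [← inv_inj, h3, mul_inv, inv_eq_of_mul_eq_one_left hs2]
    rw [div_pow, h4, mul_div_cancel_right₀ _ (pow_ne_zero _ hne')]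

/-- A common point other than the origin gives $w$ with $w^p=1$, $w^q=-1$ if $p$ is odd, or
$w^p=-1$, $w^q=1$ if $p$ is even. In the second case $q$ is odd by coprimality. Either way,
evaluating $w^{pq}$ in two orders gives $1=-1$. -/
lemma swCone_inter_companionCone {p q : ℕ} (hp : 0 < p) (hq : 0 < q) (hpq : p.Coprime q) :
    swCone p q ∩ companionCone p q = {0} := by
  refine Set.Subset.antisymm ?_ (Set.singleton_subset_iff.2 ⟨zero_mem_cone _, zero_mem_cone _⟩)
  rintro x ⟨⟨r, hr, θ, -, rfl⟩, ⟨r', hr', θ', -, h⟩⟩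
  by_contra hx
  have hr0 : 0 < r := hr.lt_of_ne fun h0 => hx (by simp [← h0])
  have h0 := congrArg (fun z : C2 => z 0) h
  have h1 := congrArg (fun z : C2 => z 1) h
  simp only [PiLp.smul_apply, Complex.real_smul, companionCurve] at h0 h1
  by_cases hodd : Odd p
  · simp only [if_pos hodd, PiLp.toLp_apply, Matrix.cons_val_zero, Matrix.cons_val_one,
      Matrix.cons_val_fin_one] at h0 h1
    obtain ⟨w, h2, h3⟩ := exists_pow_eq_of_smul_curve hp hq hr0 hr' isSign_one isSign_neg_one
      (by simpa using h0) (by simpa using h1)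
    have h4 : w ^ (p * q) = 1 := by rw [pow_mul, h2]; simp
    rw [mul_comm, pow_mul, h3] at h4
    norm_num [hodd.neg_pow] at h4
  · have hqodd : Odd q := by
      rw [← Nat.not_even_iff_odd]
      intro hq2
      have := Nat.dvd_gcd (Nat.not_odd_iff_even.1 hodd).two_dvd hq2.two_dvd
      rw [hpq] at this
      norm_num at this
    simp only [if_neg hodd, PiLp.toLp_apply, Matrix.cons_val_zero, Matrix.cons_val_one,
      Matrix.cons_val_fin_one] at h0 h1
    obtain ⟨w, h2, h3⟩ := exists_pow_eq_of_smul_curve hp hq hr0 hr' isSign_neg_one isSign_one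
      (by simpa using h0) (by simpa using h1)
    have h4 : w ^ (p * q) = 1 := by rw [mul_comm, pow_mul, h3]; simp
    rw [pow_mul, h2] at h4
    norm_num [hqodd.neg_pow] at h4

end SchoenWolfson
end

theorem theorem1p1 (p q : ℕ) (hp : 0 < p) (hq : 0 < q) (hpq : Nat.Coprime p q) (hne : p ≠ q) :
    SchoenWolfson.swCone p q ∩ SchoenWolfson.companionCone p q = {0} ∧
    ∃ V : ℝ → SchoenWolfson.Varifold,
      SchoenWolfson.IsBrakkeMotion V ∧
      SchoenWolfson.HasNoMassLoss V ∧
      (∃ (M : SchoenWolfson.SmoothSurface) (F : M.carrier → SchoenWolfson.C2) (c : ℝ), c < 0 ∧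
        ∀ t < 0,
          SchoenWolfson.IsHamiltonianStationary M (fun x => Real.sqrt (t / c) • F x) ∧
          SchoenWolfson.IsSelfSimilar M (fun x => Real.sqrt (t / c) • F x) t ∧
          SchoenWolfson.IsVarifoldOf M (fun x => Real.sqrt (t / c) • F x) (V t)) ∧
      (∃ (M : SchoenWolfson.SmoothSurface) (F : M.carrier → SchoenWolfson.C2) (c : ℝ), 0 < c ∧
        ∀ t > 0,
          SchoenWolfson.IsHamiltonianStationary M (fun x => Real.sqrt (t / c) • F x) ∧
          SchoenWolfson.IsSelfSimilar M (fun x => Real.sqrt (t / c) • F x) t ∧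
          SchoenWolfson.IsVarifoldOf M (fun x => Real.sqrt (t / c) • F x) (V t)) ∧
      (V 0).toMeasure =
        SchoenWolfson.coneMeasure (SchoenWolfson.curve p q) +
          SchoenWolfson.coneMeasure (SchoenWolfson.companionCurve p q) ∧
      SchoenWolfson.VarifoldTendsto V (𝓝[<] 0) (V 0) ∧
      SchoenWolfson.VarifoldTendsto V (𝓝[>] 0) (V 0) := by
  obtain ⟨M, F, c, hc, h⟩ :=
    SchoenWolfson.exists_homothety hp hq hne SchoenWolfson.isSign_neg_one
  obtain ⟨M', F', c', hc', h'⟩ :=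
    SchoenWolfson.exists_homothety hp hq hne SchoenWolfson.isSign_one
  refine ⟨SchoenWolfson.swCone_inter_companionCone hp hq hpq, SchoenWolfson.motion hp hq,
    SchoenWolfson.isBrakkeMotion_motion hp hq hne, SchoenWolfson.hasNoMassLoss_motion hp hq hne,
    ⟨M, F, c, by linarith, fun t ht => h t (by linarith)⟩,
    ⟨M', F', c', by linarith, fun t ht => h' t (by linarith)⟩, ?_, ?_, ?_⟩
  · rw [SchoenWolfson.toMeasure_motion, mul_zero, zero_mul,
      SchoenWolfson.leafMeasure_zero hp hq hpq]
  · exact fun f hf hc =>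
      (SchoenWolfson.varifoldTendsto_motion hp hq f hf hc).mono_left nhdsWithin_le_nhds
  · exact fun f hf hc =>
      (SchoenWolfson.varifoldTendsto_motion hp hq f hf hc).mono_left nhdsWithin_le_nhds
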